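/- Let $A$ be a regular 2-dimensional local ring of characteristic $p>0$ with maximal ideal $\mathfrak m$, algebraically closed residue field $k$ and fraction field $K$. Let $L/K$ be a cyclic extension of degree $p$, and $B$ the integral closure of $A$ in $L$. For distinct primes $\mathfrak p,\mathfrak p'$ of $A$ with $\dim A/\mathfrak p=\dim A/\mathfrak p'=1$, let $(F_{\mathfrak p}.F_{\mathfrak p'})$ be the length of $A/(\mathfrak p+\mathfrak p')$ (which is its dimension over $k$ when $k\subseteq A$), and put $(F_{\mathfrak p}.F_{\mathfrak p})=\infty$. Let $\mathfrak p_1,\dots,\mathfrak p_d$ be the distinct primes $\mathfrak p$ with $\dim A/\mathfrak p=1$ at which $L/K$ is ramified (an inseparable residue field extension counts as ramification). Assume that the branch divisor is non-empty and strictly normal crossing: $1\le d\le 2$, the rings $A/\mathfrak p_i$ are regular, and $(F_{\mathfrak p_1}.F_{\mathfrak p_2})=1$ if $d=2$. Let $U_A$ be the set of primes $\mathfrak p\notin\{\mathfrak p_1,\dots,\mathfrak p_d\}$ of $A$ such that $A/\mathfrak p$ is regular of dimension $1$. For $\mathfrak p\in U_A$ let $\mathfrak q$ be a prime of $B$ over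 $\mathfrak p$, and let $L(\mathfrak q)/K(\mathfrak p)$ be the extension of the fraction fields of $B/\mathfrak q$ and $A/\mathfrak p$. If its ramification index over the discrete valuation ring $A/\mathfrak p$ equals $p$, let $h_{\mathfrak p}(L/K)$ be the largest $i$ such that the lower ramification group $G_i$ of $L(\mathfrak q)/K(\mathfrak p)$ has order $p$; otherwise let $h_{\mathfrak p}(L/K)=0$. For integers $r\ge1$ and $n\ge0$ put $$J_n(\mathfrak p)=\{\mathfrak p'\in U_A : (F_{\mathfrak p'}.F_{\mathfrak p})\ge n+1\},$$ $$T_r=\{\mathfrak p\in U_A : (F_{\mathfrak p}.F_{\mathfrak p_1})=r,\text{ and } (F_{\mathfrak p}.F_{\mathfrak p_2})=1\text{ if }d=2\},\qquad T_{r,n}=\{J_n(\mathfrak p):\mathfrak p\in T_r\}.$$ Let $su_{1,r}(L/K)$ be the least $s\ge0$ such that $h_{\mathfrak p}(L/K)=h_{\mathfrak p'}(L/K)$ for all $\mathfrak p,\mathfrak p'\in T_r$ with $(F_{\mathfrak p}.F_{\mathfrak p'})\ge s+1$. Let $T,U$ generate $\mathfrak m$, with $\mathfrak p_1=(T)$ and,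 if $d=2$, $\mathfrak p_2=(U)$. Let $\lambda:k\to A$ be a section of level $n$, i.e. a map lifting the identity of $k$ such that the induced map $k\to A/\mathfrak m^n$ is a ring homomorphism. For $c=(c_r,\dots,c_n)\in k^{n+1-r}$ put $$f_c=\begin{cases}-U+\sum_{i=1}^n\lambda(c_i)T^i,& r=d=1,\\ -T+\sum_{i=r}^n\lambda(c_i)U^i,&\text{otherwise.}\end{cases}$$ Let $V_{r,n}$ be the whole affine space $k^{n+1-r}$ if $r=d=1$, and its open part $\{c_r\ne0\}$ otherwise; if $n<r$, let $V_{r,n}$ be one point, and let the sum in $f_c$ be empty. For any ideal $I$ of $A$ let $J_n(I)$ be the set of $\mathfrak p'\in U_A$ such that $A/(\mathfrak p'+I)$ has length at least $n+1$. Then, for every $r\ge1$ and every $n\ge su_{1,r}(L/K)$, the map $c\mapsto J_n((f_c))$ is a bijection $V_{r,n}\to T_{r,n}$, and for every integer $s\ge0$ the set $$\{J_n(\mathfrak p) : \mathfrak p\in T_r,\ h_{\mathfrak p}(L/K)\le s\}$$ corresponds under this bijection to a Zariski-closed subset of $V_{r,n}$ (the set of common zeros in $V_{r,n}$ of a set of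 polynomials in $c_r,\dots,c_n$ over $k$). -/

import Mathlib

open IsLocalRing

namespace SurfaceJump

/-- The intersection number `(F_𝔭 . F_𝔮)`: the length of the `A`-module `A / (𝔭 + 𝔮)`, with values
in `ℕ∞`. (When `A` is local, every simple subquotient is the residue field `k`, so that this is the
dimension over `k`. For `𝔭 = 𝔮` of positive-dimensional quotient it is `⊤`.) -/
noncomputable def interNum {A : Type*} [CommRing A] (𝔭 𝔮 : Ideal A) : ℕ∞ :=
  Module.length A (A ⧸ (𝔭 ⊔ 𝔮))

/-- The primes `𝔭` of `A` with `dim (A / 𝔭) = 1`. -/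
def spec₁ (A : Type*) [CommRing A] : Set (Ideal A) :=
  {𝔭 | 𝔭.IsPrime ∧ ringKrullDim (A ⧸ 𝔭) = 1}

/-- The primes in `spec₁ A` at which `L` is ramified: some prime `𝔮` over `𝔭` of the integral
closure `B` of `A` in `L` is not unramified over `A`. (Unramified includes separability of the
residue field extension.) -/
def branchPrimes (A L : Type*) [CommRing A] [Field L] [Algebra A L] : Set (Ideal A) :=
  {𝔭 | 𝔭 ∈ spec₁ A ∧ ∃ (𝔮 : Ideal (integralClosure A L)) (_ : 𝔮.IsPrime),
    𝔮.under A = 𝔭 ∧ ¬ Algebra.IsUnramifiedAt A 𝔮}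

/-- `𝔭₁, …, 𝔭_d` (here `P 0, …, P (d - 1)`) is an enumeration without repetition of the ramified
primes, there is at least one of them, and the branch divisor is strictly normal crossing. -/
structure IsNormalCrossingBranch (A L : Type*) [CommRing A] [Field L] [Algebra A L]
    {d : ℕ} (P : Fin d → Ideal A) : Prop where
  one_le : 1 ≤ d
  le_two : d ≤ 2
  injective : Function.Injective P
  range_eq : Set.range P = branchPrimes A L
  regular : ∀ i, IsRegularLocalRing (A ⧸ P i)
  transversal : ∀ i j, i ≠ j → interNum (P i) (P j) = 1

/-- `U_A`: the primes `𝔭` with `A / 𝔭` one-dimensional and regular, and `L` unramified at `𝔭`. -/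
def regularUnramified (A L : Type*) [CommRing A] [Field L] [Algebra A L] : Set (Ideal A) :=
  {𝔭 | 𝔭 ∈ spec₁ A ∧ IsRegularLocalRing (A ⧸ 𝔭) ∧ 𝔭 ∉ branchPrimes A L}

section RamificationGroups

variable (R E : Type*) [CommRing R] [CommRing E] [Algebra R E]

/-- The `i`-th lower ramification group at an ideal `M` of the integral closure `C` of `R` in `E`:
the `σ` with `σ x ≡ x mod M ^ (i + 1)` for all `x ∈ C`. When `E` is a field extension of the
fraction field of a domain `R`, the `R`-automorphisms of `E` are the automorphisms over
that fraction field. -/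
def lowerRamificationGroup (M : Ideal (integralClosure R E)) (i : ℕ) : Subgroup (E ≃ₐ[R] E) where
  carrier := {σ | ∀ x : integralClosure R E, σ.mapIntegralClosure x - x ∈ M ^ (i + 1)}
  one_mem' := fun x ↦ by
    have : (1 : E ≃ₐ[R] E).mapIntegralClosure x = x := Subtype.ext rfl
    rw [this, sub_self]; exact zero_mem _
  mul_mem' := fun {σ τ} hσ hτ x ↦ by
    have : (σ * τ).mapIntegralClosure x = σ.mapIntegralClosure (τ.mapIntegralClosure x) :=
      Subtype.ext rfl
    have h := add_mem (hσ (τ.mapIntegralClosure x)) (hτ x)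
    rw [this]
    simpa using h
  inv_mem' := fun {σ} hσ x ↦ by
    have h := hσ ((σ⁻¹).mapIntegralClosure x)
    have e : σ.mapIntegralClosure ((σ⁻¹).mapIntegralClosure x) = x :=
      Subtype.ext (σ.apply_symm_apply x.1)
    rw [e] at h
    exact sub_mem_comm_iff.mp h

/-- The ramification jump of an extension `E` of the fraction field of a discrete valuation
ring `R` that is trivial or Galois of prime degree `p`: if the ramification index is `p`, it is
`max {i | |G_i| = p}`; otherwise it is `0` (the supremum of the empty set). The maximal ideal `M`
is unique if its ramification index is `p`. -/
noncomputable def ramificationJump (p : ℕ) : ℕ :=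
  sSup {i : ℕ | ∃ M : Ideal (integralClosure R E), M.IsMaximal ∧ M.ramificationIdx R = p ∧
    Nat.card (lowerRamificationGroup R E M i) = p}

end RamificationGroups

open Classical in
/-- `h_𝔭(L/K)`: the ramification jump of `L(𝔮)/K(𝔭)`, the extension of the fraction fields of
`B / 𝔮` and `A / 𝔭`, where `B` is the integral closure of `A` in `L` and `𝔮` is a prime of `B`
over `𝔭` (all of them are conjugate when `L` is Galois). -/
noncomputable def jump (A L : Type*) [CommRing A] [Field L] [Algebra A L] (p : ℕ)
    (𝔭 : Ideal A) : ℕ :=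
  if h : ∃ 𝔮 : Ideal (integralClosure A L), 𝔮.IsPrime ∧ 𝔮.under A = 𝔭 then
    ramificationJump (A ⧸ h.choose.under A)
      (FractionRing (integralClosure A L ⧸ h.choose)) p
  else 0

/-- The jet `J_n(𝔭)` of order `n`: the `𝔭' ∈ U_A` with `(F_𝔭' . F_𝔭) ≥ n + 1`. -/
def jet (A L : Type*) [CommRing A] [Field L] [Algebra A L] (n : ℕ) (𝔭 : Ideal A) :
    Set (Ideal A) :=
  {𝔭' | 𝔭' ∈ regularUnramified A L ∧ ((n + 1 : ℕ) : ℕ∞) ≤ interNum 𝔭' 𝔭}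

/-- `T_r`: the `𝔭 ∈ U_A` with `(F_𝔭 . F_𝔭₁) = r` and, if `d = 2`, `(F_𝔭 . F_𝔭₂) = 1`. -/
def tangentPrimes (A L : Type*) [CommRing A] [Field L] [Algebra A L] {d : ℕ}
    (P : Fin d → Ideal A) (r : ℕ) : Set (Ideal A) :=
  {𝔭 | 𝔭 ∈ regularUnramified A L ∧
    ∀ i : Fin d, interNum 𝔭 (P i) = if (i : ℕ) = 0 then (r : ℕ∞) else 1}

/-- `T_{r,n}`: the set of the jets of order `n` of elements of `T_r`. -/
def tangentJets (A L : Type*) [CommRing A] [Field L] [Algebra A L] {d : ℕ}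
    (P : Fin d → Ideal A) (r n : ℕ) : Set (Set (Ideal A)) :=
  jet A L n '' tangentPrimes A L P r

/-- `su_{1,r}(L/K)`: the minimal `s` such that `h_𝔭 = h_𝔭'` whenever `𝔭, 𝔭' ∈ T_r` and
`(F_𝔭 . F_𝔭') ≥ s + 1`. -/
noncomputable def sufficientJetOrder (A L : Type*) [CommRing A] [Field L] [Algebra A L] (p : ℕ)
    {d : ℕ} (P : Fin d → Ideal A) (r : ℕ) : ℕ :=
  sInf {s : ℕ | ∀ 𝔭 ∈ tangentPrimes A L P r, ∀ 𝔭' ∈ tangentPrimes A L P r,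
    ((s + 1 : ℕ) : ℕ∞) ≤ interNum 𝔭 𝔭' → jump A L p 𝔭 = jump A L p 𝔭'}

/-- Regular local parameters `T, U` of `A` with `𝔭₁ = (T)` and, if `d = 2`, `𝔭₂ = (U)`. -/
def IsAdapted {A : Type*} [CommRing A] [IsLocalRing A] {d : ℕ} (P : Fin d → Ideal A)
    (T U : A) : Prop :=
  Ideal.span {T, U} = maximalIdeal A ∧
    ∀ i : Fin d, P i = if (i : ℕ) = 0 then Ideal.span {T} else Ideal.span {U}

/-- `lam : k → A` is a section of level `n`: it lifts the identity of `k`, and its reduction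
`k → A / 𝔪 ^ n` is a ring homomorphism. (If `A` has characteristic `p` and `k` is perfect, there
is exactly one ring homomorphism `k → A / 𝔪 ^ n` lifting the identity, the one that comes from the
coefficient field `k ⊆ k[[T, U]]` of the completion of `A`.) -/
structure IsSection {A : Type*} [CommRing A] [IsLocalRing A] (n : ℕ)
    (lam : ResidueField A → A) : Prop where
  residue_eq : ∀ x, residue A (lam x) = x
  map_one : lam 1 - 1 ∈ maximalIdeal A ^ n
  map_add : ∀ x y, lam (x + y) - (lam x + lam y) ∈ maximalIdeal A ^ n
  map_mul : ∀ x y, lam (x * y) - lam x * lam y ∈ maximalIdeal A ^ n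

/-- The equation of a germ with given jet coefficients `c_r, …, c_n`:
`-U + ∑ lam(c_i) T ^ i` (`1 ≤ i ≤ n`) if `r = 1` and `d = 1`, and
`-T + ∑ lam(c_i) U ^ i` (`r ≤ i ≤ n`) otherwise. -/
noncomputable def germ {A : Type*} [CommRing A] [IsLocalRing A] (d r n : ℕ) (T U : A)
    (lam : ResidueField A → A) (c : Finset.Icc r n → ResidueField A) : A :=
  if r = 1 ∧ d = 1 then -U + ∑ i, lam (c i) * T ^ (i : ℕ)
  else -T + ∑ i, lam (c i) * U ^ (i : ℕ)

/-- The space of the jet coefficients: all of affine space if `r = 1` and `d = 1`, and the open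
part of affine space where the coordinate `c_r` does not vanish otherwise. -/
def coeffSpace (k : Type*) [Field k] (d r n : ℕ) : Set (Finset.Icc r n → k) :=
  {c | (r = 1 ∧ d = 1) ∨ ∀ i : Finset.Icc r n, (i : ℕ) = r → c i ≠ 0}

/-- The identification of `coeffSpace` with `T_{r,n}`: `c ↦ J_n((germ c))`. -/
noncomputable def coeffJet (A L : Type*) [CommRing A] [IsLocalRing A] [Field L] [Algebra A L]
    (d r n : ℕ) (T U : A) (lam : ResidueField A → A) (c : Finset.Icc r n → ResidueField A) :
    Set (Ideal A) :=
  jet A L n (Ideal.span {germ d r n T U lam c})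

/-- A set of jets is Zariski-closed in `T_{r,n}`: it corresponds, under `coeffJet`, to
the intersection of `coeffSpace` with the zero locus of an ideal of polynomials. -/
def IsZariskiClosed (A L : Type*) [CommRing A] [IsLocalRing A] [Field L] [Algebra A L]
    (d r n : ℕ) (T U : A) (lam : ResidueField A → A) (Z : Set (Set (Ideal A))) : Prop :=
  ∃ I : Ideal (MvPolynomial (Finset.Icc r n) (ResidueField A)),
    Z = coeffJet A L d r n T U lam ''
      (coeffSpace (ResidueField A) d r n ∩ MvPolynomial.zeroLocus (ResidueField A) I)

end SurfaceJump

open SurfaceJump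

/-!
Choose the parameters `X, Y` of `A` to be `T, U` if `r = d = 1`, and `U, T` otherwise. A curve `𝔭` in
`T_r` is then transversal to `X = 0`, so that `x`, the class of `X`, is a uniformizer of the discrete
valuation ring `A ⧸ 𝔭`, and expanding `Y` in powers of `x` gives
`Y ≡ ∑ lam(c_i) X ^ i` modulo `𝔭 + 𝔪 ^ (n + 1)` with uniquely determined coefficients `c_i`. The
conditions on the intersection numbers say exactly that the expansion starts at `i = r`, with `c_r ≠ 0`
unless `r = d = 1`; these are the families of graphs of `IsGraphFamily`. Since a jet of order `n`
depends only on `𝔭 + 𝔪 ^ (n + 1)`, this gives the bijection (`IsGraphFamily.bijOn`).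

For the ramification jumps, one Artin-Schreier equation is used for all curves at once. Let `δ` be an
equation of the branch divisor. Away from `δ = 0` the integral closure `B` of `A` in `L` is
unramified, so inertia is trivial and, by independence of characters modulo primes, the trace is
nonzero modulo each such prime. Hence some power `ε = δ ^ j` is a trace from `B`
(`exists_pow_eq_sum_pow`; `A` is factorial, hence integrally closed). The additive form of
Hilbert 90 then yields `z ∈ B` with `σ z = z - ε`, so that `z / ε` satisfies
`θ ^ p - θ = α / ε ^ p` with `α ∈ A`, and the discriminant of `z` is up to sign a power of `ε`
(`exists_artinSchreier_datum`). This equation can be reduced modulo every curve `𝔭` on which `δ` does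
not vanish, and its root generates the residue extension there (`artinSchreier_quotient`).

Over the discrete valuation ring `A ⧸ 𝔭` with algebraically closed residue field, the right-hand side
has a reduced form modulo the elements `c ^ p - c`: each term `a x ^ (-i p ^ e)` is replaced by
`a ^ (1 / p ^ e) x ^ (-i)`. The jump is the largest pole order left (`ramificationJump_le_iff`, from
the computation of the ramification groups in `ramificationJump_eq` and
`ramificationJump_eq_zero`). Up to a high power of `x`, the principal part is a polynomial expression
in the `c_i` and `c_r⁻¹`; raising the reduced coefficients to a power of `p` and clearing the
denominators makes their vanishing a polynomial condition
(`IsGraphFamily.exists_polynomials`). In particular the jump depends on a jet of some finite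
order `N` only, so that the infimum defining the sufficient jet order is attained. For
`n` at least that order, the condition in order `N` descends to order `n` by substituting constants
for the remaining coefficients (`IsGraphFamily.exists_zeroLocus`).
-/

/-! ### Artin-Schreier extensions of fields -/

section ArtinSchreier
open Polynomial

variable {p : ℕ} [Fact p.Prime] {F E : Type*} [Field F] [Field E] [Algebra F E]
  {y : E} {b : F}

theorem artinSchreier_separable (p : ℕ) [Fact p.Prime] [CharP F p] (b : F) :
    (X ^ p - X - C b : F[X]).Separable := by
  have h : derivative (X ^ p - X - C b : F[X]) = -1 := by
    simp [derivative_X_pow]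
  rw [Polynomial.separable_def, h]
  exact ⟨0, -1, by ring⟩

theorem artinSchreier_natDegree (b : F) : (X ^ p - X - C b : F[X]).natDegree = p := by
  have hp : 1 < p := (Fact.out : p.Prime).one_lt
  have : (X ^ p - X - C b : F[X]) = X ^ p - (X + C b) := by ring
  rw [this, natDegree_sub_eq_left_of_natDegree_lt] <;> simp [hp]

theorem artinSchreier_monic {F : Type*} [CommRing F] [Nontrivial F] (b : F) :
    (X ^ p - X - C b : F[X]).Monic := by
  have hp : 1 < p := (Fact.out : p.Prime).one_lt
  have : (X ^ p - X - C b : F[X]) = X ^ p - (X + C b) := by ring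
  rw [this]
  apply monic_X_pow_sub
  simp [degree_X_add_C, hp]

theorem artinSchreier_aeval {p : ℕ} {F : Type*} [CommRing F] [Algebra F E] {b : F}
    (hy : y ^ p - y = algebraMap F E b) :
    aeval y (X ^ p - X - C b : F[X]) = 0 := by
  simp [hy]

theorem artinSchreier_isIntegral {F : Type*} [CommRing F] [Nontrivial F] [Algebra F E] {b : F}
    (hy : y ^ p - y = algebraMap F E b) : IsIntegral F y :=
  ⟨_, artinSchreier_monic (p := p) b, by simpa [aeval_def] using artinSchreier_aeval hy⟩

theorem artinSchreier_minpoly_dvd {p : ℕ} (hy : y ^ p - y = algebraMap F E b) :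
    minpoly F y ∣ (X ^ p - X - C b : F[X]) := minpoly.dvd _ _ (artinSchreier_aeval hy)

theorem artinSchreier_finiteDimensional (hy : y ^ p - y = algebraMap F E b)
    (hgen : IntermediateField.adjoin F {y} = ⊤) :
    FiniteDimensional F E := by
  have := IntermediateField.adjoin.finiteDimensional (artinSchreier_isIntegral hy)
  rw [hgen] at this
  exact (IntermediateField.topEquiv (F := F) (E := E)).toLinearEquiv.finiteDimensional

theorem artinSchreier_finrank_le (hy : y ^ p - y = algebraMap F E b)
    (hgen : IntermediateField.adjoin F {y} = ⊤) :
    Module.finrank F E ≤ p := by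
  have := IntermediateField.adjoin.finrank (artinSchreier_isIntegral hy)
  rw [hgen, IntermediateField.finrank_top'] at this
  rw [this, ← artinSchreier_natDegree (p := p) b]
  exact natDegree_le_of_dvd (artinSchreier_minpoly_dvd hy) (artinSchreier_monic b).ne_zero

theorem artinSchreier_isSeparable [CharP F p] (hy : y ^ p - y = algebraMap F E b)
    (hgen : IntermediateField.adjoin F {y} = ⊤) :
    Algebra.IsSeparable F E := by
  have h : IsSeparable F y :=
    Separable.of_dvd (artinSchreier_separable p b) (artinSchreier_minpoly_dvd hy)
  have := (IntermediateField.isSeparable_adjoin_simple_iff_isSeparable F E).2 h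
  rw [hgen] at this
  exact AlgEquiv.Algebra.isSeparable (IntermediateField.topEquiv (F := F) (E := E))

theorem artinSchreier_isGalois [CharP F p] (hy : y ^ p - y = algebraMap F E b)
    (hgen : IntermediateField.adjoin F {y} = ⊤) :
    IsGalois F E := by
  have : CharP E p := charP_of_injective_algebraMap (algebraMap F E).injective p
  have : FiniteDimensional F E := artinSchreier_finiteDimensional hy hgen
  let : Algebra (ZMod p) E := ZMod.algebra E p
  have hsp : ((X ^ p - X - C b : F[X]).map (algebraMap F E)).Splits := by
    have h1 : (X ^ p - X : (ZMod p)[X]).Splits :=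
      GaloisField.splits_zmod_X_pow_sub_X p
    have h2 : ((X ^ p - X : (ZMod p)[X]).map (algebraMap (ZMod p) E)).Splits := h1.map _
    have h3 := h2.comp_X_sub_C y
    have h4 : (X ^ p - X - C b : F[X]).map (algebraMap F E) =
        ((X ^ p - X : (ZMod p)[X]).map (algebraMap (ZMod p) E)).comp (X - C y) := by
      simp only [Polynomial.map_sub, Polynomial.map_pow, map_X, map_C, sub_comp, pow_comp, X_comp]
      rw [← hy, sub_pow_char, map_sub, map_pow]
      ring
    rw [h4]
    exact h3
  have : (X ^ p - X - C b : F[X]).IsSplittingField F E := by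
    refine ⟨hsp, ?_⟩
    rw [eq_top_iff]
    have h : Algebra.adjoin F {y} = ⊤ := by
      rw [← IntermediateField.adjoin_simple_toSubalgebra_of_isAlgebraic
        (artinSchreier_isIntegral hy).isAlgebraic, hgen]
      rfl
    rw [← h]
    apply Algebra.adjoin_mono
    rintro z rfl
    rw [mem_rootSet]
    exact ⟨(artinSchreier_monic b).ne_zero, artinSchreier_aeval hy⟩
  exact IsGalois.of_separable_splitting_field (artinSchreier_separable p b)

end ArtinSchreier

/-! ### Extensions of discrete valuation rings -/

section LocalExtension
open Polynomial

variable {R E : Type*} (F : Type*) [CommRing R] [IsDomain R] [IsDiscreteValuationRing R]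
  [Field F] [Field E] [Algebra R F] [IsFractionRing R F] [Algebra R E] [Algebra F E]
  [IsScalarTower R F E] [FiniteDimensional F E] [Algebra.IsSeparable F E]

/-- From `∑ e f = [E : F]`: if one ramification index is as large as the degree, then the maximal ideal is
unique. -/
theorem ramificationIdx_le_finrank_and_eq_of_isMaximal
    (M : Ideal (integralClosure R E)) [M.IsMaximal] :
    0 < M.ramificationIdx R ∧ M.ramificationIdx R ≤ Module.finrank F E ∧
    (M.ramificationIdx R = Module.finrank F E →
      ∀ M' : Ideal (integralClosure R E), M'.IsMaximal → M' = M) := by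
  classical
  have hinj : Function.Injective (algebraMap R E) := by
    rw [IsScalarTower.algebraMap_eq R F E]
    exact (algebraMap F E).injective.comp (IsFractionRing.injective R F)
  have : FaithfulSMul R E := (faithfulSMul_iff_algebraMap_injective R E).2 hinj
  have : Module.IsTorsionFree R E := inferInstance
  have : Module.Finite R (integralClosure R E) := IsIntegralClosure.finite R F E _
  have : Module.Free R (integralClosure R E) := IsIntegralClosure.module_free R F E _
  have hu : ∀ N : Ideal (integralClosure R E), N.IsMaximal → N.under R = maximalIdeal R :=
    fun N hN ↦ eq_maximalIdeal (Ideal.isMaximal_comap_of_isIntegral_of_isMaximal N)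
  have hm : ∀ N : Ideal (integralClosure R E), N.IsMaximal →
      N ∈ (maximalIdeal R).primesOver (integralClosure R E) :=
    fun N hN ↦ ⟨hN.isPrime, ⟨(hu N hN).symm⟩⟩
  have : Fintype ((maximalIdeal R).primesOver (integralClosure R E)) :=
    (Algebra.QuasiFinite.finite_primesOver (maximalIdeal R)).fintype
  have hs := Ideal.sum_ramification_inertia_eq_finrank (maximalIdeal R) (integralClosure R E)
  rw [IsIntegralClosure.rank R F E] at hs
  have hpos : ∀ N : Ideal (integralClosure R E), N.IsMaximal →
      0 < N.ramificationIdx R ∧ 0 < N.inertiaDeg R :=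
    fun N hN ↦ ⟨N.ramificationIdx_pos R, N.inertiaDeg_pos R⟩
  have hM := hpos M inferInstance
  refine ⟨hM.1, ?_, fun h M' hM' ↦ ?_⟩
  · rw [← hs]
    refine le_trans (Nat.le_mul_of_pos_right _ hM.2) ?_
    exact Finset.single_le_sum (f := fun q : (maximalIdeal R).primesOver (integralClosure R E) ↦
      q.1.ramificationIdx R * q.1.inertiaDeg R) (fun _ _ ↦ Nat.zero_le _)
      (Finset.mem_univ ⟨M, hm M inferInstance⟩)
  · by_contra hne
    have h2 := Finset.add_le_sum
      (f := fun q : (maximalIdeal R).primesOver (integralClosure R E) ↦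
      q.1.ramificationIdx R * q.1.inertiaDeg R) (s := Finset.univ) (fun _ _ ↦ Nat.zero_le _)
      (i := ⟨M, hm M inferInstance⟩) (j := ⟨M', hm M' hM'⟩) (Finset.mem_univ _) (Finset.mem_univ _)
      (by simpa using Ne.symm hne)
    rw [hs, ← h] at h2
    have h3 := hpos M' hM'
    have h4 := Nat.mul_pos h3.1 h3.2
    have h5 := Nat.le_mul_of_pos_right (M.ramificationIdx R) hM.2
    simp only at h2
    omega

/-- The `R`-automorphisms of `E` are its automorphisms over the fraction field of `R`. -/
noncomputable def autEquivOfIsFractionRing (R E F : Type*) [CommRing R]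
    [Field F] [Field E] [Algebra R F] [IsFractionRing R F] [Algebra R E] [Algebra F E]
    [IsScalarTower R F E] : (E ≃ₐ[R] E) ≃ (E ≃ₐ[F] E) where
  toFun σ := AlgEquiv.ofBijective
    (AlgHom.extendScalarsOfIsLocalization F (nonZeroDivisors R) (σ : E →ₐ[R] E)) σ.bijective
  invFun σ := σ.restrictScalars R
  left_inv σ := by ext; rfl
  right_inv σ := by ext; rfl

end LocalExtension

/-! ### The ramification jump of an integral Artin-Schreier equation -/

section ValuationLemmas
open Polynomial WithZero

theorem Valuation.map_natCast_le_one' {E Γ : Type*} [Ring E] [LinearOrderedCommMonoidWithZero Γ]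
    (w : Valuation E Γ) (i : ℕ) : w i ≤ 1 := by
  induction i with
  | zero => simp
  | succ i ih => rw [Nat.cast_succ]; exact w.map_add_le ih (by simp)

theorem Valuation.map_one_add_pow_sub_le {E Γ : Type*} [CommRing E]
    [LinearOrderedCommMonoidWithZero Γ] (w : Valuation E Γ) {ε : E} (hε : w ε ≤ 1) (i : ℕ) :
    w ((1 + ε) ^ i - 1 - i * ε) ≤ w ε ^ 2 := by
  induction i with
  | zero => simp
  | succ i ih =>
    have : (1 + ε) ^ (i + 1) - 1 - (i + 1 : ℕ) * ε =
        ((1 + ε) ^ i - 1 - i * ε) * (1 + ε) + i * ε ^ 2 := by push_cast; ring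
    rw [this]
    refine w.map_add_le ?_ ?_
    · rw [map_mul]
      exact mul_le_of_le_of_le_one ih (w.map_add_le (by simp) hε)
    · rw [map_mul, map_pow]
      exact mul_le_of_le_one_left' (w.map_natCast_le_one' i)

/-- Terms of pairwise distinct valuation cannot cancel. -/
theorem Valuation.map_le_map_sum {E Γ ι : Type*} [Ring E] [LinearOrderedCommGroupWithZero Γ]
    (w : Valuation E Γ) (s : Finset ι) (f : ι → E)
    (hf : ∀ i ∈ s, ∀ j ∈ s, i ≠ j → w (f i) ≠ 0 → w (f i) ≠ w (f j)) {i : ι} (hi : i ∈ s) :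
    w (f i) ≤ w (∑ j ∈ s, f j) := by
  classical
  obtain ⟨k, hk, hmax⟩ := s.exists_max_image (fun j ↦ w (f j)) ⟨i, hi⟩
  by_cases h0 : w (f k) = 0
  · exact (hmax i hi).trans (by simp [h0])
  · rw [w.map_sum_eq_of_lt hk]
    · exact hmax i hi
    · intro j hj
      simp only [Finset.mem_sdiff, Finset.mem_singleton] at hj
      exact lt_of_le_of_ne (hmax j hj.1) (hf k hk j hj.1 (Ne.symm hj.2) h0).symm

end ValuationLemmas

section Jump
open Polynomial

/-- There is no residue field extension over an algebraically closed residue field. -/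
theorem exists_algebraMap_sub_mem {R E : Type*} [CommRing R] [IsLocalRing R] [Field E]
    [Algebra R E] [IsAlgClosed (ResidueField R)]
    (M : Ideal (integralClosure R E)) [M.IsMaximal] (z : integralClosure R E) :
    ∃ β : R, z - algebraMap R _ β ∈ M := by
  have hu : M.under R = maximalIdeal R :=
    eq_maximalIdeal (Ideal.isMaximal_comap_of_isIntegral_of_isMaximal M)
  have : M.LiesOver (maximalIdeal R) := ⟨hu.symm⟩
  let : Algebra (ResidueField R) (integralClosure R E ⧸ M) :=
    inferInstanceAs (Algebra (R ⧸ maximalIdeal R) (integralClosure R E ⧸ M))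
  have : Algebra.IsIntegral (ResidueField R) (integralClosure R E ⧸ M) :=
    inferInstanceAs (Algebra.IsIntegral (R ⧸ maximalIdeal R) (integralClosure R E ⧸ M))
  have hb := (IsAlgClosed.algebraMap_bijective_of_isIntegral (k := ResidueField R)
    (K := integralClosure R E ⧸ M)).2 (Ideal.Quotient.mk M z)
  obtain ⟨β, hβ⟩ := hb
  obtain ⟨β, rfl⟩ := Ideal.Quotient.mk_surjective β
  refine ⟨β, ?_⟩
  rw [← Ideal.Quotient.eq]
  exact hβ.symm

/-- The differences `σ y - y` lie in the prime field. -/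
theorem artinSchreier_aut_sub {p : ℕ} [Fact p.Prime] {F E : Type*} [Field F] [Field E]
    [Algebra F E] [CharP E p]
    {y : E} {b : F} (hy : y ^ p - y = algebraMap F E b) (σ : E ≃ₐ[F] E) :
    (σ y - y) ^ p = σ y - y := by
  have h : σ y ^ p - σ y = algebraMap F E b := by
    rw [← map_pow, ← map_sub, hy, AlgEquiv.commutes]
  rw [sub_pow_char]
  linear_combination h - hy

theorem artinSchreier_aut_ne {F E : Type*} [Field F] [Field E] [Algebra F E] {y : E}
    (hgen : IntermediateField.adjoin F {y} = ⊤) {σ : E ≃ₐ[F] E} (hσ : σ ≠ 1) : σ y - y ≠ 0 := by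
  intro h
  apply hσ
  ext z
  have hz : z ∈ IntermediateField.adjoin F {y} := by rw [hgen]; trivial
  induction hz using IntermediateField.adjoin_induction with
  | mem x hx => rw [Set.mem_singleton_iff.1 hx]; exact sub_eq_zero.1 h
  | algebraMap x => simp
  | add x y _ _ hx hy => simpa using congrArg₂ (· + ·) hx hy
  | inv x _ hx => simpa using hx
  | mul x y _ _ hx hy => simpa using congrArg₂ (· * ·) hx hy

theorem pow_pred_eq_one_of_pow_eq_self {p : ℕ} (hp : 1 < p) {E : Type*} [Field E] {j : E}
    (hj : j ^ p = j) (h0 : j ≠ 0) : j ^ (p - 1) = 1 := by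
  have : j ^ (p - 1) * j = 1 * j := by rw [← pow_succ, Nat.sub_add_cancel hp.le, hj, one_mul]
  exact mul_right_cancel₀ h0 this

variable {p : ℕ} [Fact p.Prime] {R E : Type*} (F : Type*) [CommRing R] [IsDomain R]
  [IsDiscreteValuationRing R]
  [Field F] [Field E] [Algebra R F] [IsFractionRing R F] [Algebra R E] [Algebra F E]
  [IsScalarTower R F E] {y : E}

/-- If the right-hand side is integral, then `σ y - y` is a unit for `σ ≠ 1`. Were the extension
totally ramified, then `σ y ≡ y` modulo the maximal ideal, since `y` is congruent to an element of `R`. -/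
theorem ramificationJump_eq_zero [IsAlgClosed (ResidueField R)] [CharP F p]
    {b : R} (hy : y ^ p - y = algebraMap F E (algebraMap R F b))
    (hgen : IntermediateField.adjoin F {y} = ⊤) :
    ramificationJump R E p = 0 := by
  have hp1 : 1 < p := (Fact.out : p.Prime).one_lt
  have : CharP E p := charP_of_injective_algebraMap (algebraMap F E).injective p
  have : FiniteDimensional F E := artinSchreier_finiteDimensional hy hgen
  have : Algebra.IsSeparable F E := artinSchreier_isSeparable hy hgen
  have : IsGalois F E := artinSchreier_isGalois hy hgen
  unfold ramificationJump
  rw [Set.eq_empty_of_forall_notMem (s := {i : ℕ | _}), csSup_empty, Nat.bot_eq_zero]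
  rintro i ⟨M, hM, he, -⟩
  obtain ⟨-, hle, hun⟩ := ramificationIdx_le_finrank_and_eq_of_isMaximal F M
  have hfr : Module.finrank F E = p :=
    le_antisymm (artinSchreier_finrank_le hy hgen) (he ▸ hle)
  have hun := hun (he.trans hfr.symm)
  have hcard : Nat.card (E ≃ₐ[F] E) = p := (IsGalois.card_aut_eq_finrank F E).trans hfr
  have : Nontrivial (E ≃ₐ[F] E) := by
    have : Finite (E ≃ₐ[F] E) := inferInstance
    exact Finite.one_lt_card_iff_nontrivial.1 (hcard ▸ hp1)
  obtain ⟨σ, hσ⟩ := exists_ne (1 : E ≃ₐ[F] E)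
  have hyint : IsIntegral R y :=
    artinSchreier_isIntegral (p := p) (b := b) (by rw [hy, ← IsScalarTower.algebraMap_apply])
  obtain ⟨β, hβ⟩ := exists_algebraMap_sub_mem M ⟨y, hyint⟩
  set τ : integralClosure R E ≃ₐ[R] integralClosure R E :=
    (σ.restrictScalars R).mapIntegralClosure
  have hτ : M.comap τ = M := hun _ (Ideal.comap_isMaximal_of_surjective τ τ.surjective)
  have h2 : τ (⟨y, hyint⟩ - algebraMap R _ β) ∈ M := by
    rw [← Ideal.mem_comap, hτ]; exact hβ
  have h3 : τ ⟨y, hyint⟩ - ⟨y, hyint⟩ ∈ M := by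
    rw [map_sub, AlgEquiv.commutes] at h2
    simpa using sub_mem h2 hβ
  apply hM.ne_top
  rw [Ideal.eq_top_iff_one]
  have h4 : (τ ⟨y, hyint⟩ - ⟨y, hyint⟩) ^ (p - 1) = 1 := by
    apply Subtype.ext
    exact pow_pred_eq_one_of_pow_eq_self hp1 (artinSchreier_aut_sub hy σ)
      (artinSchreier_aut_ne hgen hσ)
  rw [← h4]
  exact Ideal.pow_mem_of_mem _ h3 _ (by omega)

end Jump

/-! ### The ramification jump of an Artin-Schreier equation with a pole of order prime to `p` -/

section Jump
open Polynomial WithZero IsDedekindDomain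

variable {p : ℕ} [Fact p.Prime] {R E : Type*} (F : Type*) [CommRing R] [IsDomain R]
  [IsDiscreteValuationRing R]
  [Field F] [Field E] [Algebra R F] [IsFractionRing R F] [Algebra R E] [Algebra F E]
  [IsScalarTower R F E] {y : E}

/-- At a maximal ideal `M` of the integral closure, with ramification index `e`, there is a
valuation of `E` that takes the values `exp (e * n)` at the elements of the base field of order `-n`,
and whose powers of the valuation ideal are the powers of `M`. If `M` is the only maximal ideal, its
valuation ring is the integral closure. -/
theorem exists_valuation_of_isMaximal [FiniteDimensional F E] [Algebra.IsSeparable F E]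
    {t : R} (ht : Irreducible t) (M : Ideal (integralClosure R E)) (hM : M.IsMaximal) :
    ∃ w : Valuation E ℤᵐ⁰,
      (∀ u : Rˣ, w (algebraMap R E u) = 1) ∧
      w (algebraMap R E t) = exp (-(M.ramificationIdx R : ℤ)) ∧
      (∀ (z : integralClosure R E) (n : ℕ), w (z : E) ≤ exp (-(n : ℤ)) ↔ z ∈ M ^ n) ∧
      ((∀ M' : Ideal (integralClosure R E), M'.IsMaximal → M' = M) →
        ∀ z : E, w z ≤ 1 → IsIntegral R z) := by
  have hinj : Function.Injective (algebraMap R E) := by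
    rw [IsScalarTower.algebraMap_eq R F E]
    exact (algebraMap F E).injective.comp (IsFractionRing.injective R F)
  have : FaithfulSMul R E := (faithfulSMul_iff_algebraMap_injective R E).2 hinj
  have : IsDedekindDomain (integralClosure R E) := integralClosure.isDedekindDomain R F E
  have : IsFractionRing (integralClosure R E) E :=
    integralClosure.isFractionRing_of_finite_extension F E
  have hu : M.under R = maximalIdeal R :=
    eq_maximalIdeal (Ideal.isMaximal_comap_of_isIntegral_of_isMaximal M)
  have hlo : M.LiesOver (maximalIdeal R) := ⟨hu.symm⟩
  have htM : algebraMap R (integralClosure R E) t ∈ M := by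
    rw [← Ideal.mem_comap]
    change t ∈ M.under R
    rw [hu, ht.maximalIdeal_eq]
    exact Ideal.mem_span_singleton_self t
  have ht0 : algebraMap R (integralClosure R E) t ≠ 0 := by
    intro h
    apply ht.ne_zero
    apply hinj
    rw [IsScalarTower.algebraMap_apply R (integralClosure R E) E, h, map_zero, map_zero]
  have hM0 : M ≠ ⊥ := by
    rintro rfl
    exact ht0 htM
  let v : HeightOneSpectrum (integralClosure R E) := ⟨M, hM.isPrime, hM0⟩
  refine ⟨v.valuation E, fun u ↦ ?_, ?_, fun z n ↦ ?_, fun h z hz ↦ ?_⟩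
  · rw [IsScalarTower.algebraMap_apply R (integralClosure R E) E,
      HeightOneSpectrum.valuation_eq_one_iff_notMem]
    intro h
    exact hM.ne_top (Ideal.eq_top_of_isUnit_mem _ h (u.isUnit.map _))
  · rw [IsScalarTower.algebraMap_apply R (integralClosure R E) E,
      HeightOneSpectrum.valuation_of_algebraMap,
      HeightOneSpectrum.intValuation_eq_exp_neg_multiplicity _ ht0,
      Ideal.IsDedekindDomain.ramificationIdx_eq_multiplicity (maximalIdeal R) M,
      ht.maximalIdeal_eq, Ideal.map_span, Set.image_singleton]
    rw [ht.maximalIdeal_eq, Ideal.map_span, Set.image_singleton]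
    simpa using ht0
  · rw [← HeightOneSpectrum.intValuation_le_pow_iff_mem v,
      ← HeightOneSpectrum.valuation_of_algebraMap (K := E)]
    rfl
  · have := HeightOneSpectrum.mem_integers_of_valuation_le_one (R := integralClosure R E) E z
      (fun v' ↦ by
        have : v' = v := HeightOneSpectrum.ext (h v'.asIdeal v'.isMaximal)
        rwa [this])
    obtain ⟨c, rfl⟩ := this
    exact c.2

theorem exists_valuation_algebraMap_eq {w : Valuation E ℤᵐ⁰} {e : ℤ} {t : R} (ht : Irreducible t)
    (hwu : ∀ u : Rˣ, w (algebraMap R E u) = 1) (hwt : w (algebraMap R E t) = exp (-e))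
    {a : F} (ha : a ≠ 0) : ∃ k : ℤ, w (algebraMap F E a) = exp (e * k) := by
  obtain ⟨n, u, rfl⟩ := IsDiscreteValuationRing.exists_units_eq_smul_zpow_of_irreducible ht ha
  refine ⟨-n, ?_⟩
  rw [Units.smul_def, Algebra.smul_def, map_mul, map_mul, ← IsScalarTower.algebraMap_apply, hwu,
    map_zpow₀, map_zpow₀, ← IsScalarTower.algebraMap_apply, hwt, one_mul, ← exp_zsmul]
  congr 1
  simp [mul_comm]

/-- A pole of order `m` prime to `p` forces the ramification index `e ≤ p` to be `p`, because the order
of `y` is `-e m / p`. -/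
theorem artinSchreier_valuation_eq {w : Valuation E ℤᵐ⁰} {b : F}
    (hy : y ^ p - y = algebraMap F E b) {e m : ℕ} (he : 0 < e) (hep : e ≤ p) (hm : ¬ p ∣ m)
    (hb : w (algebraMap F E b) = exp ((e : ℤ) * m)) : e = p ∧ w y = exp (m : ℤ) := by
  have hp : p.Prime := Fact.out
  have hm0 : 0 < m := Nat.pos_of_ne_zero (by rintro rfl; simp at hm)
  have hb1 : 1 < w (algebraMap F E b) := by
    rw [hb, ← exp_zero, exp_lt_exp]; positivity
  have hy1 : 1 < w y := by
    by_contra! h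
    rw [← hy] at hb1
    refine hb1.not_ge (w.map_sub_le ?_ h)
    rw [map_pow]
    exact pow_le_one' h p
  have hlt : w y < w (y ^ p) := by
    rw [map_pow]
    exact lt_self_pow₀ hy1 hp.one_lt
  rw [← hy, w.map_sub_eq_of_lt_left hlt, map_pow] at hb
  obtain ⟨k, hk⟩ : ∃ k : ℤ, w y = exp k :=
    ⟨log (w y), (exp_log (ne_of_gt (zero_lt_one.trans hy1))).symm⟩
  rw [hk, ← exp_nsmul, exp_inj, nsmul_eq_mul] at hb
  have hdvd : p ∣ e := by
    have : (p : ℤ) ∣ (e * m : ℕ) := ⟨k, by push_cast; exact hb.symm⟩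
    exact (hp.dvd_mul.1 (Int.natCast_dvd_natCast.1 this)).resolve_right hm
  have hep : e = p := le_antisymm hep (Nat.le_of_dvd he hdvd)
  refine ⟨hep, ?_⟩
  rw [hk, exp_inj]
  rw [hep] at hb
  exact mul_left_cancel₀ (by exact_mod_cast hp.ne_zero) hb

theorem exp_pow_eq (k : ℤ) (i : ℕ) : (exp k : ℤᵐ⁰) ^ i = exp (i * k) := by
  rw [← exp_nsmul, nsmul_eq_mul]

/-- If `y` has order `-m` with `p ∤ m` and the base field has ramification index `p`, the elements
`a y ^ i` with `i < p` have distinct valuations. So a substitution `y ↦ y + j` moves an integral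
element by an element of order at least `m + 1`. -/
theorem artinSchreier_valuation_aut_sub_le {w : Valuation E ℤᵐ⁰} {b : F}
    (hy : y ^ p - y = algebraMap F E b) (hgen : IntermediateField.adjoin F {y} = ⊤)
    {m : ℕ} (hm : ¬ p ∣ m) (hwy : w y = exp (m : ℤ))
    (hwF : ∀ a : F, a ≠ 0 → ∃ k : ℤ, w (algebraMap F E a) = exp ((p : ℤ) * k))
    (σ : E ≃ₐ[F] E) (hj : w (σ y - y) = 1) {z : E} (hz : w z ≤ 1) :
    w (σ z - z) ≤ exp (-((m + 1 : ℕ) : ℤ)) := by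
  have hp : p.Prime := Fact.out
  have hy0 : y ≠ 0 := by
    rintro rfl; rw [map_zero] at hwy; exact exp_ne_zero hwy.symm
  obtain ⟨f, hf, rfl⟩ : ∃ f : F[X], f.natDegree < p ∧ z = aeval y f := by
    have hz : z ∈ Algebra.adjoin F {y} := by
      rw [← IntermediateField.adjoin_simple_toSubalgebra_of_isAlgebraic
        (artinSchreier_isIntegral hy).isAlgebraic, hgen]
      trivial
    rw [Algebra.adjoin_singleton_eq_range_aeval] at hz
    obtain ⟨q, rfl⟩ := hz
    refine ⟨q %ₘ (X ^ p - X - C b), ?_, ?_⟩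
    · conv_rhs => rw [← artinSchreier_natDegree (p := p) b]
      refine natDegree_modByMonic_lt _ (artinSchreier_monic b) fun h ↦ ?_
      have := artinSchreier_natDegree (p := p) b
      rw [h, natDegree_one] at this
      exact hp.ne_zero this.symm
    · change aeval y q = _
      conv_lhs => rw [← modByMonic_add_div q (X ^ p - X - C b)]
      rw [map_add, map_mul, artinSchreier_aeval hy, zero_mul, add_zero]
  rw [aeval_eq_sum_range' hf] at hz ⊢
  have hval : ∀ i, f.coeff i ≠ 0 → ∃ k : ℤ, w (f.coeff i • y ^ i) = exp (p * k + i * m) := by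
    intro i hi
    obtain ⟨k, hk⟩ := hwF _ hi
    refine ⟨k, ?_⟩
    rw [Algebra.smul_def, map_mul, hk, map_pow, hwy, exp_pow_eq, ← exp_add]
  have hdist : ∀ i ∈ Finset.range p, ∀ j ∈ Finset.range p, i ≠ j → w (f.coeff i • y ^ i) ≠ 0 →
      w (f.coeff i • y ^ i) ≠ w (f.coeff j • y ^ j) := by
    intro i hi j hj hij h0 heq
    rw [Finset.mem_range] at hi hj
    have hi0 : f.coeff i ≠ 0 := by rintro h; simp [h] at h0
    have hj0 : f.coeff j ≠ 0 := by rintro h; rw [heq] at h0; simp [h] at h0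
    obtain ⟨k, hk⟩ := hval i hi0
    obtain ⟨l, hl⟩ := hval j hj0
    rw [hk, hl, exp_inj] at heq
    have h1 : (p : ℤ) ∣ ((i : ℤ) - j) * m := ⟨l - k, by linear_combination heq⟩
    rcases (Nat.prime_iff_prime_int.1 hp).dvd_or_dvd h1 with h | h
    · have := Int.eq_zero_of_abs_lt_dvd h (by rw [abs_lt]; omega)
      omega
    · exact hm (Int.natCast_dvd_natCast.1 h)
  have hε : w ((σ y - y) / y) = exp (-(m : ℤ)) := by
    rw [map_div₀, hj, hwy, exp_neg, one_div]
  have hε1 : w ((σ y - y) / y) ≤ 1 := by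
    rw [hε, ← exp_zero, exp_le_exp]; omega
  rw [map_sum, ← Finset.sum_sub_distrib]
  refine w.map_sum_le fun i hi ↦ ?_
  rcases Nat.eq_zero_or_pos i with rfl | hi0
  · simp
  by_cases hc : f.coeff i = 0
  · simp [hc]
  obtain ⟨k, hk⟩ := hval i hc
  have hle := (w.map_le_map_sum _ _ hdist hi).trans hz
  rw [hk, ← exp_zero, exp_le_exp] at hle
  have hne : (p : ℤ) * k + i * m ≠ 0 := by
    intro h
    have h1 : (p : ℤ) ∣ (i * m : ℕ) := ⟨-k, by push_cast; linear_combination h⟩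
    rcases hp.dvd_mul.1 (Int.natCast_dvd_natCast.1 h1) with h | h
    · exact absurd (Nat.le_of_dvd hi0 h) (by rw [Finset.mem_range] at hi; omega)
    · exact hm h
  have hexp : σ (f.coeff i • y ^ i) - f.coeff i • y ^ i =
      f.coeff i • y ^ i * ((1 + (σ y - y) / y) ^ i - 1) := by
    rw [map_smul, map_pow]
    have : 1 + (σ y - y) / y = σ y / y := by field_simp; ring
    rw [this, div_pow, Algebra.smul_def, Algebra.smul_def]
    field_simp
  have h2 : w ((1 + (σ y - y) / y) ^ i - 1) ≤ exp (-(m : ℤ)) := by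
    have h3 : (1 + (σ y - y) / y) ^ i - 1 = ((1 + (σ y - y) / y) ^ i - 1 - i * ((σ y - y) / y))
      + i * ((σ y - y) / y) := by ring
    rw [h3, ← hε]
    refine w.map_add_le ((w.map_one_add_pow_sub_le hε1 i).trans ?_) ?_
    · rw [sq]; exact mul_le_of_le_one_left' hε1
    · rw [map_mul]; exact mul_le_of_le_one_left' (w.map_natCast_le_one' i)
  rw [hexp, map_mul, hk]
  calc exp ((p : ℤ) * k + i * m) * w ((1 + (σ y - y) / y) ^ i - 1)
      ≤ exp ((p : ℤ) * k + i * m) * exp (-(m : ℤ)) := by gcongr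
    _ ≤ _ := by
      rw [← exp_add, exp_le_exp]
      push_cast
      omega

/-- If the right-hand side has a pole of order `m` prime to `p`, then `y` has order `-m` for the normalized
valuation of `E`. All elements are moved by at least order `m + 1`, and the uniformizer
`y ^ α * t ^ β`, where `α m + 1 = p β`, is moved by exactly that. -/
theorem ramificationJump_eq [CharP F p] {b : F} (hy : y ^ p - y = algebraMap F E b)
    (hgen : IntermediateField.adjoin F {y} = ⊤) {t : R} (ht : Irreducible t) {m : ℕ}
    (hm : ¬ p ∣ m) (u : Rˣ) (hb : b * algebraMap R F t ^ m = algebraMap R F u) :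
    ramificationJump R E p = m := by
  have hp : p.Prime := Fact.out
  have : CharP E p := charP_of_injective_algebraMap (algebraMap F E).injective p
  have : FiniteDimensional F E := artinSchreier_finiteDimensional hy hgen
  have : Algebra.IsSeparable F E := artinSchreier_isSeparable hy hgen
  have : IsGalois F E := artinSchreier_isGalois hy hgen
  have hm0 : 0 < m := Nat.pos_of_ne_zero (by rintro rfl; simp at hm)
  have : Nontrivial (integralClosure R E) := inferInstance
  obtain ⟨M, hM⟩ := Ideal.exists_maximal (integralClosure R E)
  obtain ⟨w, hwu, hwt, hwM, hwint⟩ := exists_valuation_of_isMaximal F ht M hM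
  obtain ⟨he0, hle, hun⟩ := ramificationIdx_le_finrank_and_eq_of_isMaximal F M
  have hfrp := artinSchreier_finrank_le hy hgen
  have hwb : w (algebraMap F E b) = exp ((M.ramificationIdx R : ℤ) * m) := by
    have := congrArg (fun z ↦ w (algebraMap F E z)) hb
    simp only [map_mul, map_pow, ← IsScalarTower.algebraMap_apply, hwu, hwt] at this
    rw [exp_pow_eq] at this
    rw [eq_inv_of_mul_eq_one_left this, ← exp_neg]
    congr 1
    ring
  obtain ⟨hep, hwy⟩ := artinSchreier_valuation_eq F hy he0 (hle.trans hfrp) hm hwb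
  have hfr : Module.finrank F E = p := le_antisymm hfrp (hep ▸ hle)
  have hun := hun (hep.trans hfr.symm)
  rw [hep] at hwt
  have hcardF : Nat.card (E ≃ₐ[F] E) = p := (IsGalois.card_aut_eq_finrank F E).trans hfr
  have hcard : Nat.card (E ≃ₐ[R] E) = p :=
    (Nat.card_congr (autEquivOfIsFractionRing R E F)).trans hcardF
  have hpow1 : ∀ x : ℤᵐ⁰, x ^ (p - 1) = 1 → x = 1 := fun x hx ↦
    (pow_eq_one_iff.1 hx).resolve_right (by have := hp.one_lt; omega)
  have hj : ∀ σ : E ≃ₐ[F] E, σ ≠ 1 → w (σ y - y) = 1 := by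
    intro σ hσ
    have := congrArg w (pow_pred_eq_one_of_pow_eq_self hp.one_lt (artinSchreier_aut_sub hy σ)
      (artinSchreier_aut_ne hgen hσ))
    rw [map_pow, map_one] at this
    exact hpow1 _ this
  refine IsGreatest.csSup_eq ⟨⟨M, hM, hep, ?_⟩, ?_⟩
  · suffices h : lowerRamificationGroup R E M m = ⊤ by
      rw [h, Subgroup.card_top, hcard]
    rw [eq_top_iff]
    intro σ _ x
    set σ' := autEquivOfIsFractionRing R E F σ
    rw [← hwM]
    change w (σ' x - x) ≤ _
    by_cases hσ : σ' = 1
    · rw [hσ]; simp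
    · exact artinSchreier_valuation_aut_sub_le F hy hgen hm hwy
        (fun a ha ↦ exists_valuation_algebraMap_eq F ht hwu hwt ha) σ' (hj σ' hσ)
        (by simpa using (hwM x 0).2 (by simp))
  · rintro i ⟨M', hM', -, hi⟩
    obtain rfl := hun M' hM'
    by_contra! hlt
    have : Finite (E ≃ₐ[R] E) := Nat.finite_of_card_ne_zero (hcard ▸ hp.ne_zero)
    have htop : lowerRamificationGroup R E M' i = ⊤ :=
      Subgroup.eq_top_of_card_eq _ (hi.trans hcard.symm)
    have : Nontrivial (E ≃ₐ[F] E) :=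
      have : Finite (E ≃ₐ[F] E) := inferInstance
      Finite.one_lt_card_iff_nontrivial.1 (hcardF ▸ hp.one_lt)
    obtain ⟨σ, hσ⟩ := exists_ne (1 : E ≃ₐ[F] E)
    -- a uniformizer `y ^ α * t ^ β` is moved by an element of order exactly `m + 1`
    obtain ⟨α, β, hαβ⟩ : ∃ α β : ℕ, α * m + 1 = p * β := by
      have hm' : (m : ZMod p) ≠ 0 := by rwa [Ne, ZMod.natCast_eq_zero_iff]
      refine ⟨(-(m : ZMod p)⁻¹).val, ?_⟩
      have : ((((-(m : ZMod p)⁻¹).val * m + 1 : ℕ)) : ZMod p) = 0 := by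
        push_cast
        rw [ZMod.natCast_zmod_val, neg_mul, inv_mul_cancel₀ hm', neg_add_cancel]
      exact (ZMod.natCast_eq_zero_iff _ _).1 this
    have hα : ¬ p ∣ α := fun h ↦ by
      have h1 : p ∣ α * m + 1 := ⟨β, hαβ⟩
      exact hp.one_lt.ne' (Nat.dvd_one.1 ((Nat.dvd_add_right (h.mul_right m)).1 h1))
    have hwα : w (α : E) = 1 := by
      have h0 : (α : E) ≠ 0 := by rwa [Ne, CharP.cast_eq_zero_iff E p]
      have h1 : (α : E) ^ p = α := by
        rw [← frobenius_def, map_natCast]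
      apply hpow1
      rw [← map_pow, pow_pred_eq_one_of_pow_eq_self hp.one_lt h1 h0, map_one]
    have hy0 : y ≠ 0 := by
      rintro rfl; rw [map_zero] at hwy; exact exp_ne_zero hwy.symm
    set π : E := y ^ α * algebraMap R E t ^ β with hπ
    have hwπ : w π = exp (-1) := by
      rw [hπ, map_mul, map_pow, map_pow, hwy, hwt, exp_pow_eq, exp_pow_eq,
        ← exp_add]
      congr 1
      have : (α : ℤ) * m + 1 = p * β := by exact_mod_cast hαβ
      linear_combination this
    set π' : integralClosure R E := ⟨π, hwint hun π (by rw [hwπ, ← exp_zero, exp_le_exp]; omega)⟩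
    have hmem := (htop ▸ Subgroup.mem_top ((autEquivOfIsFractionRing R E F).symm σ) :
      (autEquivOfIsFractionRing R E F).symm σ ∈ lowerRamificationGroup R E M' i) π'
    rw [← hwM] at hmem
    change w (σ π - π) ≤ _ at hmem
    have hε : w ((σ y - y) / y) = exp (-(m : ℤ)) := by
      rw [map_div₀, hj σ hσ, hwy, exp_neg, one_div]
    have hε1 : w ((σ y - y) / y) < 1 := by
      rw [hε, ← exp_zero, exp_lt_exp]; omega
    have hexp : σ π - π = π * ((1 + (σ y - y) / y) ^ α - 1) := by
      have h1 : σ (algebraMap R E t) = algebraMap R E t := by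
        rw [IsScalarTower.algebraMap_apply R F E, AlgEquiv.commutes]
      have : 1 + (σ y - y) / y = σ y / y := by field_simp; ring
      rw [hπ, map_mul, map_pow, map_pow, h1, this, div_pow]
      field_simp
    have h2 : w ((1 + (σ y - y) / y) ^ α - 1) = exp (-(m : ℤ)) := by
      have h3 : (1 + (σ y - y) / y) ^ α - 1 =
        ((1 + (σ y - y) / y) ^ α - 1 - α * ((σ y - y) / y)) + α * ((σ y - y) / y) := by ring
      have h4 : w (α * ((σ y - y) / y)) = w ((σ y - y) / y) := by rw [map_mul, hwα, one_mul]
      rw [h3, w.map_add_eq_of_lt_right, h4, hε]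
      rw [h4]
      refine (w.map_one_add_pow_sub_le hε1.le α).trans_lt ?_
      rw [hε, exp_pow_eq, exp_lt_exp]
      push_cast
      omega
    rw [hexp, map_mul, h2, hwπ, ← exp_add, exp_le_exp] at hmem
    push_cast at hmem
    omega

end Jump

/-! ### Intersection numbers with regular curves, and factoriality of the surface -/

section Curves

/-- The ideals of regular one-dimensional subschemes: primes `𝔭` with `A ⧸ 𝔭` regular of
dimension one. -/
def regularCurves (A : Type*) [CommRing A] : Set (Ideal A) :=
  {𝔭 | 𝔭 ∈ spec₁ A ∧ IsRegularLocalRing (A ⧸ 𝔭)}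

theorem le_length_quotient_iff {R : Type*} [CommRing R] [IsDomain R] [IsDiscreteValuationRing R]
    (J : Ideal R) (n : ℕ) : (n : ℕ∞) ≤ Module.length R (R ⧸ J) ↔ J ≤ maximalIdeal R ^ n := by
  obtain ⟨a, rfl⟩ := (IsDiscreteValuationRing.idealOrderIsoENat R).symm.surjective J
  rw [Module.length_quotient, Order.coheight_orderIso,
    ← IsDiscreteValuationRing.idealOrderIsoENat_symm_apply_coe, OrderIso.le_iff_le]
  obtain ⟨a, rfl⟩ := OrderDual.toDual.surjective a
  rw [Order.coheight_toDual, Order.height_enat]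
  rfl

theorem isDiscreteValuationRing_of_mem_regularCurves {A : Type*} [CommRing A] {𝔭 : Ideal A}
    [𝔭.IsPrime] (h : 𝔭 ∈ regularCurves A) : IsDiscreteValuationRing (A ⧸ 𝔭) := by
  obtain ⟨⟨-, hdim⟩, hreg⟩ := h
  have h1 := hreg.spanFinrank_maximalIdeal
  rw [hdim] at h1
  have h2 : (maximalIdeal (A ⧸ 𝔭)).spanFinrank = 1 := by exact_mod_cast h1
  obtain ⟨h3, h4⟩ := (Submodule.spanFinrank_eq_one_iff _).1 h2
  have h5 : ¬ IsField (A ⧸ 𝔭) := fun h ↦ h4 (isField_iff_maximalIdeal_eq.1 h)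
  exact ((IsDiscreteValuationRing.TFAE (A ⧸ 𝔭) h5).out 0 4).2 h3

theorem mem_regularCurves_of_isDiscreteValuationRing {A : Type*} [CommRing A] {𝔭 : Ideal A}
    [𝔭.IsPrime] [IsDiscreteValuationRing (A ⧸ 𝔭)] : 𝔭 ∈ regularCurves A :=
  ⟨⟨inferInstance, IsDiscreteValuationRing.ringKrullDim_eq_one _⟩, inferInstance⟩

variable {A : Type*} [CommRing A] [IsLocalRing A]

theorem mem_sup_pow_iff (𝔭 : Ideal A) [𝔭.IsPrime] [IsLocalRing (A ⧸ 𝔭)] (z : A) (n : ℕ) :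
    z ∈ 𝔭 ⊔ maximalIdeal A ^ n ↔ Ideal.Quotient.mk 𝔭 z ∈ maximalIdeal (A ⧸ 𝔭) ^ n := by
  rw [← IsLocalRing.map_maximalIdeal_of_surjective (Ideal.Quotient.mk 𝔭)
    Ideal.Quotient.mk_surjective, ← Ideal.map_pow, Ideal.mem_quotient_iff_mem_sup, sup_comm]

/-- On a regular curve, the intersection number measures how far an ideal lies in the powers of the
maximal ideal. -/
theorem le_interNum_iff {𝔭 : Ideal A} (h𝔭 : 𝔭 ∈ regularCurves A) (J : Ideal A) (n : ℕ) :
    (n : ℕ∞) ≤ interNum 𝔭 J ↔ J ≤ 𝔭 ⊔ maximalIdeal A ^ n := by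
  have : 𝔭.IsPrime := h𝔭.1.1
  have := isDiscreteValuationRing_of_mem_regularCurves h𝔭
  have h1 : interNum 𝔭 J = Module.length (A ⧸ 𝔭) ((A ⧸ 𝔭) ⧸ J.map (Ideal.Quotient.mk 𝔭)) := by
    rw [interNum, ← Module.length_eq_of_surjective (S := A) (R := A ⧸ 𝔭)
      Ideal.Quotient.mk_surjective]
    exact (DoubleQuot.quotQuotEquivQuotSupₐ A 𝔭 J).symm.toLinearEquiv.length_eq
  rw [h1, le_length_quotient_iff, Ideal.map_le_iff_le_comap]
  refine forall₂_congr fun z _ ↦ ?_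
  rw [mem_sup_pow_iff, Ideal.mem_comap]

theorem interNum_comm {A : Type*} [CommRing A] (𝔭 𝔮 : Ideal A) : interNum 𝔭 𝔮 = interNum 𝔮 𝔭 := by
  unfold interNum; rw [sup_comm]

theorem interNum_eq_iff {𝔭 : Ideal A} (h𝔭 : 𝔭 ∈ regularCurves A) (z : A) (n : ℕ) :
    interNum 𝔭 (Ideal.span {z}) = n ↔
      z ∈ 𝔭 ⊔ maximalIdeal A ^ n ∧ z ∉ 𝔭 ⊔ maximalIdeal A ^ (n + 1) := by
  have h := le_interNum_iff h𝔭 (Ideal.span {z})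
  simp only [Ideal.span_singleton_le_iff_mem] at h
  rw [← h, ← h, not_le]
  constructor
  · intro h; rw [h]; exact ⟨le_rfl, by exact_mod_cast Nat.lt_succ_self n⟩
  · rintro ⟨h1, h2⟩
    exact le_antisymm (Order.lt_add_one_iff_of_not_isMax (by simp) |>.1 (by exact_mod_cast h2)) h1

theorem interNum_self {𝔭 : Ideal A} (h𝔭 : 𝔭 ∈ regularCurves A) : interNum 𝔭 𝔭 = ⊤ := by
  rw [ENat.eq_top_iff_forall_ge]
  intro n
  rw [le_interNum_iff h𝔭]
  exact le_sup_left

theorem sup_pow_eq_of_le_interNum {𝔭 𝔮 : Ideal A} (h𝔭 : 𝔭 ∈ regularCurves A)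
    (h𝔮 : 𝔮 ∈ regularCurves A) {n : ℕ} (h : (n : ℕ∞) ≤ interNum 𝔭 𝔮) :
    𝔭 ⊔ maximalIdeal A ^ n = 𝔮 ⊔ maximalIdeal A ^ n := by
  apply le_antisymm
  · rw [interNum_comm, le_interNum_iff h𝔮] at h
    exact sup_le h le_sup_right
  · rw [le_interNum_iff h𝔭] at h
    exact sup_le h le_sup_right

end Curves

section RegularSurface

variable {A : Type*} [CommRing A] [IsLocalRing A] [IsNoetherianRing A]

/-- One of two generators of the maximal ideal of a two-dimensional local ring defines a regular
curve. -/
theorem span_mem_regularCurves (hdim : ringKrullDim A = 2) {f g : A}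
    (hfg : Ideal.span {f, g} = maximalIdeal A) : Ideal.span {f} ∈ regularCurves A := by
  set 𝔭 := Ideal.span {f}
  have hs : Function.Surjective (Ideal.Quotient.mk 𝔭) := Ideal.Quotient.mk_surjective
  have hfm : 𝔭 ≤ maximalIdeal A := by
    rw [← hfg]; exact Ideal.span_mono (by simp)
  have hne : 𝔭 ≠ ⊤ := fun h ↦ (maximalIdeal.isMaximal A).ne_top (top_le_iff.1 (h ▸ hfm))
  have : Nontrivial (A ⧸ 𝔭) := Ideal.Quotient.nontrivial_iff.2 hne
  have hloc : IsLocalRing (A ⧸ 𝔭) := IsLocalRing.of_surjective' _ hs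
  set x := Ideal.Quotient.mk 𝔭 g
  have hmap : (maximalIdeal A).map (Ideal.Quotient.mk 𝔭) = Ideal.span {x} := by
    rw [← hfg, Ideal.map_span, Set.image_pair]
    have : Ideal.Quotient.mk 𝔭 f = 0 := Ideal.Quotient.eq_zero_iff_mem.2
      (Ideal.mem_span_singleton_self f)
    rw [this, Ideal.span_insert]
    simp [x]
  have hmax : maximalIdeal (A ⧸ 𝔭) = Ideal.span {x} := by
    rw [← hmap]
    exact (IsLocalRing.map_maximalIdeal_of_surjective _ hs).symm
  have hnil : ¬ IsNilpotent x := by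
    rintro ⟨n, hn⟩
    have h1 : maximalIdeal A ∈ 𝔭.minimalPrimes := by
      refine ⟨⟨inferInstance, hfm⟩, fun 𝔮 ⟨h𝔮, hle⟩ _ ↦ ?_⟩
      rw [← hfg, Ideal.span_le, Set.insert_subset_iff, Set.singleton_subset_iff]
      refine ⟨hle (Ideal.mem_span_singleton_self f), h𝔮.mem_of_pow_mem n (hle ?_)⟩
      rw [← Ideal.Quotient.eq_zero_iff_mem, map_pow]
      exact hn
    have : 𝔭.IsPrincipal := ⟨f, rfl⟩
    have h2 := Ideal.height_le_one_of_isPrincipal_of_mem_minimalPrimes 𝔭 _ h1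
    have h3 := IsLocalRing.maximalIdeal_height_eq_ringKrullDim (R := A)
    rw [hdim] at h3
    have h4 : ((maximalIdeal A).height : WithBot ℕ∞) ≤ (1 : ℕ∞) := WithBot.coe_le_coe.2 h2
    rw [h3] at h4
    exact absurd h4 (by decide)
  have hfac : ∀ z : A ⧸ 𝔭, z ≠ 0 → ∃ (n : ℕ) (u : A ⧸ 𝔭), IsUnit u ∧ z = u * x ^ n := by
    intro z hz
    have h1 : ∃ n, z ∉ Ideal.span {x} ^ n := by
      by_contra! h
      apply hz
      have := Ideal.iInf_pow_eq_bot_of_isLocalRing (maximalIdeal (A ⧸ 𝔭)) Ideal.IsPrime.ne_top'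
      rw [← Ideal.mem_bot, ← this, Ideal.mem_iInf, hmax]
      exact h
    classical
    have h2 := Nat.find_spec h1
    have h3 : Nat.find h1 ≠ 0 := by
      intro h
      rw [h] at h2
      simp at h2
    obtain ⟨n, hn⟩ := Nat.exists_eq_succ_of_ne_zero h3
    have h4 : z ∈ Ideal.span {x} ^ n := by
      by_contra h
      have := Nat.find_min' h1 h
      omega
    rw [Ideal.span_singleton_pow, Ideal.mem_span_singleton'] at h4
    obtain ⟨u, rfl⟩ := h4
    refine ⟨n, u, ?_, rfl⟩
    by_contra hu
    have h5 : u ∈ Ideal.span {x} := hmax ▸ (mem_maximalIdeal u).2 hu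
    obtain ⟨w, rfl⟩ := Ideal.mem_span_singleton'.1 h5
    apply h2
    rw [hn, Ideal.span_singleton_pow, Ideal.mem_span_singleton']
    exact ⟨w, by rw [pow_succ]; ring⟩
  have hdom : IsDomain (A ⧸ 𝔭) := by
    have : NoZeroDivisors (A ⧸ 𝔭) := by
      refine ⟨fun {a b} hab ↦ ?_⟩
      by_contra! h
      obtain ⟨n, u, hu, rfl⟩ := hfac a h.1
      obtain ⟨m, v, hv, rfl⟩ := hfac b h.2
      refine hnil ⟨n + m, ?_⟩
      have : u * v * x ^ (n + m) = 0 := by rw [← hab]; ring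
      exact (hu.mul hv).mul_right_eq_zero.1 this
    exact NoZeroDivisors.to_isDomain _
  have hprime : 𝔭.IsPrime := (Ideal.Quotient.isDomain_iff_prime 𝔭).1 hdom
  have h5 : ¬ IsField (A ⧸ 𝔭) := fun h ↦ by
    rw [isField_iff_maximalIdeal_eq, hmax, Ideal.span_singleton_eq_bot] at h
    exact hnil (h ▸ IsNilpotent.zero)
  have hpr : (maximalIdeal (A ⧸ 𝔭)).IsPrincipal := ⟨x, hmax⟩
  have : IsDiscreteValuationRing (A ⧸ 𝔭) :=
    ((IsDiscreteValuationRing.TFAE (A ⧸ 𝔭) h5).out 0 4).2 hpr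
  exact mem_regularCurves_of_isDiscreteValuationRing

theorem ne_zero_of_span_pair_eq (hdim : ringKrullDim A = 2) {f g : A}
    (hfg : Ideal.span {f, g} = maximalIdeal A) : f ≠ 0 := by
  rintro rfl
  have h1 := (span_mem_regularCurves hdim hfg).1.2
  rw [Ideal.span_singleton_eq_bot.2 rfl, ringKrullDim_eq_of_ringEquiv (RingEquiv.quotientBot A),
    hdim] at h1
  exact absurd h1 (by decide)

/-- A two-dimensional regular local domain is factorial: a prime `𝔭` that does not contain the
parameter `f` meets `(f)` in `f 𝔭`, and its image in the discrete valuation ring `A ⧸ (f)` is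
principal, so that `𝔭` is principal by Nakayama. -/
theorem uniqueFactorizationMonoid_of_ringKrullDim_eq_two [IsDomain A] (hdim : ringKrullDim A = 2)
    {f g : A} (hfg : Ideal.span {f, g} = maximalIdeal A) : UniqueFactorizationMonoid A := by
  have hf := span_mem_regularCurves hdim hfg
  have hfp : (Ideal.span {f}).IsPrime := hf.1.1
  have := isDiscreteValuationRing_of_mem_regularCurves hf
  have hf0 : f ≠ 0 := ne_zero_of_span_pair_eq hdim hfg
  refine UniqueFactorizationMonoid.iff_exists_prime_mem_of_isPrime.2 ?_
  intro 𝔭 h0 h𝔭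
  by_cases hmem : f ∈ 𝔭
  · exact ⟨f, hmem, (Ideal.span_singleton_prime hf0).1 hfp⟩
  · obtain ⟨y, hy⟩ := (IsPrincipalIdealRing.principal
      (𝔭.map (Ideal.Quotient.mk (Ideal.span {f})))).principal
    have hy' : y ∈ 𝔭.map (Ideal.Quotient.mk (Ideal.span {f})) := by
      rw [hy]; exact Submodule.mem_span_singleton_self y
    obtain ⟨h, hh, rfl⟩ :=
      (Ideal.mem_map_iff_of_surjective _ Ideal.Quotient.mk_surjective).1 hy'
    have hle : 𝔭 ≤ Ideal.span {h} ⊔ maximalIdeal A • 𝔭 := by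
      intro z hz
      have h1 : Ideal.Quotient.mk (Ideal.span {f}) z ∈
          Ideal.span {Ideal.Quotient.mk (Ideal.span {f}) h} := by
        rw [Ideal.submodule_span_eq] at hy
        rw [← hy]; exact Ideal.mem_map_of_mem _ hz
      obtain ⟨a, ha⟩ := Ideal.mem_span_singleton'.1 h1
      obtain ⟨a, rfl⟩ := Ideal.Quotient.mk_surjective a
      rw [← map_mul, eq_comm, Ideal.Quotient.eq, Ideal.mem_span_singleton'] at ha
      obtain ⟨b, hb⟩ := ha
      have h2 : b * f ∈ 𝔭 := by rw [hb]; exact sub_mem hz (𝔭.mul_mem_left a hh)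
      have h3 : b ∈ 𝔭 := (h𝔭.mem_or_mem h2).resolve_right hmem
      have h4 : z = a * h + f * b := by linear_combination -hb
      rw [h4]
      refine Submodule.add_mem_sup (Ideal.mul_mem_left _ _ (Ideal.mem_span_singleton_self h)) ?_
      exact Submodule.smul_mem_smul (hfg ▸ Ideal.subset_span (by simp)) h3
    have h5 : 𝔭 = Ideal.span {h} := by
      refine le_antisymm ?_ ((Ideal.span_singleton_le_iff_mem _).2 hh)
      exact Submodule.le_of_le_smul_of_le_jacobson_bot (IsNoetherian.noetherian 𝔭)
        (maximalIdeal_le_jacobson _) hle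
    refine ⟨h, hh, (Ideal.span_singleton_prime ?_).1 (h5 ▸ h𝔭)⟩
    rintro rfl
    exact h0 (by rw [h5]; simp)

end RegularSurface

/-! ### Sections of the residue field -/

section Sections

variable {A : Type*} [CommRing A] [IsLocalRing A]

theorem charP_residueField (p : ℕ) [Fact p.Prime] [CharP A p] : CharP (ResidueField A) p := by
  have h : (p : ResidueField A) = 0 := by
    rw [← map_natCast (residue A), CharP.cast_eq_zero, map_zero]
  exact (CharP.charP_iff_prime_eq_zero Fact.out).2 h

theorem SurfaceJump.IsSection.pow_sub_mem {n : ℕ} {lam : ResidueField A → A} (h : IsSection n lam)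
    (x : ResidueField A) (j : ℕ) : lam (x ^ j) - lam x ^ j ∈ maximalIdeal A ^ n := by
  induction j with
  | zero => simpa using h.map_one
  | succ j ih =>
    have e : lam (x ^ j * x) - lam x ^ (j + 1) =
        (lam (x ^ j * x) - lam (x ^ j) * lam x) + (lam (x ^ j) - lam x ^ j) * lam x := by ring
    rw [pow_succ x, e]
    exact add_mem (h.map_mul _ _) (Ideal.mul_mem_right _ _ ih)

theorem sub_mem_maximalIdeal_iff (a b : A) : a - b ∈ maximalIdeal A ↔ residue A a = residue A b :=
  Ideal.Quotient.eq.symm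

theorem pow_sub_pow_mem (p : ℕ) [Fact p.Prime] [CharP A p] {a b : A}
    (h : a - b ∈ maximalIdeal A) (n : ℕ) :
    a ^ p ^ n - b ^ p ^ n ∈ maximalIdeal A ^ n := by
  rw [← sub_pow_char_pow]
  exact Ideal.pow_le_pow_right (Nat.lt_pow_self (Fact.out : p.Prime).one_lt).le
    (Ideal.pow_mem_pow h _)

/-- Over a perfect residue field of characteristic `p`, all sections of level `n` agree modulo
`𝔪 ^ n`, since each value is congruent to a `p ^ n`-th power of a lift. -/
theorem SurfaceJump.IsSection.sub_mem_pow (p : ℕ) [Fact p.Prime] [CharP A p]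
    [IsAlgClosed (ResidueField A)] {n : ℕ}
    {lam lam' : ResidueField A → A} (h : IsSection n lam) (h' : IsSection n lam')
    (x : ResidueField A) : lam x - lam' x ∈ maximalIdeal A ^ n := by
  obtain ⟨y, rfl⟩ := IsAlgClosed.exists_pow_nat_eq x
    (pow_pos (Fact.out : p.Prime).pos n)
  have e : lam (y ^ p ^ n) - lam' (y ^ p ^ n) = (lam (y ^ p ^ n) - lam y ^ p ^ n) +
      (lam y ^ p ^ n - lam' y ^ p ^ n) -
      (lam' (y ^ p ^ n) - lam' y ^ p ^ n) := by ring
  rw [e]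
  refine sub_mem (add_mem (h.pow_sub_mem _ _) (pow_sub_pow_mem p ?_ n)) (h'.pow_sub_mem _ _)
  rw [sub_mem_maximalIdeal_iff, h.residue_eq, h'.residue_eq]

theorem exists_isSection (p : ℕ) [Fact p.Prime] [CharP A p] [IsAlgClosed (ResidueField A)] (n : ℕ) :
    ∃ lam : ResidueField A → A, IsSection n lam := by
  have := charP_residueField (A := A) p
  choose s hs using residue_surjective (R := A)
  let φ := iterateFrobeniusEquiv (ResidueField A) p n
  have key : ∀ x, φ.symm x ^ p ^ n = x := fun x ↦ by
    rw [← iterateFrobeniusEquiv_def]; exact φ.apply_symm_apply x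
  refine ⟨fun x ↦ s (φ.symm x) ^ p ^ n, fun x ↦ ?_, ?_, fun x y ↦ ?_, fun x y ↦ ?_⟩
  · rw [map_pow, hs, key]
  · have : (1 : A) = 1 ^ p ^ n := by simp
    rw [this]
    apply pow_sub_pow_mem p
    rw [sub_mem_maximalIdeal_iff, hs, map_one, map_one]
  · rw [← add_pow_char_pow]
    apply pow_sub_pow_mem p
    rw [sub_mem_maximalIdeal_iff, hs, map_add, map_add, hs, hs]
  · rw [← mul_pow]
    apply pow_sub_pow_mem p
    rw [sub_mem_maximalIdeal_iff, hs, map_mul, map_mul, hs, hs]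

theorem SurfaceJump.IsSection.of_le {n m : ℕ} (hnm : n ≤ m)
    {lam : ResidueField A → A} (h : IsSection m lam) :
    IsSection n lam :=
  ⟨h.residue_eq, Ideal.pow_le_pow_right hnm h.map_one,
    fun x y ↦ Ideal.pow_le_pow_right hnm (h.map_add x y),
    fun x y ↦ Ideal.pow_le_pow_right hnm (h.map_mul x y)⟩

end Sections

/-! ### Expansions along a regular curve -/

section Digits

variable {A : Type*} [CommRing A] [IsLocalRing A]

theorem irreducible_of_mem_of_notMem_sq {R : Type*} [CommRing R] [IsDomain R]
    [IsDiscreteValuationRing R] {x : R} (h1 : x ∈ maximalIdeal R) (h2 : x ∉ maximalIdeal R ^ 2) :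
    Irreducible x := by
  obtain ⟨ϖ, hϖ⟩ := IsDiscreteValuationRing.exists_irreducible R
  have hx0 : x ≠ 0 := by rintro rfl; exact h2 (zero_mem _)
  obtain ⟨k, u, rfl⟩ := IsDiscreteValuationRing.eq_unit_mul_pow_irreducible hx0 hϖ
  rw [hϖ.maximalIdeal_eq] at h1 h2
  rw [Ideal.span_singleton_pow, Ideal.mem_span_singleton] at h2
  match k with
  | 0 => exact absurd (isUnit_of_dvd_unit (Ideal.mem_span_singleton.1 h1) (by simp)) hϖ.not_isUnit
  | 1 => rw [pow_one]; exact (irreducible_units_mul u).2 hϖ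
  | k + 2 => exact absurd (Dvd.dvd.mul_left (pow_dvd_pow ϖ (by omega)) _) h2

variable {𝔭 : Ideal A} [𝔭.IsPrime] [IsDiscreteValuationRing (A ⧸ 𝔭)] {X : A}

theorem irreducible_mk_of_notMem (hX : X ∈ maximalIdeal A)
    (hX2 : X ∉ 𝔭 ⊔ maximalIdeal A ^ 2) : Irreducible (Ideal.Quotient.mk 𝔭 X) := by
  apply irreducible_of_mem_of_notMem_sq
  · rw [← pow_one (maximalIdeal (A ⧸ 𝔭)), ← mem_sup_pow_iff, pow_one]
    exact Ideal.mem_sup_right hX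
  · rwa [← mem_sup_pow_iff]

theorem mem_sup_pow_iff_dvd (hX : Irreducible (Ideal.Quotient.mk 𝔭 X)) (z : A) (n : ℕ) :
    z ∈ 𝔭 ⊔ maximalIdeal A ^ n ↔ Ideal.Quotient.mk 𝔭 X ^ n ∣ Ideal.Quotient.mk 𝔭 z := by
  rw [mem_sup_pow_iff, hX.maximalIdeal_eq, Ideal.span_singleton_pow, Ideal.mem_span_singleton]

theorem mk_dvd_sub_iff (hX : Irreducible (Ideal.Quotient.mk 𝔭 X)) (a b : A) :
    Ideal.Quotient.mk 𝔭 X ∣ Ideal.Quotient.mk 𝔭 a - Ideal.Quotient.mk 𝔭 b ↔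
      residue A a = residue A b := by
  rw [← sub_mem_maximalIdeal_iff, ← map_sub]
  have := mem_sup_pow_iff_dvd hX (a - b) 1
  rw [pow_one, pow_one] at this
  rw [← this, sup_eq_right.2 (le_maximalIdeal (‹𝔭.IsPrime›.ne_top))]

variable {lam : ResidueField A → A}

/-- Truncated power series expansion along a regular curve, with digits in the image of a section
of the residue field. -/
theorem exists_digits (hX : Irreducible (Ideal.Quotient.mk 𝔭 X))
    (hlam : ∀ x, residue A (lam x) = x) (N : ℕ) (a : A) :
    ∃ c : ℕ → ResidueField A, c 0 = residue A a ∧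
      Ideal.Quotient.mk 𝔭 X ^ N ∣ Ideal.Quotient.mk 𝔭 a -
        ∑ j ∈ Finset.range N, Ideal.Quotient.mk 𝔭 (lam (c j)) * Ideal.Quotient.mk 𝔭 X ^ j := by
  induction N generalizing a with
  | zero => exact ⟨fun _ ↦ residue A a, rfl, by simp⟩
  | succ N ih =>
    obtain ⟨b, hb⟩ := (mk_dvd_sub_iff hX a (lam (residue A a))).2 (hlam _).symm
    obtain ⟨b, rfl⟩ := Ideal.Quotient.mk_surjective b
    obtain ⟨c, -, e, he⟩ := ih b
    refine ⟨fun j ↦ Nat.casesOn j (residue A a) c, rfl, e, ?_⟩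
    rw [Finset.sum_range_succ']
    simp only [pow_zero, mul_one, pow_succ _ (_ : ℕ), ← mul_assoc, ← Finset.sum_mul]
    linear_combination hb + Ideal.Quotient.mk 𝔭 X * he

theorem digits_unique (hX : Irreducible (Ideal.Quotient.mk 𝔭 X))
    (hlam : ∀ x, residue A (lam x) = x) (N : ℕ) (c c' : ℕ → ResidueField A)
    (h : Ideal.Quotient.mk 𝔭 X ^ N ∣ ∑ j ∈ Finset.range N, (Ideal.Quotient.mk 𝔭 (lam (c j)) -
      Ideal.Quotient.mk 𝔭 (lam (c' j))) * Ideal.Quotient.mk 𝔭 X ^ j) :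
    ∀ j < N, c j = c' j := by
  induction N generalizing c c' with
  | zero => intro j hj; omega
  | succ N ih =>
    rw [Finset.sum_range_succ'] at h
    simp only [pow_zero, mul_one, pow_succ _ (_ : ℕ), ← mul_assoc, ← Finset.sum_mul] at h
    have h0 : c 0 = c' 0 := by
      have := (Dvd.dvd.trans (Dvd.intro_left _ rfl) h : Ideal.Quotient.mk 𝔭 X ∣ _)
      rw [dvd_add_right (Dvd.intro_left _ rfl), mk_dvd_sub_iff hX, hlam, hlam] at this
      exact this
    rw [h0, sub_self, add_zero] at h
    have h1 := ih (fun j ↦ c (j + 1)) (fun j ↦ c' (j + 1))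
      ((mul_dvd_mul_iff_right hX.ne_zero).1 h)
    intro j hj
    match j with
    | 0 => exact h0
    | j + 1 => exact h1 j (by omega)

end Digits

section Germs

variable {A : Type*} [CommRing A] [IsLocalRing A]

/-- The equation `Y = ∑ lam(c_i) X ^ i` (`r ≤ i ≤ n`) of a curve, as an element of `A`. -/
noncomputable def curveGerm (r n : ℕ) (X Y : A) (lam : ResidueField A → A)
    (c : Finset.Icc r n → ResidueField A) : A :=
  -Y + ∑ i, lam (c i) * X ^ (i : ℕ)

theorem sum_Icc_coe_eq_sum_range {M : Type*} [AddCommMonoid M] (r n : ℕ) (f : ℕ → M) :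
    ∑ i : Finset.Icc r n, f i = ∑ j ∈ Finset.range (n + 1 - r), f (r + j) := by
  rw [Finset.sum_coe_sort (Finset.Icc r n) f, ← Finset.sum_Ico_eq_sum_range]
  rfl

/-- Extension of a coefficient vector to all natural numbers, shifted by `r`. -/
noncomputable def shiftCoeff {k : Type*} [Zero k] {r n : ℕ} (c : Finset.Icc r n → k) (j : ℕ) : k :=
  if h : r + j ∈ Finset.Icc r n then c ⟨r + j, h⟩ else 0

theorem shiftCoeff_apply {k : Type*} [Zero k] {r n : ℕ} (c : Finset.Icc r n → k)
    (i : Finset.Icc r n) : shiftCoeff c (i - r) = c i := by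
  have h := Finset.mem_Icc.1 i.2
  have e : r + (i - r) = (i : ℕ) := by omega
  unfold shiftCoeff
  simp [e]

theorem sum_Icc_coeff {k M : Type*} [Zero k] [AddCommMonoid M] {r n : ℕ} (c : Finset.Icc r n → k)
    (f : k → ℕ → M) : ∑ i : Finset.Icc r n, f (c i) i =
      ∑ j ∈ Finset.range (n + 1 - r), f (shiftCoeff c j) (r + j) := by
  have := sum_Icc_coe_eq_sum_range r n (fun i ↦ f (shiftCoeff c (i - r)) i)
  simpa only [shiftCoeff_apply, Nat.add_sub_cancel_left] using this

end Germs

/-! ### Jets of curves -/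

section GermCurves

variable {A : Type*} [CommRing A] [IsLocalRing A] {X Y : A} {lam : ResidueField A → A} {r n : ℕ}

theorem mk_curveGerm (𝔭 : Ideal A) (c : Finset.Icc r n → ResidueField A) :
    Ideal.Quotient.mk 𝔭 (curveGerm r n X Y lam c) = -Ideal.Quotient.mk 𝔭 Y +
      Ideal.Quotient.mk 𝔭 X ^ r * ∑ j ∈ Finset.range (n + 1 - r),
        Ideal.Quotient.mk 𝔭 (lam (shiftCoeff c j)) * Ideal.Quotient.mk 𝔭 X ^ j := by
  rw [curveGerm, sum_Icc_coeff c (fun a i ↦ lam a * X ^ i), map_add, map_neg, map_sum,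
    Finset.mul_sum]
  congr 1
  refine Finset.sum_congr rfl fun j _ ↦ ?_
  rw [map_mul, map_pow, pow_add]
  ring

theorem sum_mem_span_X (hr : 1 ≤ r) (c : Finset.Icc r n → ResidueField A) :
    ∑ i, lam (c i) * X ^ (i : ℕ) ∈ Ideal.span {X} := by
  refine Ideal.sum_mem _ fun i _ ↦ Ideal.mul_mem_left _ _ ?_
  have := (Finset.mem_Icc.1 i.2).1
  exact Ideal.pow_mem_of_mem _ (Ideal.mem_span_singleton_self X) _ (by omega)

theorem span_curveGerm (hr : 1 ≤ r) (hXY : Ideal.span {X, Y} = maximalIdeal A)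
    (c : Finset.Icc r n → ResidueField A) :
    Ideal.span {curveGerm r n X Y lam c, X} = maximalIdeal A := by
  obtain ⟨a, ha⟩ := Ideal.mem_span_singleton'.1 (sum_mem_span_X (lam := lam) (X := X) hr c)
  rw [← hXY, curveGerm, ← ha]
  apply le_antisymm
  · rw [Ideal.span_le, Set.insert_subset_iff, Set.singleton_subset_iff]
    refine ⟨?_, Ideal.subset_span (by simp)⟩
    exact Ideal.mem_span_pair.2 ⟨a, -1, by ring⟩
  · rw [Ideal.span_le, Set.insert_subset_iff, Set.singleton_subset_iff]
    refine ⟨Ideal.subset_span (by simp), ?_⟩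
    exact Ideal.mem_span_pair.2 ⟨-1, a, by ring⟩

theorem notMem_sup_sq_of_span_eq {𝔭 : Ideal A} (h𝔭 : 𝔭 ∈ regularCurves A) {g : A} (hg : g ∈ 𝔭)
    (hgX : Ideal.span {g, X} = maximalIdeal A) : X ∉ 𝔭 ⊔ maximalIdeal A ^ 2 := by
  have : 𝔭.IsPrime := h𝔭.1.1
  have := isDiscreteValuationRing_of_mem_regularCurves h𝔭
  have h1 : maximalIdeal (A ⧸ 𝔭) = Ideal.span {Ideal.Quotient.mk 𝔭 X} := by
    rw [← IsLocalRing.map_maximalIdeal_of_surjective (Ideal.Quotient.mk 𝔭)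
      Ideal.Quotient.mk_surjective, ← hgX, Ideal.map_span, Set.image_pair,
      Ideal.Quotient.eq_zero_iff_mem.2 hg, Ideal.span_insert]
    simp
  have h2 : Irreducible (Ideal.Quotient.mk 𝔭 X) :=
    (IsDiscreteValuationRing.irreducible_iff_uniformizer _).2 h1
  rw [mem_sup_pow_iff_dvd h2]
  intro h
  have h3 := (pow_dvd_pow_iff h2.ne_zero h2.not_isUnit (n := 2) (m := 1)).1 (by simpa using h)
  omega

/-- A regular curve transversal to `X = 0` on which `Y` has order at least `r` agrees to order `n` with the
graph of a polynomial. -/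
theorem exists_curveGerm_mem {𝔭 : Ideal A} (h𝔭 : 𝔭 ∈ regularCurves A) (hXm : X ∈ maximalIdeal A)
    (hlam : ∀ x, residue A (lam x) = x)
    (hX : X ∉ 𝔭 ⊔ maximalIdeal A ^ 2) (hY : Y ∈ 𝔭 ⊔ maximalIdeal A ^ r) :
    ∃ c : Finset.Icc r n → ResidueField A,
      curveGerm r n X Y lam c ∈ 𝔭 ⊔ maximalIdeal A ^ (n + 1) ∧
      (Y ∉ 𝔭 ⊔ maximalIdeal A ^ (r + 1) → ∀ i : Finset.Icc r n, (i : ℕ) = r → c i ≠ 0) := by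
  have : 𝔭.IsPrime := h𝔭.1.1
  have := isDiscreteValuationRing_of_mem_regularCurves h𝔭
  have hirr := irreducible_mk_of_notMem hXm hX
  rw [mem_sup_pow_iff_dvd hirr] at hY
  obtain ⟨w, hw⟩ := hY
  obtain ⟨w, rfl⟩ := Ideal.Quotient.mk_surjective w
  obtain ⟨c, hc0, e, he⟩ := exists_digits hirr hlam (n + 1 - r) w
  refine ⟨fun i ↦ c (i - r), ?_, fun hY' i hi ↦ ?_⟩
  · rw [mem_sup_pow_iff_dvd hirr, mk_curveGerm, hw]
    have hs : ∑ j ∈ Finset.range (n + 1 - r), Ideal.Quotient.mk 𝔭 (lam (shiftCoeff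
        (fun i : Finset.Icc r n ↦ c (i - r)) j)) * Ideal.Quotient.mk 𝔭 X ^ j =
        ∑ j ∈ Finset.range (n + 1 - r), Ideal.Quotient.mk 𝔭 (lam (c j)) *
          Ideal.Quotient.mk 𝔭 X ^ j := by
      refine Finset.sum_congr rfl fun j hj ↦ ?_
      have := Finset.mem_range.1 hj
      rw [shiftCoeff, dif_pos (Finset.mem_Icc.2 ⟨by omega, by omega⟩)]
      simp
    rw [hs]
    have h1 : -(Ideal.Quotient.mk 𝔭 X ^ r * Ideal.Quotient.mk 𝔭 w) + Ideal.Quotient.mk 𝔭 X ^ r *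
        ∑ j ∈ Finset.range (n + 1 - r), Ideal.Quotient.mk 𝔭 (lam (c j)) *
          Ideal.Quotient.mk 𝔭 X ^ j =
        Ideal.Quotient.mk 𝔭 X ^ (r + (n + 1 - r)) * (-e) := by
      rw [pow_add]; linear_combination -Ideal.Quotient.mk 𝔭 X ^ r * he
    rw [h1]
    exact Dvd.dvd.mul_right (pow_dvd_pow _ (by omega)) _
  · rw [mem_sup_pow_iff_dvd hirr, hw, pow_succ,
      mul_dvd_mul_iff_left (pow_ne_zero r hirr.ne_zero)] at hY'
    simp only [hi, Nat.sub_self, hc0]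
    intro h
    apply hY'
    have := (mk_dvd_sub_iff hirr w 0).2 (by rw [h, map_zero])
    simpa using this

/-- The coefficients of the germ to which a curve agrees to order `n` are unique. -/
theorem curveGerm_injective {𝔭 : Ideal A} (h𝔭 : 𝔭 ∈ regularCurves A) (hXm : X ∈ maximalIdeal A)
    (hlam : ∀ x, residue A (lam x) = x) (hX : X ∉ 𝔭 ⊔ maximalIdeal A ^ 2)
    {c c' : Finset.Icc r n → ResidueField A}
    (h : curveGerm r n X Y lam c ∈ 𝔭 ⊔ maximalIdeal A ^ (n + 1))
    (h' : curveGerm r n X Y lam c' ∈ 𝔭 ⊔ maximalIdeal A ^ (n + 1)) : c = c' := by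
  have : 𝔭.IsPrime := h𝔭.1.1
  have := isDiscreteValuationRing_of_mem_regularCurves h𝔭
  have hirr := irreducible_mk_of_notMem hXm hX
  ext i
  have hi := Finset.mem_Icc.1 i.2
  have h1 := sub_mem h h'
  rw [mem_sup_pow_iff_dvd hirr, map_sub, mk_curveGerm, mk_curveGerm] at h1
  have h2 : Ideal.Quotient.mk 𝔭 X ^ r * Ideal.Quotient.mk 𝔭 X ^ (n + 1 - r) ∣
      Ideal.Quotient.mk 𝔭 X ^ r * ∑ j ∈ Finset.range (n + 1 - r),
        (Ideal.Quotient.mk 𝔭 (lam (shiftCoeff c j)) - Ideal.Quotient.mk 𝔭 (lam (shiftCoeff c' j)))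
          * Ideal.Quotient.mk 𝔭 X ^ j := by
    rw [← pow_add, Nat.add_sub_cancel' (by omega)]
    convert h1 using 1
    simp only [sub_mul, Finset.sum_sub_distrib]
    ring
  rw [mul_dvd_mul_iff_left (pow_ne_zero r hirr.ne_zero)] at h2
  have h3 := digits_unique hirr hlam _ _ _ h2 (i - r) (by omega)
  rwa [shiftCoeff_apply, shiftCoeff_apply] at h3

theorem mem_sup_pow_of_curveGerm_mem {𝔭 : Ideal A} (h𝔭 : 𝔭 ∈ regularCurves A)
    (hXm : X ∈ maximalIdeal A)
    (hlam : ∀ x, residue A (lam x) = x) (hX : X ∉ 𝔭 ⊔ maximalIdeal A ^ 2) (hrn : r ≤ n)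
    {c : Finset.Icc r n → ResidueField A}
    (h : curveGerm r n X Y lam c ∈ 𝔭 ⊔ maximalIdeal A ^ (n + 1)) :
    Y ∈ 𝔭 ⊔ maximalIdeal A ^ r ∧ ((∀ i : Finset.Icc r n, (i : ℕ) = r → c i ≠ 0) →
      Y ∉ 𝔭 ⊔ maximalIdeal A ^ (r + 1)) := by
  have : 𝔭.IsPrime := h𝔭.1.1
  have := isDiscreteValuationRing_of_mem_regularCurves h𝔭
  have hirr := irreducible_mk_of_notMem hXm hX
  rw [mem_sup_pow_iff_dvd hirr, mk_curveGerm] at h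
  have h1 := (pow_dvd_pow _ (by omega : r + 1 ≤ n + 1)).trans h
  refine ⟨?_, fun hc hY ↦ ?_⟩
  · rw [mem_sup_pow_iff_dvd hirr]
    have h2 := (pow_dvd_pow _ (by omega : r ≤ r + 1)).trans h1
    rwa [dvd_add_left (Dvd.intro _ rfl), dvd_neg] at h2
  · rw [mem_sup_pow_iff_dvd hirr] at hY
    rw [dvd_add_right (hY.neg_right), pow_succ, mul_dvd_mul_iff_left (pow_ne_zero r hirr.ne_zero),
      show n + 1 - r = (n - r) + 1 by omega, Finset.sum_range_succ'] at h1
    rw [dvd_add_right, pow_zero, mul_one] at h1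
    · have h3 := (mk_dvd_sub_iff hirr (lam (shiftCoeff c 0)) 0).1 (by simpa using h1)
      rw [hlam, map_zero] at h3
      have h4 := shiftCoeff_apply c ⟨r, Finset.mem_Icc.2 ⟨le_rfl, hrn⟩⟩
      simp only [Nat.sub_self] at h4
      exact hc _ rfl (h4.symm.trans h3)
    · refine Finset.dvd_sum fun j _ ↦ ?_
      exact (dvd_pow_self _ j.succ_ne_zero).mul_left _

end GermCurves

section Jets

variable {A : Type*} [CommRing A] [IsLocalRing A] {L : Type*} [Field L] [Algebra A L] {n : ℕ}

theorem mem_regularCurves_of_mem_regularUnramified {A L : Type*} [CommRing A] [Field L]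
    [Algebra A L] {𝔭 : Ideal A}
    (h : 𝔭 ∈ regularUnramified A L) : 𝔭 ∈ regularCurves A := ⟨h.1, h.2.1⟩

theorem mem_jet_iff {I 𝔭 : Ideal A} : 𝔭 ∈ jet A L n I ↔
    𝔭 ∈ regularUnramified A L ∧ I ≤ 𝔭 ⊔ maximalIdeal A ^ (n + 1) :=
  and_congr_right fun h ↦ le_interNum_iff (mem_regularCurves_of_mem_regularUnramified h) I (n + 1)

theorem jet_congr {I J : Ideal A}
    (h : I ⊔ maximalIdeal A ^ (n + 1) = J ⊔ maximalIdeal A ^ (n + 1)) :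
    jet A L n I = jet A L n J := by
  have key : ∀ I 𝔭 : Ideal A, I ≤ 𝔭 ⊔ maximalIdeal A ^ (n + 1) ↔
      I ⊔ maximalIdeal A ^ (n + 1) ≤ 𝔭 ⊔ maximalIdeal A ^ (n + 1) :=
    fun I 𝔭 ↦ ⟨fun h ↦ sup_le h le_sup_right, fun h ↦ le_sup_left.trans h⟩
  ext 𝔭
  rw [mem_jet_iff, mem_jet_iff, key I, key J, h]

theorem jet_eq_of_le_interNum {𝔭 𝔮 : Ideal A} (h𝔭 : 𝔭 ∈ regularCurves A)
    (h𝔮 : 𝔮 ∈ regularCurves A) (h : ((n + 1 : ℕ) : ℕ∞) ≤ interNum 𝔭 𝔮) :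
    jet A L n 𝔭 = jet A L n 𝔮 :=
  jet_congr (sup_pow_eq_of_le_interNum h𝔭 h𝔮 h)

theorem jet_span_eq_of_sub_mem {f g : A} (h : f - g ∈ maximalIdeal A ^ (n + 1)) :
    jet A L n (Ideal.span {f}) = jet A L n (Ideal.span {g}) := by
  apply jet_congr
  apply le_antisymm
  · refine sup_le ?_ le_sup_right
    rw [Ideal.span_singleton_le_iff_mem, ← sub_add_cancel f g]
    exact add_mem (Ideal.mem_sup_right h) (Ideal.mem_sup_left (Ideal.mem_span_singleton_self g))
  · refine sup_le ?_ le_sup_right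
    rw [Ideal.span_singleton_le_iff_mem, ← sub_sub_cancel f g]
    exact sub_mem (Ideal.mem_sup_left (Ideal.mem_span_singleton_self f)) (Ideal.mem_sup_right h)

end Jets

/-! ### Families of graphs -/

section Family

variable {A : Type*} [CommRing A] [IsLocalRing A] {L : Type*} [Field L] [Algebra A L]

/-- The condition on the regular curves `𝔭` of a set `S` that makes them graphs
`Y = ∑ c_i X ^ i` with `i ≥ r`: the parameter `X` is transversal to `𝔭`, and `Y` has order at least
`r` along `𝔭`, with equality unless `r = d = 1`. -/
structure IsGraphFamily (L : Type*) [Field L] [Algebra A L] (d r : ℕ) (X Y : A)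
    (S : Set (Ideal A)) : Prop where
  span_eq : Ideal.span {X, Y} = maximalIdeal A
  subset : S ⊆ regularUnramified A L
  mem_iff : ∀ 𝔭 ∈ regularCurves A, 𝔭 ∈ S ↔ X ∉ 𝔭 ⊔ maximalIdeal A ^ 2 ∧
    Y ∈ 𝔭 ⊔ maximalIdeal A ^ r ∧ (¬ (r = 1 ∧ d = 1) → Y ∉ 𝔭 ⊔ maximalIdeal A ^ (r + 1))

variable {d r n : ℕ} {X Y : A} {S : Set (Ideal A)} {lam : ResidueField A → A}

theorem IsGraphFamily.mem_maximalIdeal (h : IsGraphFamily L d r X Y S) :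
    X ∈ maximalIdeal A ∧ Y ∈ maximalIdeal A := by
  rw [← h.span_eq]
  exact ⟨Ideal.subset_span (by simp), Ideal.subset_span (by simp)⟩

theorem IsGraphFamily.mem_regularCurves (h : IsGraphFamily L d r X Y S) {𝔭 : Ideal A}
    (h𝔭 : 𝔭 ∈ S) : 𝔭 ∈ regularCurves A :=
  mem_regularCurves_of_mem_regularUnramified (h.subset h𝔭)

theorem IsGraphFamily.exists_coeff (h : IsGraphFamily L d r X Y S)
    (hlam : ∀ x, residue A (lam x) = x) {𝔭 : Ideal A} (h𝔭 : 𝔭 ∈ S) (n : ℕ) :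
    ∃ c ∈ coeffSpace (ResidueField A) d r n,
      curveGerm r n X Y lam c ∈ 𝔭 ⊔ maximalIdeal A ^ (n + 1) := by
  have hreg := h.mem_regularCurves h𝔭
  obtain ⟨hX, hY, hY'⟩ := (h.mem_iff _ hreg).1 h𝔭
  obtain ⟨c, hc, hc'⟩ := exists_curveGerm_mem (n := n) hreg h.mem_maximalIdeal.1 hlam hX hY
  exact ⟨c, or_iff_not_imp_left.2 fun hP ↦ hc' (hY' hP), hc⟩

/-- Extension of a vector of coefficients to higher order: by zeros, except that the leading
coefficient is put to `1` if it is not given. -/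
noncomputable def extendCoeff {k : Type*} [Zero k] [One k] {r n : ℕ} (N : ℕ)
    (c : Finset.Icc r n → k) (i : Finset.Icc r N) : k :=
  if h : (i : ℕ) ∈ Finset.Icc r n then c ⟨i, h⟩ else if (i : ℕ) = r then 1 else 0

theorem extendCoeff_mem_coeffSpace {k : Type*} [Field k] (N : ℕ) {c : Finset.Icc r n → k}
    (hc : c ∈ coeffSpace k d r n) : extendCoeff N c ∈ coeffSpace k d r N := by
  refine hc.imp_right fun hc i hi ↦ ?_
  unfold extendCoeff
  split_ifs with h1
  · exact hc _ hi
  · exact one_ne_zero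

theorem curveGerm_sub_extendCoeff_mem (hXm : X ∈ maximalIdeal A) (p : ℕ) [Fact p.Prime]
    [CharP A p] [IsAlgClosed (ResidueField A)] (hr : 1 ≤ r) {N : ℕ} (hnN : n ≤ N)
    {lam' : ResidueField A → A} (hlam : IsSection n lam) (hlam' : IsSection n lam')
    (c : Finset.Icc r n → ResidueField A) :
    curveGerm r n X Y lam c - curveGerm r N X Y lam' (extendCoeff N c) ∈
      maximalIdeal A ^ (n + 1) := by
  have e : curveGerm r n X Y lam c - curveGerm r N X Y lam' (extendCoeff N c) =
      ∑ i, lam (c i) * X ^ (i : ℕ) - ∑ i, lam' (extendCoeff N c i) * X ^ (i : ℕ) := by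
    unfold curveGerm; ring
  rw [e, sum_Icc_coeff c (fun a i ↦ lam a * X ^ i),
    sum_Icc_coeff (extendCoeff N c) (fun a i ↦ lam' a * X ^ i),
    ← Finset.sum_range_add_sum_Ico _ (show n + 1 - r ≤ N + 1 - r by omega), ← sub_sub,
    ← Finset.sum_sub_distrib]
  refine sub_mem (Ideal.sum_mem _ fun j hj ↦ ?_) (Ideal.sum_mem _ fun j hj ↦ ?_)
  · have hj := Finset.mem_range.1 hj
    have h1 : shiftCoeff (extendCoeff N c) j = shiftCoeff c j := by
      have h2 : r + j ∈ Finset.Icc r n := Finset.mem_Icc.2 ⟨by omega, by omega⟩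
      have h3 : r + j ∈ Finset.Icc r N := Finset.mem_Icc.2 ⟨by omega, by omega⟩
      simp only [shiftCoeff, extendCoeff, h2, h3, dif_pos]
    rw [h1, ← sub_mul, pow_succ]
    refine Ideal.mul_mem_mul (hlam.sub_mem_pow p hlam' _) ?_
    exact Ideal.pow_mem_of_mem _ hXm _ (by omega)
  · have hj := Finset.mem_Ico.1 hj
    refine Ideal.mul_mem_left _ _ ?_
    exact Ideal.pow_le_pow_right (by omega) (Ideal.pow_mem_pow hXm _)

variable [IsNoetherianRing A]

theorem IsGraphFamily.span_curveGerm_mem_regularCurves (h : IsGraphFamily L d r X Y S)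
    (hdim : ringKrullDim A = 2) (hr : 1 ≤ r) (c : Finset.Icc r n → ResidueField A) :
    Ideal.span {curveGerm r n X Y lam c} ∈ regularCurves A :=
  span_mem_regularCurves hdim (span_curveGerm hr h.span_eq c)

theorem IsGraphFamily.notMem_sup_sq (h : IsGraphFamily L d r X Y S)
    (hdim : ringKrullDim A = 2) (hr : 1 ≤ r) (c : Finset.Icc r n → ResidueField A) :
    X ∉ Ideal.span {curveGerm r n X Y lam c} ⊔ maximalIdeal A ^ 2 :=
  notMem_sup_sq_of_span_eq (h.span_curveGerm_mem_regularCurves hdim hr c)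
    (Ideal.mem_span_singleton_self _) (span_curveGerm hr h.span_eq c)

theorem IsGraphFamily.span_curveGerm_mem (h : IsGraphFamily L d r X Y S)
    (hdim : ringKrullDim A = 2) (hr : 1 ≤ r) (hlam : ∀ x, residue A (lam x) = x)
    {c : Finset.Icc r n → ResidueField A} (hc : c ∈ coeffSpace (ResidueField A) d r n)
    (hrn : r ≤ n ∨ (r = 1 ∧ d = 1)) :
    Ideal.span {curveGerm r n X Y lam c} ∈ S := by
  have hreg := h.span_curveGerm_mem_regularCurves hdim hr (lam := lam) c
  have hX := h.notMem_sup_sq hdim hr (lam := lam) c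
  rw [h.mem_iff _ hreg]
  refine ⟨hX, ?_⟩
  by_cases hrn' : r ≤ n
  · have := mem_sup_pow_of_curveGerm_mem hreg h.mem_maximalIdeal.1 hlam hX hrn'
      (Ideal.mem_sup_left (Ideal.mem_span_singleton_self _))
    exact ⟨this.1, fun h' ↦ this.2 (hc.resolve_left h')⟩
  · have h1 := hrn.resolve_left hrn'
    refine ⟨?_, fun h' ↦ absurd h1 h'⟩
    have h2 : maximalIdeal A ^ r = maximalIdeal A := by rw [h1.1, pow_one]
    rw [h2]
    exact Ideal.mem_sup_right h.mem_maximalIdeal.2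

/-- Every jet with the given coefficients is the jet of a member of the family. -/
theorem IsGraphFamily.exists_mem_jet_eq (h : IsGraphFamily L d r X Y S)
    (hdim : ringKrullDim A = 2) (p : ℕ) [Fact p.Prime] [CharP A p] [IsAlgClosed (ResidueField A)]
    (hr : 1 ≤ r) {N : ℕ} (hnN : n ≤ N) (hrN : r ≤ N) {lam' : ResidueField A → A}
    (hlam : IsSection n lam) (hlam' : IsSection N lam') {c : Finset.Icc r n → ResidueField A}
    (hc : c ∈ coeffSpace (ResidueField A) d r n) :
    Ideal.span {curveGerm r N X Y lam' (extendCoeff N c)} ∈ S ∧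
    jet A L n (Ideal.span {curveGerm r N X Y lam' (extendCoeff N c)}) =
      jet A L n (Ideal.span {curveGerm r n X Y lam c}) :=
  ⟨h.span_curveGerm_mem hdim hr hlam'.residue_eq (extendCoeff_mem_coeffSpace N hc) (Or.inl hrN),
    (jet_span_eq_of_sub_mem (curveGerm_sub_extendCoeff_mem h.mem_maximalIdeal.1 p hr hnN hlam
      (hlam'.of_le hnN) c)).symm⟩

theorem IsGraphFamily.jet_eq (h : IsGraphFamily L d r X Y S)
    (hdim : ringKrullDim A = 2) (hr : 1 ≤ r) {𝔭 : Ideal A} (h𝔭 : 𝔭 ∈ S)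
    {c : Finset.Icc r n → ResidueField A}
    (hc : curveGerm r n X Y lam c ∈ 𝔭 ⊔ maximalIdeal A ^ (n + 1)) :
    jet A L n 𝔭 = jet A L n (Ideal.span {curveGerm r n X Y lam c}) := by
  have hreg := h.mem_regularCurves h𝔭
  refine jet_eq_of_le_interNum hreg (h.span_curveGerm_mem_regularCurves hdim hr c) ?_
  rwa [le_interNum_iff hreg, Ideal.span_singleton_le_iff_mem]

/-- The jets of order `n` of a graph family are parametrized by their coefficients. If `n < r`, then there
are no coefficients, and a member of the family with the given jet is found in order `r`. -/
theorem IsGraphFamily.bijOn (h : IsGraphFamily L d r X Y S)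
    (hdim : ringKrullDim A = 2) (p : ℕ) [Fact p.Prime] [CharP A p] [IsAlgClosed (ResidueField A)]
    (hr : 1 ≤ r) (hlam : IsSection n lam) :
    Set.BijOn (fun c ↦ jet A L n (Ideal.span {curveGerm r n X Y lam c}))
      (coeffSpace (ResidueField A) d r n) (jet A L n '' S) := by
  obtain ⟨lam', hlam'⟩ := exists_isSection (A := A) p (max n r)
  refine ⟨fun c hc ↦ ?_, fun c hc c' hc' heq ↦ ?_, ?_⟩
  · obtain ⟨h1, h2⟩ := h.exists_mem_jet_eq hdim p hr (le_max_left n r) (le_max_right n r) hlam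
      hlam' hc
    exact ⟨_, h1, h2⟩
  · by_cases hrn : r ≤ n
    · have h1 := h.span_curveGerm_mem hdim hr hlam.residue_eq hc (Or.inl hrn)
      have hreg := h.mem_regularCurves h1
      have h2 : Ideal.span {curveGerm r n X Y lam c} ∈
          jet A L n (Ideal.span {curveGerm r n X Y lam c}) :=
        mem_jet_iff.2 ⟨h.subset h1, le_sup_left⟩
      simp only at heq
      rw [heq, mem_jet_iff, Ideal.span_singleton_le_iff_mem] at h2
      exact curveGerm_injective hreg h.mem_maximalIdeal.1 hlam.residue_eq
        (h.notMem_sup_sq hdim hr c) (Ideal.mem_sup_left (Ideal.mem_span_singleton_self _)) h2.2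
    · ext i
      have := Finset.mem_Icc.1 i.2
      omega
  · rintro _ ⟨𝔭, h𝔭, rfl⟩
    obtain ⟨c, hc, hc'⟩ := h.exists_coeff hlam.residue_eq h𝔭 n
    exact ⟨c, hc, (h.jet_eq hdim hr h𝔭 hc').symm⟩

/-- If an invariant `f` of the curves of the family is determined by the jet of order `n`, and the
condition `f ≤ s` is polynomial in the coefficients of the jet of some higher order `N`, then it is
polynomial in the coefficients of the jet of order `n`: substitute the extension by constants. -/
theorem IsGraphFamily.exists_zeroLocus (h : IsGraphFamily L d r X Y S)
    (hdim : ringKrullDim A = 2) (p : ℕ) [Fact p.Prime] [CharP A p] [IsAlgClosed (ResidueField A)]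
    (hr : 1 ≤ r) (hlam : IsSection n lam) {N : ℕ} (hnN : n ≤ N) (hrN : r ≤ N)
    {lam' : ResidueField A → A} (hlam' : IsSection N lam') (C : Ideal A → Prop)
    (hC : ∀ 𝔭 ∈ S, ∀ 𝔮 ∈ S, ((n + 1 : ℕ) : ℕ∞) ≤ interNum 𝔭 𝔮 → (C 𝔭 ↔ C 𝔮))
    (Q : Set (MvPolynomial (Finset.Icc r N) (ResidueField A)))
    (hQ : ∀ 𝔭 ∈ S, ∀ c ∈ coeffSpace (ResidueField A) d r N,
      curveGerm r N X Y lam' c ∈ 𝔭 ⊔ maximalIdeal A ^ (N + 1) →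
      (C 𝔭 ↔ ∀ q ∈ Q, MvPolynomial.eval c q = 0)) :
    ∃ I : Ideal (MvPolynomial (Finset.Icc r n) (ResidueField A)),
      jet A L n '' {𝔭 | 𝔭 ∈ S ∧ C 𝔭} =
        (fun c ↦ jet A L n (Ideal.span {curveGerm r n X Y lam c})) ''
        (coeffSpace (ResidueField A) d r n ∩ MvPolynomial.zeroLocus (ResidueField A) I) := by
  let φ : MvPolynomial (Finset.Icc r N) (ResidueField A) →ₐ[ResidueField A]
      MvPolynomial (Finset.Icc r n) (ResidueField A) :=
    MvPolynomial.aeval (extendCoeff N MvPolynomial.X)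
  have hφ : ∀ c q, MvPolynomial.eval c (φ q) = MvPolynomial.eval (extendCoeff N c) q := by
    intro c q
    have : (MvPolynomial.eval c).comp φ.toRingHom = MvPolynomial.eval (extendCoeff N c) := by
      apply MvPolynomial.ringHom_ext
      · intro a; simp [φ]
      · intro i
        simp only [φ, extendCoeff, AlgHom.toRingHom_eq_coe, RingHom.coe_comp, RingHom.coe_coe,
          Function.comp_apply, MvPolynomial.aeval_X, MvPolynomial.eval_X]
        split_ifs <;> simp
    exact congrArg (fun f : _ →+* _ ↦ f q) this
  refine ⟨Ideal.span (φ '' Q), ?_⟩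
  have hzero : ∀ c, c ∈ MvPolynomial.zeroLocus (ResidueField A) (Ideal.span (φ '' Q)) ↔
      ∀ q ∈ Q, MvPolynomial.eval (extendCoeff N c) q = 0 := by
    intro c
    rw [MvPolynomial.zeroLocus_span]
    simp [hφ, MvPolynomial.aeval_eq_eval]
  have key : ∀ c ∈ coeffSpace (ResidueField A) d r n,
      c ∈ MvPolynomial.zeroLocus (ResidueField A) (Ideal.span (φ '' Q)) ↔
        C (Ideal.span {curveGerm r N X Y lam' (extendCoeff N c)}) := by
    intro c hc
    rw [hzero]
    obtain ⟨h1, -⟩ := h.exists_mem_jet_eq hdim p hr hnN hrN hlam hlam' hc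
    exact (hQ _ h1 _ (extendCoeff_mem_coeffSpace N hc)
      (Ideal.mem_sup_left (Ideal.mem_span_singleton_self _))).symm
  ext j
  constructor
  · rintro ⟨𝔭, ⟨h𝔭, hC𝔭⟩, rfl⟩
    obtain ⟨c, hc, hc'⟩ := h.exists_coeff hlam.residue_eq h𝔭 n
    refine ⟨c, ⟨hc, (key c hc).2 ?_⟩, (h.jet_eq hdim hr h𝔭 hc').symm⟩
    obtain ⟨h1, h2⟩ := h.exists_mem_jet_eq hdim p hr hnN hrN hlam hlam' hc
    refine (hC _ h𝔭 _ h1 ?_).1 hC𝔭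
    have h3 : 𝔭 ∈ jet A L n 𝔭 := mem_jet_iff.2 ⟨h.subset h𝔭, le_sup_left⟩
    rw [h.jet_eq hdim hr h𝔭 hc', ← h2] at h3
    exact h3.2
  · rintro ⟨c, ⟨hc, hcI⟩, rfl⟩
    obtain ⟨h1, h2⟩ := h.exists_mem_jet_eq hdim p hr hnN hrN hlam hlam' hc
    exact ⟨_, ⟨h1, (key c hc).1 hcI⟩, h2⟩

end Family

/-! ### Reduction of poles modulo the Artin-Schreier map -/

section ArtinSchreierReduction

variable {p : ℕ} [Fact p.Prime] {R F k : Type*} [CommRing R]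
  [Field F] [CharP F p] [Algebra R F] [Field k]

/-- The additive map `c ↦ c ^ p - c`. -/
def artinSchreierMap (p : ℕ) [Fact p.Prime] (F : Type*) [Field F] [CharP F p] : F →+ F :=
  AddMonoidHom.mk' (fun c ↦ c ^ p - c) fun a b ↦ by
    simp only [add_pow_char]; ring

/-- The elements of `F` that are congruent to an element of `R` modulo the image of the
Artin-Schreier map. -/
def integralClasses (p : ℕ) [Fact p.Prime] (R F : Type*) [CommRing R] [Field F] [CharP F p]
    [Algebra R F] : AddSubgroup F :=
  (algebraMap R F).range.toAddSubgroup ⊔ (artinSchreierMap p F).range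

theorem mem_integralClasses_iff {b : F} : b ∈ integralClasses p R F ↔
    ∃ (a : R) (c : F), b = algebraMap R F a + (c ^ p - c) := by
  rw [integralClasses, AddSubgroup.mem_sup]
  constructor
  · rintro ⟨_, ⟨a, rfl⟩, _, ⟨c, rfl⟩, rfl⟩
    exact ⟨a, c, rfl⟩
  · rintro ⟨a, c, rfl⟩
    exact ⟨_, ⟨a, rfl⟩, _, ⟨c, rfl⟩, rfl⟩

theorem algebraMap_mem_integralClasses (a : R) : algebraMap R F a ∈ integralClasses p R F :=
  mem_integralClasses_iff.2 ⟨a, 0, by simp [(Fact.out : p.Prime).ne_zero]⟩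

theorem div_mem_integralClasses {x a : R} (hx : algebraMap R F x ≠ 0) {D i : ℕ} (hi : i ≤ D)
    (h : x ^ D ∣ a) : algebraMap R F a / algebraMap R F x ^ i ∈ integralClasses p R F := by
  obtain ⟨e, rfl⟩ := h
  have : algebraMap R F (x ^ D * e) / algebraMap R F x ^ i = algebraMap R F (x ^ (D - i) * e) := by
    rw [div_eq_iff (pow_ne_zero i hx)]
    simp only [map_mul, map_pow]
    rw [mul_right_comm, ← pow_add, Nat.sub_add_cancel hi]
  rw [this]
  exact algebraMap_mem_integralClasses _

/-- The class of the monomial `a x ^ (-i)`, for a set-theoretic lift of the coefficients. -/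
def poleClass (p : ℕ) [Fact p.Prime] [CharP F p] (μ : k → R) (x : R) (i : ℕ) (a : k) :
    F ⧸ integralClasses p R F :=
  QuotientAddGroup.mk (algebraMap R F (μ a) / algebraMap R F x ^ i)

variable {μ : k → R} {x : R} {D : ℕ}

theorem poleClass_add (hx : algebraMap R F x ≠ 0)
    (hadd : ∀ a b, x ^ D ∣ μ (a + b) - (μ a + μ b)) {i : ℕ} (hi : i ≤ D) (a b : k) :
    poleClass (F := F) p μ x i (a + b) = poleClass p μ x i a + poleClass p μ x i b := by
  unfold poleClass
  rw [← QuotientAddGroup.mk_add, ← sub_eq_zero, ← QuotientAddGroup.mk_sub,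
    QuotientAddGroup.eq_zero_iff, ← add_div, ← sub_div, ← map_add, ← map_sub]
  exact div_mem_integralClasses hx hi (hadd a b)

theorem poleClass_zero (hx : algebraMap R F x ≠ 0)
    (hadd : ∀ a b, x ^ D ∣ μ (a + b) - (μ a + μ b)) {i : ℕ} (hi : i ≤ D) :
    poleClass (F := F) p μ x i 0 = 0 := by
  have := poleClass_add (p := p) (F := F) hx hadd hi 0 0
  rwa [add_zero, right_eq_add] at this

theorem poleClass_sum (hx : algebraMap R F x ≠ 0)
    (hadd : ∀ a b, x ^ D ∣ μ (a + b) - (μ a + μ b)) {i : ℕ} (hi : i ≤ D) {ι : Type*}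
    (s : Finset ι) (f : ι → k) :
    poleClass (F := F) p μ x i (∑ j ∈ s, f j) = ∑ j ∈ s, poleClass p μ x i (f j) := by
  classical
  induction s using Finset.induction_on with
  | empty => simpa using poleClass_zero hx hadd hi
  | insert j s hj ih =>
    rw [Finset.sum_insert hj, Finset.sum_insert hj, poleClass_add hx hadd hi, ih]

variable [CharP k p] [PerfectRing k p]

theorem poleClass_mul_pow (hx : algebraMap R F x ≠ 0)
    (hpow : ∀ a, x ^ D ∣ μ (a ^ p) - μ a ^ p) {i e : ℕ} (hi : i * p ^ e ≤ D) (a : k) :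
    poleClass (F := F) p μ x (i * p ^ e) a =
      poleClass p μ x i ((iterateFrobeniusEquiv k p e).symm a) := by
  have step : ∀ (i : ℕ) (a : k), i * p ≤ D →
      poleClass (F := F) p μ x (i * p) (a ^ p) = poleClass p μ x i a := by
    intro i a hi
    unfold poleClass
    rw [← sub_eq_zero, ← QuotientAddGroup.mk_sub, QuotientAddGroup.eq_zero_iff]
    have e : algebraMap R F (μ (a ^ p)) / algebraMap R F x ^ (i * p) -
        algebraMap R F (μ a) / algebraMap R F x ^ i =
        algebraMap R F (μ (a ^ p) - μ a ^ p) / algebraMap R F x ^ (i * p) +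
        ((algebraMap R F (μ a) / algebraMap R F x ^ i) ^ p -
          algebraMap R F (μ a) / algebraMap R F x ^ i) := by
      rw [map_sub, map_pow, div_pow, ← pow_mul]
      ring
    rw [e]
    refine add_mem (div_mem_integralClasses hx hi (hpow a)) ?_
    exact mem_integralClasses_iff.2 ⟨0, _, by rw [map_zero, zero_add]⟩
  obtain ⟨a, rfl⟩ := (iterateFrobeniusEquiv k p e).surjective a
  rw [RingEquiv.symm_apply_apply, iterateFrobeniusEquiv_def]
  induction e generalizing a with
  | zero => simp
  | succ e ih =>
    have h1 : i * p ^ (e + 1) = i * p ^ e * p := by ring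
    have h2 : a ^ p ^ (e + 1) = (a ^ p ^ e) ^ p := by ring
    rw [h1] at hi ⊢
    rw [h2, step _ _ hi]
    exact ih ((Nat.le_mul_of_pos_right _ (Fact.out : p.Prime).pos).trans hi) a

/-- The coefficient of `x ^ (-i)`, for `i` prime to `p`, in the reduced form modulo the
Artin-Schreier map of the principal part `∑ w (D - j) x ^ (-j)`: the poles of order `i p ^ e` are
moved to order `i` by taking `p ^ e`-th roots of their coefficients. -/
noncomputable def reducedCoeff (p : ℕ) [Fact p.Prime] [CharP k p] [PerfectRing k p] (D : ℕ)
    (w : ℕ → k) (i : ℕ) : k :=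
  ∑ j ∈ Finset.Icc 1 D with j / p ^ j.factorization p = i,
    (iterateFrobeniusEquiv k p (j.factorization p)).symm (w (D - j))

theorem reducedCoeff_eq_zero_of_dvd {w : ℕ → k} {i : ℕ} (hi : p ∣ i) :
    reducedCoeff p D w i = 0 := by
  apply Finset.sum_eq_zero
  intro j hj
  rw [Finset.mem_filter, Finset.mem_Icc] at hj
  exact absurd (hj.2 ▸ hi) (Nat.not_dvd_ordCompl Fact.out (by omega))

theorem mk_eq_sum_poleClass (hx : algebraMap R F x ≠ 0)
    (hadd : ∀ a b, x ^ D ∣ μ (a + b) - (μ a + μ b)) (hpow : ∀ a, x ^ D ∣ μ (a ^ p) - μ a ^ p)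
    {b : F} {β : R} (hb : b * algebraMap R F x ^ D = algebraMap R F β) {w : ℕ → k}
    (hβ : x ^ D ∣ β - ∑ j ∈ Finset.range D, μ (w j) * x ^ j) :
    (QuotientAddGroup.mk b : F ⧸ integralClasses p R F) =
      ∑ i ∈ Finset.Icc 1 D, poleClass p μ x i (reducedCoeff p D w i) := by
  have h1 : (QuotientAddGroup.mk b : F ⧸ integralClasses p R F) =
      ∑ j ∈ Finset.Icc 1 D, poleClass p μ x j (w (D - j)) := by
    have h2 : b = algebraMap R F (β - ∑ j ∈ Finset.range D, μ (w j) * x ^ j) /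
        algebraMap R F x ^ D +
        ∑ j ∈ Finset.Icc 1 D, algebraMap R F (μ (w (D - j))) / algebraMap R F x ^ j := by
      have h3 : ∑ j ∈ Finset.Icc 1 D, algebraMap R F (μ (w (D - j))) / algebraMap R F x ^ j =
          (∑ j ∈ Finset.range D, algebraMap R F (μ (w j)) * algebraMap R F x ^ j) /
            algebraMap R F x ^ D := by
        rw [Finset.sum_div]
        refine Finset.sum_nbij' (fun j ↦ D - j) (fun j ↦ D - j) ?_ ?_ ?_ ?_ ?_
        · intro j hj; rw [Finset.mem_Icc] at hj; rw [Finset.mem_range]; omega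
        · intro j hj; rw [Finset.mem_range] at hj; rw [Finset.mem_Icc]; omega
        · intro j hj; rw [Finset.mem_Icc] at hj; omega
        · intro j hj; rw [Finset.mem_range] at hj; omega
        · intro j hj
          rw [Finset.mem_Icc] at hj
          rw [div_eq_div_iff (pow_ne_zero _ hx) (pow_ne_zero _ hx), mul_assoc, ← pow_add,
            Nat.sub_add_cancel hj.2]
      rw [h3, ← add_div, eq_div_iff (pow_ne_zero _ hx), hb, map_sub, map_sum]
      simp
    conv_lhs => rw [h2]
    rw [QuotientAddGroup.mk_add, (QuotientAddGroup.eq_zero_iff _).2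
      (div_mem_integralClasses hx le_rfl hβ), zero_add]
    exact map_sum (QuotientAddGroup.mk' (integralClasses p R F)) _ _
  rw [h1]
  have hmaps : ∀ j ∈ Finset.Icc 1 D, j / p ^ j.factorization p ∈ Finset.Icc 1 D := by
    intro j hj
    rw [Finset.mem_Icc] at hj ⊢
    exact ⟨Nat.ordCompl_pos p (by omega), (Nat.div_le_self _ _).trans hj.2⟩
  rw [← Finset.sum_fiberwise_of_maps_to hmaps]
  refine Finset.sum_congr rfl fun i hi ↦ ?_
  rw [Finset.mem_Icc] at hi
  rw [reducedCoeff, poleClass_sum hx hadd hi.2]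
  refine Finset.sum_congr rfl fun j hj ↦ ?_
  rw [Finset.mem_filter, Finset.mem_Icc] at hj
  have h4 : i * p ^ j.factorization p = j := by
    rw [← hj.2, mul_comm]; exact Nat.ordProj_mul_ordCompl_eq_self j p
  conv_lhs => rw [← h4]
  rw [poleClass_mul_pow hx hpow (by rw [h4]; exact hj.1.2)]
  simp only [h4]

/-- The ramification jump of `E = F(θ)`, `θ ^ p - θ = b`, is the largest pole order of the reduced
form of `b`. -/
theorem ramificationJump_le_iff [IsDomain R] [IsDiscreteValuationRing R]
    [IsAlgClosed (ResidueField R)] [IsFractionRing R F] {E : Type*} [Field E] [Algebra R E]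
    [Algebra F E] [IsScalarTower R F E] {θ : E} {b : F} (hθ : θ ^ p - θ = algebraMap F E b)
    (hgen : IntermediateField.adjoin F {θ} = ⊤) (hx : Irreducible x)
    (hunit : ∀ a, a ≠ 0 → IsUnit (μ a))
    (hadd : ∀ a b, x ^ D ∣ μ (a + b) - (μ a + μ b)) (hpow : ∀ a, x ^ D ∣ μ (a ^ p) - μ a ^ p)
    {β : R} (hb : b * algebraMap R F x ^ D = algebraMap R F β) {w : ℕ → k}
    (hβ : x ^ D ∣ β - ∑ j ∈ Finset.range D, μ (w j) * x ^ j) (s : ℕ) :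
    ramificationJump R E p ≤ s ↔ ∀ i ∈ Finset.Icc 1 D, s < i → reducedCoeff p D w i = 0 := by
  classical
  have hx0 : algebraMap R F x ≠ 0 := by
    rw [Ne, IsFractionRing.to_map_eq_zero_iff]; exact hx.ne_zero
  have : CharP E p := charP_of_injective_algebraMap (algebraMap F E).injective p
  set T := (Finset.Icc 1 D).filter fun i ↦ reducedCoeff p D w i ≠ 0 with hT
  obtain ⟨a, c, hac⟩ : ∃ (a : R) (c : F), b - ∑ i ∈ T, algebraMap R F (μ (reducedCoeff p D w i)) /
      algebraMap R F x ^ i = algebraMap R F a + (c ^ p - c) := by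
    rw [← mem_integralClasses_iff, ← QuotientAddGroup.eq_zero_iff, QuotientAddGroup.mk_sub,
      sub_eq_zero, mk_eq_sum_poleClass hx0 hadd hpow hb hβ]
    have h1 := map_sum (QuotientAddGroup.mk' (integralClasses p R F))
      (fun i ↦ algebraMap R F (μ (reducedCoeff p D w i)) / algebraMap R F x ^ i) T
    refine Eq.trans ?_ h1.symm
    rw [hT, Finset.sum_filter]
    refine Finset.sum_congr rfl fun i hi ↦ ?_
    split_ifs with h
    · rfl
    · rw [not_not.1 h]
      exact poleClass_zero hx0 hadd (Finset.mem_Icc.1 hi).2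
  have hθ' : (θ - algebraMap F E c) ^ p - (θ - algebraMap F E c) =
      algebraMap F E (b - (c ^ p - c)) := by
    rw [sub_pow_char, map_sub, map_sub, map_pow, ← hθ]; ring
  have hgen' : IntermediateField.adjoin F {θ - algebraMap F E c} = ⊤ := by
    rw [← top_le_iff, ← hgen, IntermediateField.adjoin_le_iff, Set.singleton_subset_iff]
    have h1 := IntermediateField.mem_adjoin_simple_self F (θ - algebraMap F E c)
    simpa using add_mem h1 ((IntermediateField.adjoin F {θ - algebraMap F E c}).algebraMap_mem c)
  have hbc : b - (c ^ p - c) = algebraMap R F a +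
      ∑ i ∈ T, algebraMap R F (μ (reducedCoeff p D w i)) / algebraMap R F x ^ i := by
    linear_combination hac
  rcases T.eq_empty_or_nonempty with hTe | hTn
  · rw [hTe, Finset.sum_empty, add_zero] at hbc
    rw [hbc] at hθ'
    rw [ramificationJump_eq_zero F hθ' hgen']
    refine ⟨fun _ i hi _ ↦ ?_, fun _ ↦ Nat.zero_le s⟩
    by_contra h
    exact Finset.notMem_empty i (hTe ▸ Finset.mem_filter.2 ⟨hi, h⟩)
  · set m := T.max' hTn
    have hmT : m ∈ T := T.max'_mem hTn
    obtain ⟨hmD, hm0⟩ := Finset.mem_filter.1 hmT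
    rw [Finset.mem_Icc] at hmD
    have hpm : ¬ p ∣ m := fun h ↦ hm0 (reducedCoeff_eq_zero_of_dvd h)
    set v : R := a * x ^ m + ∑ i ∈ T, μ (reducedCoeff p D w i) * x ^ (m - i) with hv
    have hvu : IsUnit v := by
      by_contra hv'
      have h1 : v ∈ maximalIdeal R := (mem_maximalIdeal v).2 hv'
      have hxm : x ∈ maximalIdeal R := (mem_maximalIdeal x).2 hx.not_isUnit
      rw [hv, ← Finset.add_sum_erase T _ hmT, Nat.sub_self, pow_zero, mul_one] at h1
      have h2 : a * x ^ m ∈ maximalIdeal R :=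
        Ideal.mul_mem_left _ _ (Ideal.pow_mem_of_mem _ hxm _ (by omega))
      have h3 : ∑ i ∈ T.erase m, μ (reducedCoeff p D w i) * x ^ (m - i) ∈ maximalIdeal R := by
        refine Ideal.sum_mem _ fun i hi ↦ Ideal.mul_mem_left _ _
          (Ideal.pow_mem_of_mem _ hxm _ ?_)
        obtain ⟨hne, hi⟩ := Finset.mem_erase.1 hi
        have := T.le_max' i hi
        omega
      have h4 : μ (reducedCoeff p D w m) ∈ maximalIdeal R := by
        have := sub_mem (sub_mem h1 h2) h3
        simpa using this
      exact (mem_maximalIdeal _).1 h4 (hunit _ hm0)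
    obtain ⟨u, hu⟩ := hvu
    have hbm : (b - (c ^ p - c)) * algebraMap R F x ^ m = algebraMap R F u := by
      rw [hbc, hu, hv, add_mul, Finset.sum_mul, map_add, map_sum]
      congr 1
      · simp
      · refine Finset.sum_congr rfl fun i hi ↦ ?_
        rw [map_mul, map_pow, pow_sub₀ _ hx0 (show i ≤ m from T.le_max' i hi)]
        field_simp
    rw [ramificationJump_eq F hθ' hgen' hx hpm u hbm]
    constructor
    · intro hms i hi hsi
      by_contra h
      have := T.le_max' i (Finset.mem_filter.2 ⟨hi, h⟩)
      omega
    · intro h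
      by_contra! hsm
      exact hm0 (h m (Finset.mem_Icc.2 hmD) hsm)

end ArtinSchreierReduction

/-! ### Polynomial dependence on the coefficients of a curve -/

section SectionHom

universe w

variable {A : Type*} [CommRing A] [IsLocalRing A] {lam : ResidueField A → A} {n : ℕ}

/-- The ring homomorphism from the residue field induced by a section of level `n`, to any
`A`-algebra in which `𝔪 ^ n` vanishes. -/
def sectionHom (h : IsSection n lam) {Q : Type*} [CommRing Q] (π : A →+* Q)
    (hπ : ∀ z ∈ maximalIdeal A ^ n, π z = 0) : ResidueField A →+* Q where
  toFun a := π (lam a)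
  map_one' := by simpa [sub_eq_zero] using hπ _ h.map_one
  map_mul' a b := by simpa [sub_eq_zero] using hπ _ (h.map_mul a b)
  map_add' a b := by simpa [sub_eq_zero] using hπ _ (h.map_add a b)
  map_zero' := by
    have h1 := hπ _ (h.map_add 0 0)
    rw [add_zero, ← sub_sub, sub_self, zero_sub, map_neg, neg_eq_zero] at h1
    exact h1

theorem sectionHom_apply (h : IsSection n lam) {Q : Type*} [CommRing Q] (π : A →+* Q)
    (hπ : ∀ z ∈ maximalIdeal A ^ n, π z = 0) (a : ResidueField A) :
    sectionHom h π hπ a = π (lam a) := rfl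

/-- Modulo `𝔪 ^ n`, every element of `A` is a polynomial in the parameters `X` and `Y`, with
coefficients in the residue field; the same polynomial serves for all quotients. -/
theorem exists_polynomial_eq {X Y : A} (hXY : Ideal.span {X, Y} = maximalIdeal A)
    (h : IsSection n lam) (g : A) :
    ∃ G : Polynomial (Polynomial (ResidueField A)), ∀ {Q : Type w} [CommRing Q] (π : A →+* Q)
      (hπ : ∀ z ∈ maximalIdeal A ^ n, π z = 0),
      π g = G.eval₂ (Polynomial.eval₂RingHom (sectionHom h π hπ) (π X)) (π Y) := by
  have key : ∀ m : ℕ, ∀ g : A, ∃ G : Polynomial (Polynomial (ResidueField A)),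
      ∀ {Q : Type w} [CommRing Q] (π : A →+* Q) (hπ : ∀ z ∈ maximalIdeal A ^ n, π z = 0),
      π g - G.eval₂ (Polynomial.eval₂RingHom (sectionHom h π hπ) (π X)) (π Y) ∈
        (maximalIdeal A ^ m).map π := by
    intro m
    induction m with
    | zero => exact fun g ↦ ⟨0, fun π hπ ↦ by simp [Ideal.one_eq_top, Ideal.map_top]⟩
    | succ m ih =>
      intro g
      have h1 : g - lam (residue A g) ∈ maximalIdeal A :=
        (sub_mem_maximalIdeal_iff _ _).2 (h.residue_eq _).symm
      rw [← hXY, Ideal.mem_span_pair] at h1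
      obtain ⟨u, v, huv⟩ := h1
      obtain ⟨G₁, hG₁⟩ := ih u
      obtain ⟨G₂, hG₂⟩ := ih v
      refine ⟨Polynomial.C (Polynomial.C (residue A g)) + Polynomial.C Polynomial.X * G₁ +
        Polynomial.X * G₂, fun π hπ ↦ ?_⟩
      have hm : ∀ z ∈ ({X, Y} : Set A), π z ∈ (maximalIdeal A).map π := fun z hz ↦
        Ideal.mem_map_of_mem _ (hXY ▸ Ideal.subset_span hz)
      rw [pow_succ, Ideal.map_mul]
      have e : π g = π (lam (residue A g)) + π u * π X + π v * π Y := by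
        rw [← map_mul, ← map_mul, ← map_add, ← map_add]
        congr 1
        linear_combination -huv
      have := add_mem (Ideal.mul_mem_mul (hG₁ π hπ) (hm X (by simp)))
        (Ideal.mul_mem_mul (hG₂ π hπ) (hm Y (by simp)))
      convert this using 1
      rw [e]
      simp [Polynomial.eval₂_add, Polynomial.eval₂_mul, sectionHom_apply]
      ring
  obtain ⟨G, hG⟩ := key n g
  refine ⟨G, fun π hπ ↦ sub_eq_zero.1 ?_⟩
  have h1 := hG π hπ
  rwa [(Ideal.map_eq_bot_iff_le_ker π).2 fun z hz ↦ hπ z hz] at h1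

end SectionHom

/-- The vanishing of a reduced coefficient is a polynomial condition on parameters on which the principal
part depends polynomially, up to the common denominator `Γ`. -/
theorem exists_reducedCoeff_polynomial {k σ : Type*} [Field k] (p : ℕ) [Fact p.Prime] [CharP k p]
    [PerfectRing k p] (D i : ℕ) (Γ : MvPolynomial σ k) (W : ℕ → MvPolynomial σ k) :
    ∃ Q : MvPolynomial σ k, ∀ c, MvPolynomial.eval c Γ ≠ 0 →
      (reducedCoeff p D (fun j ↦ (MvPolynomial.eval c Γ)⁻¹ * MvPolynomial.eval c (W j)) i = 0 ↔
        MvPolynomial.eval c Q = 0) := by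
  refine ⟨∑ j ∈ Finset.Icc 1 D with j / p ^ j.factorization p = i,
    Γ ^ (p ^ D - p ^ (D - j.factorization p)) * W (D - j) ^ p ^ (D - j.factorization p),
    fun c hc ↦ ?_⟩
  -- raise to the power `p ^ D`, which clears the roots, and multiply by `Γ ^ p ^ D`
  rw [← pow_eq_zero_iff (pow_ne_zero D (Fact.out : p.Prime).ne_zero),
    ← mul_eq_zero_iff_left (pow_ne_zero (p ^ D) hc)]
  have e : reducedCoeff p D (fun j ↦ (MvPolynomial.eval c Γ)⁻¹ * MvPolynomial.eval c (W j)) i ^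
      p ^ D * MvPolynomial.eval c Γ ^ p ^ D = MvPolynomial.eval c
        (∑ j ∈ Finset.Icc 1 D with j / p ^ j.factorization p = i,
          Γ ^ (p ^ D - p ^ (D - j.factorization p)) *
            W (D - j) ^ p ^ (D - j.factorization p)) := by
    rw [reducedCoeff, sum_pow_char_pow, Finset.sum_mul, map_sum]
    refine Finset.sum_congr rfl fun j hj ↦ ?_
    rw [Finset.mem_filter, Finset.mem_Icc] at hj
    have hv : j.factorization p ≤ D :=
      (Nat.factorization_lt p (by omega : j ≠ 0)).le.trans hj.1.2
    set v := j.factorization p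
    have h1 : ∀ a : k, ((iterateFrobeniusEquiv k p v).symm a) ^ p ^ D = a ^ p ^ (D - v) := by
      intro a
      obtain ⟨a, rfl⟩ := (iterateFrobeniusEquiv k p v).surjective a
      rw [RingEquiv.symm_apply_apply, iterateFrobeniusEquiv_def, ← pow_mul, ← pow_add,
        Nat.add_sub_cancel' hv]
    have h2 : p ^ (D - v) ≤ p ^ D :=
      Nat.pow_le_pow_right (Fact.out : p.Prime).pos (Nat.sub_le _ _)
    rw [h1, mul_pow, inv_pow, map_mul, map_pow, map_pow, pow_sub₀ _ hc h2]
    ring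
  rw [← e, mul_comm]

section PolynomialDependence

variable {A : Type*} [CommRing A] [IsLocalRing A] {L : Type*} [Field L] [Algebra A L]
  {d r N D : ℕ} {X Y : A} {S : Set (Ideal A)} {lam : ResidueField A → A}

/-- The generic power series `∑ c_i t ^ (i - r)`, with indeterminate coefficients. -/
noncomputable def genericSeries (k : Type*) [Field k] (r N : ℕ) :
    Polynomial (MvPolynomial (Finset.Icc r N) k) :=
  ∑ i : Finset.Icc r N, Polynomial.C (MvPolynomial.X i) * Polynomial.X ^ ((i : ℕ) - r)

/-- Evaluation at the coefficient vector `c` and at the parameter `t`. -/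
noncomputable def evalSeries {k Q : Type*} [Field k] [CommRing Q] (ψ : k →+* Q) (t : Q)
    {r N : ℕ} (c : Finset.Icc r N → k) : Polynomial (MvPolynomial (Finset.Icc r N) k) →+* Q :=
  Polynomial.eval₂RingHom (ψ.comp (MvPolynomial.eval c)) t

theorem evalSeries_genericSeries {k Q : Type*} [Field k] [CommRing Q] (ψ : k →+* Q) (t : Q)
    {r N : ℕ} (c : Finset.Icc r N → k) :
    evalSeries ψ t c (genericSeries k r N) =
      ∑ j ∈ Finset.range (N + 1 - r), ψ (shiftCoeff c j) * t ^ j := by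
  have := sum_Icc_coeff c (fun a i ↦ ψ a * t ^ (i - r))
  simp only [Nat.add_sub_cancel_left] at this
  rw [← this, genericSeries, map_sum]
  simp [evalSeries]

theorem evalSeries_eq_sum {k Q : Type*} [Field k] [CommRing Q] (ψ : k →+* Q) {t : Q} {D : ℕ}
    (ht : t ^ D = 0) {r N : ℕ} (c : Finset.Icc r N → k)
    (f : Polynomial (MvPolynomial (Finset.Icc r N) k)) :
    evalSeries ψ t c f =
      ∑ j ∈ Finset.range D, ψ (MvPolynomial.eval c (f.coeff j)) * t ^ j := by
  rw [evalSeries, Polynomial.coe_eval₂RingHom, Polynomial.eval₂_eq_sum_range'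
    (n := max D (f.natDegree + 1)) _ (by omega),
    ← Finset.sum_subset (Finset.range_mono (le_max_left D (f.natDegree + 1)))]
  · rfl
  · intro j _ hj
    rw [Finset.mem_range, not_lt] at hj
    rw [← Nat.sub_add_cancel hj, pow_add, ht, mul_zero, mul_zero]

/-- Along the curves of a graph family, the monomial `Y ^ M` is `X ^ (r M)` times a unit whose
inverse is, up to a nonzero constant, polynomial in the coefficients of the curve: if
`Y = X ^ r τ` with `τ = c_r + ⋯`, then `τ ^ q` is congruent to the constant `c_r ^ q` for every
large power `q` of `p`. -/
theorem IsGraphFamily.exists_inverse_unit (h : IsGraphFamily L d r X Y S) (p : ℕ)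
    [Fact p.Prime] [CharP A p] [IsNoetherianRing A] (hlam : IsSection N lam)
    (hN : D + r ≤ N) {M : ℕ} (hM : r = 1 ∧ d = 1 → M = 0) :
    ∃ (Γ : MvPolynomial (Finset.Icc r N) (ResidueField A))
      (V : Polynomial (MvPolynomial (Finset.Icc r N) (ResidueField A))),
      ∀ 𝔭 ∈ S, ∀ c ∈ coeffSpace (ResidueField A) d r N,
      curveGerm r N X Y lam c ∈ 𝔭 ⊔ maximalIdeal A ^ (N + 1) →
      MvPolynomial.eval c Γ ≠ 0 ∧ ∃ u : A ⧸ 𝔭, IsUnit u ∧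
        Ideal.Quotient.mk 𝔭 Y ^ M = Ideal.Quotient.mk 𝔭 X ^ (r * M) * u ∧
        ∀ {Q : Type*} [CommRing Q] (π : A ⧸ 𝔭 →+* Q)
          (hπ : ∀ z ∈ maximalIdeal A ^ N, π.comp (Ideal.Quotient.mk 𝔭) z = 0),
          π (Ideal.Quotient.mk 𝔭 X) ^ D = 0 →
          π u * evalSeries (sectionHom hlam _ hπ) (π (Ideal.Quotient.mk 𝔭 X)) c V =
            sectionHom hlam _ hπ (MvPolynomial.eval c Γ) ∧
          π (Ideal.Quotient.mk 𝔭 Y) = evalSeries (sectionHom hlam _ hπ)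
            (π (Ideal.Quotient.mk 𝔭 X)) c (Polynomial.X ^ r * genericSeries _ r N) := by
  have hkp := charP_residueField (A := A) p
  have hrN : r ∈ Finset.Icc r N := Finset.mem_Icc.2 ⟨le_rfl, by omega⟩
  -- the curves in question, and the expansion of `Y` along them
  have hexp : ∀ 𝔭 ∈ S, ∀ c : Finset.Icc r N → ResidueField A,
      curveGerm r N X Y lam c ∈ 𝔭 ⊔ maximalIdeal A ^ (N + 1) → ∃ e : A ⧸ 𝔭,
      Ideal.Quotient.mk 𝔭 Y = Ideal.Quotient.mk 𝔭 X ^ r * (∑ j ∈ Finset.range (N + 1 - r),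
        Ideal.Quotient.mk 𝔭 (lam (shiftCoeff c j)) * Ideal.Quotient.mk 𝔭 X ^ j +
        Ideal.Quotient.mk 𝔭 X ^ (N + 1 - r) * e) := by
    intro 𝔭 h𝔭 c hc
    have hreg := h.mem_regularCurves h𝔭
    have : 𝔭.IsPrime := hreg.1.1
    have := isDiscreteValuationRing_of_mem_regularCurves hreg
    have hirr := irreducible_mk_of_notMem h.mem_maximalIdeal.1 ((h.mem_iff _ hreg).1 h𝔭).1
    rw [mem_sup_pow_iff_dvd hirr, mk_curveGerm] at hc
    obtain ⟨e, he⟩ := hc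
    refine ⟨-e, ?_⟩
    have hp : Ideal.Quotient.mk 𝔭 X ^ (N + 1) =
        Ideal.Quotient.mk 𝔭 X ^ r * Ideal.Quotient.mk 𝔭 X ^ (N + 1 - r) := by
      rw [← pow_add]; congr 1; omega
    rw [hp] at he
    linear_combination -he
  have hY : ∀ (𝔭 : Ideal A) (c : Finset.Icc r N → ResidueField A) (e : A ⧸ 𝔭),
      Ideal.Quotient.mk 𝔭 Y = Ideal.Quotient.mk 𝔭 X ^ r * (∑ j ∈ Finset.range (N + 1 - r),
        Ideal.Quotient.mk 𝔭 (lam (shiftCoeff c j)) * Ideal.Quotient.mk 𝔭 X ^ j +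
        Ideal.Quotient.mk 𝔭 X ^ (N + 1 - r) * e) →
      ∀ {Q : Type _} [CommRing Q] (π : A ⧸ 𝔭 →+* Q)
        (hπ : ∀ z ∈ maximalIdeal A ^ N, π.comp (Ideal.Quotient.mk 𝔭) z = 0),
        π (Ideal.Quotient.mk 𝔭 X) ^ D = 0 →
        π (∑ j ∈ Finset.range (N + 1 - r),
          Ideal.Quotient.mk 𝔭 (lam (shiftCoeff c j)) * Ideal.Quotient.mk 𝔭 X ^ j +
          Ideal.Quotient.mk 𝔭 X ^ (N + 1 - r) * e) = evalSeries (sectionHom hlam _ hπ)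
          (π (Ideal.Quotient.mk 𝔭 X)) c (genericSeries _ r N) ∧
        π (Ideal.Quotient.mk 𝔭 Y) = evalSeries (sectionHom hlam _ hπ)
          (π (Ideal.Quotient.mk 𝔭 X)) c (Polynomial.X ^ r * genericSeries _ r N) := by
    intro 𝔭 c e hYe Q _ π hπ hD
    have h1 : π (∑ j ∈ Finset.range (N + 1 - r),
          Ideal.Quotient.mk 𝔭 (lam (shiftCoeff c j)) * Ideal.Quotient.mk 𝔭 X ^ j +
          Ideal.Quotient.mk 𝔭 X ^ (N + 1 - r) * e) = evalSeries (sectionHom hlam _ hπ)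
          (π (Ideal.Quotient.mk 𝔭 X)) c (genericSeries _ r N) := by
      rw [evalSeries_genericSeries, map_add, map_mul, map_pow,
        show N + 1 - r = D + (N + 1 - r - D) by omega, pow_add _ D, hD, zero_mul, zero_mul,
        add_zero, map_sum]
      simp [sectionHom_apply]
    refine ⟨h1, ?_⟩
    rw [hYe, map_mul, h1, map_mul, map_pow, map_pow]
    simp [evalSeries]
  by_cases hrd : r = 1 ∧ d = 1
  · obtain rfl := hM hrd
    refine ⟨1, 1, fun 𝔭 h𝔭 c _ hc ↦ ⟨by simp, 1, isUnit_one, by simp, fun π hπ hD ↦ ?_⟩⟩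
    obtain ⟨e, he⟩ := hexp 𝔭 h𝔭 c hc
    exact ⟨by simp, (hY 𝔭 c e he π hπ hD).2⟩
  · set q := p ^ max M D with hq
    have hMq : max M D ≤ q := (Nat.lt_pow_self (Fact.out : p.Prime).one_lt).le
    refine ⟨MvPolynomial.X ⟨r, hrN⟩ ^ q, genericSeries _ r N ^ (q - M), fun 𝔭 h𝔭 c hc hc' ↦ ?_⟩
    have hc0 : c ⟨r, hrN⟩ ≠ 0 := hc.resolve_left hrd _ rfl
    obtain ⟨e, he⟩ := hexp 𝔭 h𝔭 c hc'
    have hreg := h.mem_regularCurves h𝔭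
    have : 𝔭.IsPrime := hreg.1.1
    have := isDiscreteValuationRing_of_mem_regularCurves hreg
    have hirr := irreducible_mk_of_notMem h.mem_maximalIdeal.1 ((h.mem_iff _ hreg).1 h𝔭).1
    have hs0 : shiftCoeff c 0 = c ⟨r, hrN⟩ := by
      have := shiftCoeff_apply c ⟨r, hrN⟩
      simpa using this
    refine ⟨by simpa using pow_ne_zero q hc0, (∑ j ∈ Finset.range (N + 1 - r),
        Ideal.Quotient.mk 𝔭 (lam (shiftCoeff c j)) * Ideal.Quotient.mk 𝔭 X ^ j +
        Ideal.Quotient.mk 𝔭 X ^ (N + 1 - r) * e) ^ M, IsUnit.pow _ ?_, ?_, fun {Q} _ π hπ hD ↦ ?_⟩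
    · have hlamu : IsUnit (Ideal.Quotient.mk 𝔭 (lam (c ⟨r, hrN⟩))) := by
        refine IsUnit.map _ ?_
        rw [← residue_ne_zero_iff_isUnit, hlam.residue_eq]
        exact hc0
      rw [show N + 1 - r = (N - r) + 1 by omega, Finset.sum_range_succ', hs0, pow_zero, mul_one]
      have hx : ¬ IsUnit (Ideal.Quotient.mk 𝔭 X) := hirr.not_isUnit
      rw [← mem_nonunits_iff, ← IsLocalRing.mem_maximalIdeal] at hx
      by_contra hnu
      rw [← mem_nonunits_iff, ← IsLocalRing.mem_maximalIdeal] at hnu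
      have h1 : ∑ j ∈ Finset.range (N - r), Ideal.Quotient.mk 𝔭 (lam (shiftCoeff c (j + 1))) *
          Ideal.Quotient.mk 𝔭 X ^ (j + 1) ∈ maximalIdeal (A ⧸ 𝔭) :=
        Ideal.sum_mem _ fun j _ ↦ Ideal.mul_mem_left _ _ (Ideal.pow_mem_of_mem _ hx _ (by omega))
      have h2 : Ideal.Quotient.mk 𝔭 X ^ (N - r + 1) * e ∈ maximalIdeal (A ⧸ 𝔭) :=
        Ideal.mul_mem_right _ _ (Ideal.pow_mem_of_mem _ hx _ (by omega))
      have h3 : Ideal.Quotient.mk 𝔭 (lam (c ⟨r, hrN⟩)) ∈ maximalIdeal (A ⧸ 𝔭) := by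
        convert sub_mem (sub_mem hnu h2) h1 using 1
        ring
      exact (IsLocalRing.mem_maximalIdeal _).1 h3 hlamu
    · rw [he, mul_pow, ← pow_mul]
    · obtain ⟨h1, h2⟩ := hY 𝔭 c e he π hπ hD
      refine ⟨?_, h2⟩
      have hA : CharP Q p ∨ Subsingleton Q := by
        rcases subsingleton_or_nontrivial Q with hQ | hQ
        · exact Or.inr hQ
        · refine Or.inl ((CharP.charP_iff_prime_eq_zero Fact.out).2 ?_)
          rw [← map_natCast (π.comp (Ideal.Quotient.mk 𝔭)), CharP.cast_eq_zero, map_zero]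
      rcases hA with hQ | hQ
      · rw [map_pow, h1, map_pow, ← pow_add, Nat.add_sub_cancel' (by omega),
          evalSeries_genericSeries, hq, sum_pow_char_pow,
          show N + 1 - r = (N - r) + 1 by omega, Finset.sum_range_succ', hs0, ← hq]
        rw [Finset.sum_eq_zero, zero_add, pow_zero, mul_one, map_pow, MvPolynomial.eval_X, map_pow]
        intro j _
        rw [mul_pow, ← pow_mul, show (j + 1) * q = D + ((j + 1) * q - D) by
          rw [Nat.add_sub_cancel']; nlinarith [le_max_right M D], pow_add, hD, zero_mul, mul_zero]
      · exact Subsingleton.elim _ _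

/-- The condition that the ramification jump of the Artin-Schreier extension
`θ ^ p - θ = g / (X ^ M' Y ^ M)` along a curve of a graph family is at most `s` is polynomial in the
coefficients of the curve. -/
theorem IsGraphFamily.exists_polynomials (h : IsGraphFamily L d r X Y S) (p : ℕ)
    [Fact p.Prime] [CharP A p] [IsNoetherianRing A] [IsAlgClosed (ResidueField A)]
    (hlam : IsSection N lam) (g : A) {M M' : ℕ}
    (hN : r * M + M' + r ≤ N) (hM : r = 1 ∧ d = 1 → M = 0) :
    ∃ q : ℕ → MvPolynomial (Finset.Icc r N) (ResidueField A),
      ∀ 𝔭 ∈ S, ∀ c ∈ coeffSpace (ResidueField A) d r N,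
      curveGerm r N X Y lam c ∈ 𝔭 ⊔ maximalIdeal A ^ (N + 1) →
      ∀ {F E : Type*} [Field F] [Algebra (A ⧸ 𝔭) F] [IsFractionRing (A ⧸ 𝔭) F] [Field E]
        [Algebra (A ⧸ 𝔭) E] [Algebra F E] [IsScalarTower (A ⧸ 𝔭) F E] {θ : E} {b : F},
        θ ^ p - θ = algebraMap F E b → IntermediateField.adjoin F {θ} = ⊤ →
        b * algebraMap (A ⧸ 𝔭) F (Ideal.Quotient.mk 𝔭 X ^ M' * Ideal.Quotient.mk 𝔭 Y ^ M) =
          algebraMap (A ⧸ 𝔭) F (Ideal.Quotient.mk 𝔭 g) →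
        ∀ s, ramificationJump (A ⧸ 𝔭) E p ≤ s ↔ ∀ i ∈ Finset.Icc 1 (r * M + M'), s < i →
          MvPolynomial.eval c (q i) = 0 := by
  have hkp := charP_residueField (A := A) p
  set D := r * M + M' with hD
  obtain ⟨Γ, V, hV⟩ := h.exists_inverse_unit p hlam hN hM
  obtain ⟨G, hG⟩ := exists_polynomial_eq h.span_eq hlam g
  set W : Polynomial (MvPolynomial (Finset.Icc r N) (ResidueField A)) := V *
    G.eval₂ (Polynomial.mapRingHom MvPolynomial.C) (Polynomial.X ^ r * genericSeries _ r N) with hW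
  choose q hq using fun i ↦ exists_reducedCoeff_polynomial p D i Γ (fun j ↦ W.coeff j)
  refine ⟨q, fun 𝔭 h𝔭 c hc hc' F E _ _ _ _ _ _ _ θ b hθ hgen hb s ↦ ?_⟩
  have hreg := h.mem_regularCurves h𝔭
  have : 𝔭.IsPrime := hreg.1.1
  have := isDiscreteValuationRing_of_mem_regularCurves hreg
  have hirr := irreducible_mk_of_notMem h.mem_maximalIdeal.1 ((h.mem_iff _ hreg).1 h𝔭).1
  obtain ⟨hΓ, u, hu, hYu, hQ⟩ := hV 𝔭 h𝔭 c hc hc'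
  have hdvd : ∀ z ∈ maximalIdeal A ^ N,
      Ideal.Quotient.mk 𝔭 X ^ D ∣ Ideal.Quotient.mk 𝔭 z := fun z hz ↦
    (mem_sup_pow_iff_dvd hirr z D).1
      (Ideal.mem_sup_right (Ideal.pow_le_pow_right (by omega) hz))
  let π := Ideal.Quotient.mk (Ideal.span {Ideal.Quotient.mk 𝔭 X ^ D})
  have hπ0 : ∀ z, π z = 0 ↔ Ideal.Quotient.mk 𝔭 X ^ D ∣ z := fun z ↦
    Ideal.Quotient.eq_zero_iff_mem.trans Ideal.mem_span_singleton
  have hπ : ∀ z ∈ maximalIdeal A ^ N, π.comp (Ideal.Quotient.mk 𝔭) z = 0 := fun z hz ↦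
    (hπ0 _).2 (hdvd z hz)
  have hxD : π (Ideal.Quotient.mk 𝔭 X) ^ D = 0 := by
    exact (map_pow π _ D).symm.trans ((hπ0 _).2 dvd_rfl)
  obtain ⟨hQ1, hQ2⟩ := hQ π hπ hxD
  have hGW : π (Ideal.Quotient.mk 𝔭 g) = evalSeries (sectionHom hlam _ hπ)
      (π (Ideal.Quotient.mk 𝔭 X)) c (G.eval₂ (Polynomial.mapRingHom MvPolynomial.C)
        (Polynomial.X ^ r * genericSeries _ r N)) := by
    have h1 := hG (π.comp (Ideal.Quotient.mk 𝔭)) hπ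
    rw [RingHom.comp_apply, RingHom.comp_apply, RingHom.comp_apply, hQ2] at h1
    rw [h1, Polynomial.hom_eval₂]
    congr 1
    apply Polynomial.ringHom_ext
    · intro a; simp [evalSeries]
    · simp [evalSeries]
  set γ := MvPolynomial.eval c Γ with hγ
  obtain ⟨v, hv⟩ := hu.exists_left_inv
  have hb' : b * algebraMap (A ⧸ 𝔭) F (Ideal.Quotient.mk 𝔭 X) ^ D =
      algebraMap (A ⧸ 𝔭) F (v * Ideal.Quotient.mk 𝔭 g) := by
    rw [map_mul, ← hb, hYu, hD, ← map_pow, pow_add]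
    have hv' : algebraMap (A ⧸ 𝔭) F v * algebraMap (A ⧸ 𝔭) F u = 1 := by
      rw [← map_mul, hv, map_one]
    simp only [map_mul]
    linear_combination (-b * algebraMap (A ⧸ 𝔭) F (Ideal.Quotient.mk 𝔭 X ^ (r * M)) *
      algebraMap (A ⧸ 𝔭) F (Ideal.Quotient.mk 𝔭 X ^ M')) * hv'
  have hβ : Ideal.Quotient.mk 𝔭 X ^ D ∣ v * Ideal.Quotient.mk 𝔭 g - ∑ j ∈ Finset.range D,
      Ideal.Quotient.mk 𝔭 (lam (γ⁻¹ * MvPolynomial.eval c (W.coeff j))) *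
        Ideal.Quotient.mk 𝔭 X ^ j := by
    rw [← hπ0, map_sub, sub_eq_zero, map_sum]
    have h1 : ∑ j ∈ Finset.range D, π (Ideal.Quotient.mk 𝔭
        (lam (γ⁻¹ * MvPolynomial.eval c (W.coeff j))) * Ideal.Quotient.mk 𝔭 X ^ j) =
        sectionHom hlam _ hπ γ⁻¹ * evalSeries (sectionHom hlam _ hπ)
          (π (Ideal.Quotient.mk 𝔭 X)) c W := by
      rw [evalSeries_eq_sum _ hxD, Finset.mul_sum]
      refine Finset.sum_congr rfl fun j _ ↦ ?_
      rw [← mul_assoc, ← map_mul, sectionHom_apply, map_mul, map_pow]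
      rfl
    have hvu : π v * π u = 1 := by rw [← map_mul, hv, map_one]
    have hγ1 : sectionHom hlam _ hπ γ⁻¹ * sectionHom hlam _ hπ γ = 1 := by
      rw [← map_mul, inv_mul_cancel₀ hΓ, map_one]
    rw [h1, hW, map_mul (evalSeries _ _ _), ← hGW, map_mul]
    linear_combination (-π v * π (Ideal.Quotient.mk 𝔭 g)) * hγ1 -
      π v * π (Ideal.Quotient.mk 𝔭 g) * sectionHom hlam _ hπ γ⁻¹ * hQ1 +
      π (Ideal.Quotient.mk 𝔭 g) * sectionHom hlam _ hπ γ⁻¹ * evalSeries (sectionHom hlam _ hπ)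
          (π (Ideal.Quotient.mk 𝔭 X)) c V * hvu
  have hcl : IsAlgClosed (ResidueField (A ⧸ 𝔭)) := by
    have := IsLocalHom.of_surjective (Ideal.Quotient.mk 𝔭) Ideal.Quotient.mk_surjective
    refine IsAlgClosed.of_ringEquiv (ResidueField A) _
      (RingEquiv.ofBijective (ResidueField.map (Ideal.Quotient.mk 𝔭))
        ⟨RingHom.injective _, fun a ↦ ?_⟩)
    obtain ⟨a, rfl⟩ := residue_surjective a
    obtain ⟨a, rfl⟩ := Ideal.Quotient.mk_surjective a
    exact ⟨residue A a, ResidueField.map_residue _ _⟩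
  have hFp : CharP F p := by
    refine (CharP.charP_iff_prime_eq_zero Fact.out).2 ?_
    rw [← map_natCast ((algebraMap (A ⧸ 𝔭) F).comp (Ideal.Quotient.mk 𝔭)), CharP.cast_eq_zero,
      map_zero]
  rw [ramificationJump_le_iff (p := p) hθ hgen hirr (μ := fun a ↦ Ideal.Quotient.mk 𝔭 (lam a))
    ?_ ?_ ?_ hb' hβ]
  · exact forall₃_congr fun i _ _ ↦ hq i c hΓ
  · intro a ha
    refine IsUnit.map _ ?_
    rw [← residue_ne_zero_iff_isUnit, hlam.residue_eq]
    exact ha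
  · intro a b
    rw [← map_add, ← map_sub]
    exact hdvd _ (hlam.map_add a b)
  · intro a
    rw [← map_pow (Ideal.Quotient.mk 𝔭) (lam a), ← map_sub]
    exact hdvd _ (hlam.pow_sub_mem a p)

end PolynomialDependence

/-! ### Traces and unramified primes -/

section UnramifiedTrace

variable {A B : Type*} [CommRing A] [CommRing B] [Algebra A B]

/-- The inertia group at an unramified prime of a Noetherian domain is trivial: an automorphism that
is trivial modulo `𝔮` lifts the same map to `B / 𝔮` as the identity, so that it is trivial
modulo every power of `𝔮`. -/
theorem AlgEquiv.eq_one_of_sub_mem [IsDomain B] [IsNoetherianRing B] (ρ : B ≃ₐ[A] B)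
    (𝔮 : Ideal B) [𝔮.IsPrime]
    [Algebra.IsUnramifiedAt A 𝔮] (h : ∀ b, ρ b - b ∈ 𝔮) : ρ = 1 := by
  have hcomap : 𝔮 = 𝔮.comap (ρ : B →ₐ[A] B) := by
    ext b
    have : ρ b = b + (ρ b - b) := by ring
    rw [Ideal.mem_comap]
    change b ∈ 𝔮 ↔ ρ b ∈ 𝔮
    rw [this]
    exact (Ideal.add_mem_iff_left _ (h b)).symm
  have key : Localization.localAlgHom 𝔮 𝔮 (ρ : B →ₐ[A] B) hcomap = AlgHom.id A _ := by
    apply Algebra.FormallyUnramified.ext_of_iInf _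
      (Ideal.iInf_pow_eq_bot_of_isLocalRing (maximalIdeal _) Ideal.IsPrime.ne_top')
    intro x
    obtain ⟨b, s, rfl⟩ := IsLocalization.exists_mk'_eq 𝔮.primeCompl x
    have e : Localization.localAlgHom 𝔮 𝔮 (ρ : B →ₐ[A] B) hcomap
        (IsLocalization.mk' (Localization.AtPrime 𝔮) b s) =
        IsLocalization.mk' (Localization.AtPrime 𝔮) (ρ b)
          (⟨ρ s, fun hs ↦ s.2 (hcomap.ge hs)⟩ : 𝔮.primeCompl) :=
      Localization.localRingHom_mk' 𝔮 𝔮 (ρ : B →ₐ[A] B).toRingHom hcomap b s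
    rw [e, AlgHom.id_apply, Ideal.Quotient.eq, ← IsLocalization.mk'_sub,
      IsLocalization.AtPrime.mk'_mem_maximal_iff (Localization.AtPrime 𝔮) 𝔮]
    have : ρ b * s - b * ρ s = (ρ b - b) * s - b * (ρ s - s) := by ring
    rw [this]
    exact sub_mem (Ideal.mul_mem_right _ _ (h b)) (Ideal.mul_mem_left _ _ (h s))
  ext b
  apply IsLocalization.injective (Localization.AtPrime 𝔮) 𝔮.primeCompl_le_nonZeroDivisors
  have h1 := congrArg (fun f : _ →ₐ[A] _ ↦ f (algebraMap B _ b)) key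
  exact (Localization.localRingHom_to_map 𝔮 𝔮 (ρ : B →ₐ[A] B).toRingHom hcomap b).symm.trans h1

/-- Dedekind's independence of characters modulo a prime at which inertia is trivial: the trace
does not vanish there. -/
theorem exists_sum_pow_notMem {n : ℕ} {σ : B ≃ₐ[A] B} (hn : 0 < n) (hσ : orderOf σ = n)
    (𝔮 : Ideal B) [𝔮.IsPrime] (h : ∀ ρ : B ≃ₐ[A] B, ρ ≠ 1 → ∃ b, ρ b - b ∉ 𝔮) :
    ∃ b, ∑ i ∈ Finset.range n, (σ ^ i) b ∉ 𝔮 := by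
  by_contra! hcon
  let f : Fin n → (B →* B ⧸ 𝔮) := fun i ↦
    ((Ideal.Quotient.mk 𝔮).comp ((σ ^ (i : ℕ) : B ≃ₐ[A] B) : B →+* B)).toMonoidHom
  have hf : Function.Injective f := by
    intro i j hij
    by_contra hne
    have h1 : σ ^ (i : ℕ) * (σ ^ (j : ℕ))⁻¹ ≠ 1 := by
      rw [Ne, mul_inv_eq_one]
      intro h2
      exact hne (Fin.ext (pow_injOn_Iio_orderOf (by simp [hσ]) (by simp [hσ]) h2))
    obtain ⟨b, hb⟩ := h _ h1
    apply hb
    have h2 := congrArg (fun g : B →* B ⧸ 𝔮 ↦ g ((σ ^ (j : ℕ))⁻¹ b)) hij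
    have h3 : (σ ^ (j : ℕ)) ((σ ^ (j : ℕ))⁻¹ b) = b := (σ ^ (j : ℕ)).apply_symm_apply b
    have h4 : Ideal.Quotient.mk 𝔮 ((σ ^ (i : ℕ)) ((σ ^ (j : ℕ))⁻¹ b)) =
      Ideal.Quotient.mk 𝔮 ((σ ^ (j : ℕ)) ((σ ^ (j : ℕ))⁻¹ b)) := h2
    rw [h3] at h4
    exact Ideal.Quotient.eq.1 h4
  have hlin := (linearIndependent_monoidHom B (B ⧸ 𝔮)).comp f hf
  rw [Fintype.linearIndependent_iff] at hlin
  refine one_ne_zero (hlin (fun _ ↦ 1) ?_ ⟨0, hn⟩)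
  ext b
  have h1 := Ideal.Quotient.eq_zero_iff_mem.2 (hcon b)
  rw [map_sum, Finset.sum_range] at h1
  simpa [f] using h1

variable [IsDomain B] [IsNoetherianRing B] [Algebra.IsIntegral A B] [FaithfulSMul A B]
  {p : ℕ} {σ : B ≃ₐ[A] B}

/-- If `B` is unramified over the complement of `δ = 0`, then some power of `δ` is a trace. -/
theorem exists_pow_eq_sum_pow (hp : 0 < p) (hσ : orderOf σ = p)
    (hinv : ∀ b : B, σ b = b → ∃ a, algebraMap A B a = b) {δ : A}
    (hδ : ∀ 𝔮 : Ideal B, ∀ [𝔮.IsPrime], 𝔮.under A ≠ ⊥ → δ ∉ 𝔮.under A →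
      Algebra.IsUnramifiedAt A 𝔮) :
    ∃ (j : ℕ) (β : B), ∑ i ∈ Finset.range p, (σ ^ i) β = algebraMap A B (δ ^ j) := by
  let tr : B →ₗ[A] B := ∑ i ∈ Finset.range p, (σ ^ i : B ≃ₐ[A] B).toLinearMap
  have htr : ∀ b, tr b = ∑ i ∈ Finset.range p, (σ ^ i) b := fun b ↦ by simp [tr]
  have htrσ : ∀ b, ∃ a, algebraMap A B a = tr b := fun b ↦ by
    apply hinv
    rw [htr, map_sum]
    have h1 := Finset.sum_range_succ (fun i ↦ (σ ^ i) b) p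
    rw [Finset.sum_range_succ', ← hσ, pow_orderOf_eq_one, pow_zero, hσ, add_left_inj] at h1
    rw [← h1]
    simp [pow_succ', AlgEquiv.mul_apply]
  let I : Ideal A := Submodule.comap (Algebra.linearMap A B) (LinearMap.range tr)
  suffices hI : δ ∈ I.radical by
    obtain ⟨j, hj⟩ := Ideal.mem_radical_iff.1 hI
    obtain ⟨β, hβ⟩ := hj
    exact ⟨j, β, (htr β).symm.trans hβ⟩
  rw [Ideal.radical_eq_sInf, Submodule.mem_sInf]
  rintro 𝔭 ⟨hI𝔭, h𝔭⟩
  by_contra hδ𝔭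
  obtain ⟨𝔮, -, h𝔮, h𝔮𝔭⟩ := Ideal.exists_ideal_over_prime_of_isIntegral_of_isPrime 𝔭 (⊥ : Ideal B)
    (by
      rw [← RingHom.ker_eq_comap_bot, (RingHom.injective_iff_ker_eq_bot _).1
        (FaithfulSMul.algebraMap_injective A B)]
      exact bot_le)
  have hnotMem : ∃ 𝔮 : Ideal B, 𝔮.IsPrime ∧ 𝔮.under A = 𝔭 ∧
      ∀ ρ : B ≃ₐ[A] B, ρ ≠ 1 → ∃ b, ρ b - b ∉ 𝔮 := by
    by_cases h0 : 𝔭 = ⊥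
    · refine ⟨⊥, Ideal.isPrime_bot, ?_, fun ρ hρ ↦ ?_⟩
      · rw [h0, Ideal.under, ← RingHom.ker_eq_comap_bot, (RingHom.injective_iff_ker_eq_bot _).1
          (FaithfulSMul.algebraMap_injective A B)]
      · by_contra! h
        exact hρ (AlgEquiv.ext fun b ↦ sub_eq_zero.1 (Ideal.mem_bot.1 (h b)))
    · have : 𝔮.under A = 𝔭 := h𝔮𝔭
      refine ⟨𝔮, h𝔮, this, fun ρ hρ ↦ ?_⟩
      have hunr := hδ 𝔮 (this ▸ h0) (this ▸ hδ𝔭)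
      by_contra! h
      exact hρ (ρ.eq_one_of_sub_mem 𝔮 h)
  obtain ⟨𝔮, h𝔮, rfl, hin⟩ := hnotMem
  obtain ⟨b, hb⟩ := exists_sum_pow_notMem hp hσ 𝔮 hin
  obtain ⟨a, ha⟩ := htrσ b
  rw [← htr, ← ha] at hb
  exact hb (hI𝔭 (show algebraMap A B a ∈ LinearMap.range tr from ha ▸ LinearMap.mem_range_self tr b))

/-- Additive Hilbert 90 with denominators: a cyclic extension of degree `p` in characteristic `p`
that is unramified over the complement of `δ = 0` has an Artin-Schreier equation whose denominator
is a power of `δ`. -/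
theorem exists_artinSchreier_equation [Fact p.Prime] [CharP B p] (hσ : orderOf σ = p)
    (hinv : ∀ b : B, σ b = b → ∃ a, algebraMap A B a = b) {δ : A}
    (hδ : ∀ 𝔮 : Ideal B, ∀ [𝔮.IsPrime], 𝔮.under A ≠ ⊥ → δ ∉ 𝔮.under A →
      Algebra.IsUnramifiedAt A 𝔮) :
    ∃ (j : ℕ) (α : A) (z : B), σ z = z - algebraMap A B (δ ^ j) ∧
      z ^ p - algebraMap A B (δ ^ j) ^ (p - 1) * z = algebraMap A B α := by
  have hp := (Fact.out : p.Prime).pos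
  obtain ⟨j, β, hβ⟩ := exists_pow_eq_sum_pow hp hσ hinv hδ
  set ε := algebraMap A B (δ ^ j) with hε
  have hσε : σ ε = ε := σ.commutes _
  set z := ∑ i ∈ Finset.range p, (i : B) * (σ ^ i) β with hz
  have hσz : σ z = z - ε := by
    have h1 := Finset.sum_range_succ (fun i ↦ (i : B) * (σ ^ i) β) p
    rw [CharP.cast_eq_zero, zero_mul, add_zero, Finset.sum_range_succ', Nat.cast_zero, zero_mul,
      add_zero, ← hz] at h1
    have h2 : σ z = ∑ i ∈ Finset.range p, (i : B) * (σ ^ (i + 1)) β := by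
      rw [hz, map_sum]
      simp [pow_succ', AlgEquiv.mul_apply]
    have h3 : ∑ i ∈ Finset.range p, (σ ^ (i + 1)) β = ε := by
      rw [← hσε, ← hβ, map_sum]
      simp [pow_succ', AlgEquiv.mul_apply]
    rw [h2, ← h3, ← h1, ← Finset.sum_sub_distrib]
    refine Finset.sum_congr rfl fun i _ ↦ ?_
    push_cast
    ring
  obtain ⟨α, hα⟩ := hinv (z ^ p - ε ^ (p - 1) * z) (by
    rw [map_sub, map_mul, map_pow, map_pow, hσz, hσε, sub_pow_char]
    have : ε ^ p = ε ^ (p - 1) * ε := by rw [← pow_succ, Nat.sub_add_cancel hp]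
    rw [this]; ring)
  exact ⟨j, α, z, hσz, hα.symm⟩

end UnramifiedTrace

/-! ### Denominators of Artin-Schreier equations -/

section Denominators

open Polynomial in
/-- The discriminant of `z ^ p - ε ^ (p - 1) z - α` is, up to sign, a power of `ε`, so that `A[z]`
agrees with the integral closure of `A` up to powers of `ε`. -/
theorem exists_pow_mul_mem_adjoin {A K L : Type*} [CommRing A] [IsDomain A] [IsIntegrallyClosed A]
    [Field K] [Algebra A K] [IsFractionRing A K] [Field L] [Algebra K L] [Algebra A L]
    [IsScalarTower A K L] [Algebra.IsSeparable K L] {p : ℕ} [Fact p.Prime] [CharP A p]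
    (hdeg : Module.finrank K L = p) {ε α : A} {z : L}
    (hz : z ^ p - algebraMap A L ε ^ (p - 1) * z = algebraMap A L α)
    (hgen : IntermediateField.adjoin K {z} = ⊤) :
    ∃ m : ℕ, ∀ b : L, IsIntegral A b → algebraMap A L ε ^ m * b ∈ Algebra.adjoin A {z} := by
  have hp := (Fact.out : p.Prime)
  have : FiniteDimensional K L := Module.finite_of_finrank_pos (hdeg ▸ hp.pos)
  have : CharP K p := charP_of_injective_algebraMap (IsFractionRing.injective A K) p
  -- the minimal polynomial of `z`, over `A`
  set f : A[X] := X ^ p - (C (ε ^ (p - 1)) * X + C α) with hf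
  have hdeg' : (C (ε ^ (p - 1)) * X + C α).natDegree < p :=
    natDegree_linear_le.trans_lt hp.one_lt
  have hfm : f.Monic := by
    exact monic_X_pow_sub (degree_le_natDegree.trans_lt (by exact_mod_cast hdeg'))
  have hfd : f.natDegree = p := by
    rw [hf, natDegree_sub_eq_left_of_natDegree_lt] <;> rw [natDegree_X_pow]
    exact hdeg'
  have hfz : aeval z f = 0 := by
    simp only [hf, map_sub, map_add, map_mul, map_pow, aeval_X, aeval_C]
    linear_combination hz
  have hint : IsIntegral A z := ⟨f, hfm, hfz⟩
  have hadj : Algebra.adjoin K {z} = ⊤ := by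
    rw [← IntermediateField.adjoin_simple_toSubalgebra_of_isAlgebraic
      (IsAlgebraic.of_finite K z), hgen]
    rfl
  set pb := PowerBasis.ofAdjoinEqTop (IsIntegral.of_finite K z) hadj with hpb
  have hpbg : pb.gen = z := PowerBasis.ofAdjoinEqTop_gen _ _
  have hmin : minpoly K z = f.map (algebraMap A K) := by
    refine (Polynomial.eq_of_monic_of_dvd_of_natDegree_le (minpoly.monic (IsIntegral.of_finite K z))
      (hfm.map _) (minpoly.dvd _ _ ?_) ?_).symm
    · rw [aeval_map_algebraMap, hfz]
    · rw [hfm.natDegree_map, hfd, ← hpbg, pb.natDegree_minpoly, ← pb.finrank, hdeg]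
  have hdisc : ∃ e : ℤˣ, Algebra.discr K pb.basis =
      ((e : ℤ) : K) * algebraMap A K ε ^ ((p - 1) * p) := by
    have h1 : aeval z (derivative (minpoly K z)) = algebraMap K L (-algebraMap A K ε ^ (p - 1)) := by
      have hf' : derivative f = -C (ε ^ (p - 1)) := by
        rw [hf, derivative_sub, derivative_X_pow, CharP.cast_eq_zero, C_0, zero_mul, zero_sub,
          derivative_add, derivative_C_mul, derivative_X, derivative_C, mul_one, add_zero]
      rw [hmin, derivative_map, aeval_map_algebraMap, hf', map_neg, aeval_C, map_neg, map_pow,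
        map_pow, ← IsScalarTower.algebraMap_apply]
    rw [Algebra.discr_powerBasis_eq_norm, hpbg, h1, Algebra.norm_algebraMap, hdeg]
    refine ⟨(-1) ^ (p * (p - 1) / 2) * (-1) ^ p, ?_⟩
    rw [neg_pow (algebraMap A K ε ^ (p - 1)), ← pow_mul]
    push_cast
    ring
  obtain ⟨e, he⟩ := hdisc
  refine ⟨(p - 1) * p, fun b hb ↦ ?_⟩
  have h1 := Algebra.discr_mul_isIntegral_mem_adjoin (R := A) K (B := pb) (hpbg.symm ▸ hint) hb
  rw [hpbg, he] at h1
  have h2 := Subalgebra.zsmul_mem _ h1 (e : ℤ)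
  convert h2 using 1
  have h3 : ((e : ℤ) : L) * ((e : ℤ) : L) = 1 := by
    rw [← Int.cast_mul, ← Units.val_mul, Int.units_mul_self, Units.val_one, Int.cast_one]
  rw [zsmul_eq_mul, Algebra.smul_def, map_mul, map_intCast, map_pow,
    ← IsScalarTower.algebraMap_apply]
  linear_combination (-algebraMap A L ε ^ ((p - 1) * p) * b) * h3

/-- Reduction of an Artin-Schreier equation modulo a prime not containing its denominator `ε`. -/
theorem artinSchreier_quotient {A B : Type*} [CommRing A] [CommRing B] [Algebra A B] (𝔮 : Ideal B)
    [𝔮.IsPrime] {p : ℕ} [Fact p.Prime] {ε α : A} {z : B} {m : ℕ}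
    (hz : z ^ p - algebraMap A B ε ^ (p - 1) * z = algebraMap A B α)
    (hadj : ∀ b : B, algebraMap A B ε ^ m * b ∈ Algebra.adjoin A {z}) (hε : ε ∉ 𝔮.under A)
    {F E : Type*} [Field F] [Field E] [Algebra (A ⧸ 𝔮.under A) F] [Algebra (B ⧸ 𝔮) E]
    [IsFractionRing (B ⧸ 𝔮) E] [Algebra F E] [Algebra (A ⧸ 𝔮.under A) E]
    [IsScalarTower (A ⧸ 𝔮.under A) F E] [IsScalarTower (A ⧸ 𝔮.under A) (B ⧸ 𝔮) E] :
    ∃ (θ : E) (b : F), θ ^ p - θ = algebraMap F E b ∧ IntermediateField.adjoin F {θ} = ⊤ ∧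
      b * algebraMap (A ⧸ 𝔮.under A) F (Ideal.Quotient.mk _ ε) ^ p =
        algebraMap (A ⧸ 𝔮.under A) F (Ideal.Quotient.mk _ α) := by
  have hp := (Fact.out : p.Prime).pos
  set i : A →+* F := (algebraMap (A ⧸ 𝔮.under A) F).comp (Ideal.Quotient.mk _) with hi
  set g : B →+* E := (algebraMap (B ⧸ 𝔮) E).comp (Ideal.Quotient.mk _) with hg
  have hcomm : ∀ a : A, g (algebraMap A B a) = algebraMap F E (i a) := by
    intro a
    rw [hi, hg, RingHom.comp_apply, RingHom.comp_apply, ← IsScalarTower.algebraMap_apply,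
      IsScalarTower.algebraMap_apply (A ⧸ 𝔮.under A) (B ⧸ 𝔮) E]
    rfl
  have hε0 : algebraMap F E (i ε) ≠ 0 := by
    rw [← hcomm, hg, RingHom.comp_apply, Ne, IsFractionRing.to_map_eq_zero_iff,
      Ideal.Quotient.eq_zero_iff_mem]
    exact hε
  have hε0' : i ε ≠ 0 := fun h ↦ hε0 (by rw [h, map_zero])
  refine ⟨g z / algebraMap F E (i ε), i α / i ε ^ p, ?_, ?_, ?_⟩
  · have h1 := congrArg g hz
    rw [map_sub, map_mul, map_pow, map_pow, hcomm, hcomm] at h1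
    rw [map_div₀, ← h1, map_pow, div_pow]
    have h2 : algebraMap F E (i ε) ^ p = algebraMap F E (i ε) ^ (p - 1) * algebraMap F E (i ε) := by
      rw [← pow_succ, Nat.sub_add_cancel hp]
    rw [h2]
    field_simp
  · rw [eq_top_iff]
    set M := IntermediateField.adjoin F {g z / algebraMap F E (i ε)} with hM
    have hθ : g z / algebraMap F E (i ε) ∈ M := IntermediateField.mem_adjoin_simple_self _ _
    have hzM : g z ∈ M := by
      have := mul_mem hθ (M.algebraMap_mem (i ε))
      rwa [div_mul_cancel₀ _ hε0] at this
    have hadjM : ∀ b ∈ Algebra.adjoin A {z}, g b ∈ M := by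
      intro b hb
      induction hb using Algebra.adjoin_induction with
      | mem x hx => rw [Set.mem_singleton_iff.1 hx]; exact hzM
      | algebraMap a => rw [hcomm]; exact M.algebraMap_mem _
      | add x y _ _ hx hy => rw [map_add]; exact add_mem hx hy
      | mul x y _ _ hx hy => rw [map_mul]; exact mul_mem hx hy
    have hall : ∀ b : B, g b ∈ M := by
      intro b
      have h1 := hadjM _ (hadj b)
      rw [map_mul, map_pow, hcomm] at h1
      have h2 := div_mem h1 (pow_mem (M.algebraMap_mem (i ε)) m)
      rwa [mul_div_cancel_left₀ _ (pow_ne_zero m hε0)] at h2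
    intro e _
    obtain ⟨a, b, -, rfl⟩ := IsFractionRing.div_surjective (A := B ⧸ 𝔮) e
    obtain ⟨a, rfl⟩ := Ideal.Quotient.mk_surjective a
    obtain ⟨b, rfl⟩ := Ideal.Quotient.mk_surjective b
    exact div_mem (hall a) (hall b)
  · exact div_mul_cancel₀ _ (pow_ne_zero p hε0')

end Denominators

/-! ### The jump along the curves of a family -/

section Jumps

theorem mem_spec₁_of_ne {A : Type*} [CommRing A] [IsDomain A] [IsLocalRing A]
    (hdim : ringKrullDim A = 2) {𝔭 : Ideal A} [𝔭.IsPrime] (h0 : 𝔭 ≠ ⊥) (hm : 𝔭 ≠ maximalIdeal A) :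
    𝔭 ∈ spec₁ A := by
  refine ⟨‹_›, le_antisymm ?_ ?_⟩
  · obtain ⟨x, hx, hx0⟩ := Submodule.exists_mem_ne_zero_of_ne_bot h0
    have h1 := ringKrullDim_quotient_succ_le_of_nonZeroDivisor (mem_nonZeroDivisors_of_ne_zero hx0)
    have h2 : ringKrullDim (A ⧸ 𝔭) ≤ ringKrullDim (A ⧸ Ideal.span {x}) :=
      ringKrullDim_le_of_surjective
        (Ideal.Quotient.factor ((Ideal.span_singleton_le_iff_mem _).2 hx))
        (Ideal.Quotient.factor_surjective _)
    have h3 : ringKrullDim (A ⧸ 𝔭) + 1 ≤ 1 + 1 := by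
      refine (add_le_add_left h2 1).trans (h1.trans ?_)
      rw [hdim]; rfl
    exact ENat.WithBot.add_le_add_one_right_iff.1 h3
  · by_contra! hlt
    have h1 : Ring.KrullDimLE 0 (A ⧸ 𝔭) := by
      rw [Ring.krullDimLE_iff]
      exact ENat.WithBot.lt_add_one_iff.1 (by simpa using hlt)
    have h2 : IsField (A ⧸ 𝔭) := Ring.KrullDimLE.isField_of_isDomain
    exact hm (eq_maximalIdeal (Ideal.Quotient.maximal_of_isField _ h2))

theorem algebraMap_integralClosure_injective (A L : Type*) [CommRing A] [Field L] [Algebra A L]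
    [FaithfulSMul A L] : Function.Injective (algebraMap A (integralClosure A L)) := fun _ _ h ↦
  FaithfulSMul.algebraMap_injective A L (congrArg Subtype.val h)

theorem exists_jump_eq {A L : Type*} [CommRing A] [Field L] [Algebra A L] [FaithfulSMul A L] (p : ℕ)
    (𝔭 : Ideal A) [𝔭.IsPrime] :
    ∃ 𝔮 : Ideal (integralClosure A L), 𝔮.IsPrime ∧ 𝔮.under A = 𝔭 ∧ jump A L p 𝔭 =
      ramificationJump (A ⧸ 𝔮.under A) (FractionRing (integralClosure A L ⧸ 𝔮)) p := by
  have h : ∃ 𝔮 : Ideal (integralClosure A L), 𝔮.IsPrime ∧ 𝔮.under A = 𝔭 := by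
    obtain ⟨𝔮, h𝔮, h⟩ := Ideal.exists_ideal_over_prime_of_isIntegral_of_isDomain
      (S := integralClosure A L) 𝔭 (by
        rw [(RingHom.injective_iff_ker_eq_bot _).1 (algebraMap_integralClosure_injective A L)]
        exact bot_le)
    exact ⟨𝔮, h𝔮, h⟩
  exact ⟨h.choose, h.choose_spec.1, h.choose_spec.2, dif_pos h⟩

/-- The polynomial criterion for the jump, for the residue extensions of a given `A`-algebra `B` with
an Artin-Schreier equation whose denominator is a power of `X ^ a * Y ^ b`. -/
theorem IsGraphFamily.exists_polynomials_quotient {A : Type*} [CommRing A] [IsLocalRing A]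
    [IsNoetherianRing A] {L : Type*} [Field L] [Algebra A L] (p : ℕ) [Fact p.Prime] [CharP A p]
    [IsAlgClosed (ResidueField A)] {d r : ℕ} {X Y : A} {S : Set (Ideal A)}
    (h : IsGraphFamily L d r X Y S) {a b : ℕ} (hb : r = 1 ∧ d = 1 → b = 0)
    (hS : ∀ 𝔭 ∈ S, X ^ a * Y ^ b ∉ 𝔭) {B : Type*} [CommRing B] [Algebra A B]
    {j m : ℕ} {α : A} {z : B}
    (hz : z ^ p - algebraMap A B ((X ^ a * Y ^ b) ^ j) ^ (p - 1) * z = algebraMap A B α)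
    (hadj : ∀ x : B, algebraMap A B ((X ^ a * Y ^ b) ^ j) ^ m * x ∈ Algebra.adjoin A {z})
    {N : ℕ} {lam : ResidueField A → A} (hlam : IsSection N lam)
    (hN : r * (b * (j * p)) + a * (j * p) + r ≤ N) :
    ∃ q : ℕ → MvPolynomial (Finset.Icc r N) (ResidueField A), ∀ 𝔮 : Ideal B, 𝔮.IsPrime →
      𝔮.under A ∈ S → ∀ c ∈ coeffSpace (ResidueField A) d r N,
      curveGerm r N X Y lam c ∈ 𝔮.under A ⊔ maximalIdeal A ^ (N + 1) → ∀ s,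
      ramificationJump (A ⧸ 𝔮.under A) (FractionRing (B ⧸ 𝔮)) p ≤ s ↔
        ∀ i ∈ Finset.Icc 1 (r * (b * (j * p)) + a * (j * p)), s < i →
          MvPolynomial.eval c (q i) = 0 := by
  obtain ⟨q, hq⟩ := h.exists_polynomials p hlam α hN (fun hrd ↦ by rw [hb hrd, zero_mul])
  refine ⟨q, fun 𝔮 h𝔮 h𝔭 c hc hc' s ↦ ?_⟩
  have hδ : (X ^ a * Y ^ b) ^ j ∉ 𝔮.under A := fun h' ↦
    hS _ h𝔭 (Ideal.IsPrime.mem_of_pow_mem inferInstance j h')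
  have hfaith : FaithfulSMul (A ⧸ 𝔮.under A) (FractionRing (B ⧸ 𝔮)) := by
    rw [faithfulSMul_iff_algebraMap_injective, IsScalarTower.algebraMap_eq (A ⧸ 𝔮.under A) (B ⧸ 𝔮)]
    exact (IsFractionRing.injective (B ⧸ 𝔮) (FractionRing (B ⧸ 𝔮))).comp
      (Ideal.algebraMap_quotient_injective (I := 𝔮))
  let _ : Algebra (FractionRing (A ⧸ 𝔮.under A)) (FractionRing (B ⧸ 𝔮)) :=
    FractionRing.liftAlgebra _ _
  have : IsScalarTower (A ⧸ 𝔮.under A) (FractionRing (A ⧸ 𝔮.under A)) (FractionRing (B ⧸ 𝔮)) :=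
    FractionRing.isScalarTower_liftAlgebra _ _
  obtain ⟨θ, β, hθ, hgen, hβ⟩ := artinSchreier_quotient (F := FractionRing (A ⧸ 𝔮.under A))
    (E := FractionRing (B ⧸ 𝔮)) 𝔮 hz hadj hδ
  have hβ' : β * algebraMap (A ⧸ 𝔮.under A) (FractionRing (A ⧸ 𝔮.under A))
      (Ideal.Quotient.mk (𝔮.under A) X ^ (a * (j * p)) *
        Ideal.Quotient.mk (𝔮.under A) Y ^ (b * (j * p))) =
      algebraMap _ _ (Ideal.Quotient.mk (𝔮.under A) α) := by
    rw [← hβ, ← map_pow, ← map_pow, ← map_pow, ← map_pow, ← map_mul, ← pow_mul, mul_pow,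
      ← pow_mul, ← pow_mul]
  exact hq _ h𝔭 c hc hc' hθ hgen hβ' s

variable {A K L : Type*} [CommRing A] [IsDomain A] [IsLocalRing A] [IsNoetherianRing A]
    [IsIntegrallyClosed A] [Field K] [Algebra A K] [IsFractionRing A K]
    [Field L] [Algebra K L] [Algebra A L] [IsScalarTower A K L]

/-- A cyclic extension of degree `p` whose branch locus is contained in `δ = 0` is given by one
Artin-Schreier equation with denominator a power of `δ`, over all of `δ ≠ 0` at once. -/
theorem exists_artinSchreier_datum (hdim : ringKrullDim A = 2)
    (p : ℕ) [Fact p.Prime] [CharP A p] [IsGalois K L] [IsCyclic (L ≃ₐ[K] L)]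
    (hdeg : Module.finrank K L = p) {δ : A} (hδm : δ ∈ maximalIdeal A) (hδ0 : δ ≠ 0)
    (hδ : ∀ 𝔭 ∈ branchPrimes A L, δ ∈ 𝔭) :
    ∃ (j : ℕ) (α : A) (z : integralClosure A L) (m : ℕ),
      z ^ p - algebraMap A (integralClosure A L) (δ ^ j) ^ (p - 1) * z =
        algebraMap A (integralClosure A L) α ∧
      ∀ b : integralClosure A L,
        algebraMap A (integralClosure A L) (δ ^ j) ^ m * b ∈ Algebra.adjoin A {z} := by
  have hp := (Fact.out : p.Prime)
  have : FiniteDimensional K L := Module.finite_of_finrank_pos (hdeg ▸ hp.pos)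
  have : FaithfulSMul A L := by
    rw [faithfulSMul_iff_algebraMap_injective, IsScalarTower.algebraMap_eq A K L]
    exact (algebraMap K L).injective.comp (IsFractionRing.injective A K)
  set B := integralClosure A L
  have hinjB : Function.Injective (algebraMap A B) := algebraMap_integralClosure_injective A L
  have : FaithfulSMul A B := (faithfulSMul_iff_algebraMap_injective A B).2 hinjB
  have : IsNoetherianRing B := integralClosure.isNoetherianRing (A := A) (K := K) L
  have : IsFractionRing B L := integralClosure.isFractionRing_of_finite_extension K L
  have : CharP B p := charP_of_injective_algebraMap hinjB p
  obtain ⟨σ₀, hσ₀⟩ := IsCyclic.exists_generator (α := L ≃ₐ[K] L)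
  set σ := galRestrict A K L B σ₀ with hσ
  have hσL : ∀ b : B, ((σ b : B) : L) = σ₀ b := fun b ↦ algebraMap_galRestrict_apply A σ₀ b
  have hord : orderOf σ = p := by
    rw [hσ, MulEquiv.orderOf_eq, orderOf_eq_card_of_forall_mem_zpowers hσ₀,
      IsGalois.card_aut_eq_finrank, hdeg]
  have hinv : ∀ b : B, σ b = b → ∃ a, algebraMap A B a = b := by
    intro b hb
    have h1 := Algebra.isInvariant_of_isGalois' A K L B
    refine h1.1 b fun g ↦ ?_
    obtain ⟨g, rfl⟩ := (galRestrict A K L B).surjective g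
    obtain ⟨n, rfl⟩ := hσ₀ g
    have h2 : σ ∈ MulAction.stabilizer (B ≃ₐ[A] B) b := hb
    simpa using zpow_mem h2 n
  obtain ⟨j, α, z, hσz, hz⟩ := exists_artinSchreier_equation hord hinv (δ := δ) (by
    intro 𝔮 _ h0 hδ𝔮
    by_contra hram
    refine hδ𝔮 (hδ _ ⟨mem_spec₁_of_ne hdim h0 ?_, 𝔮, ‹_›, rfl, hram⟩)
    intro h
    exact hδ𝔮 (h ▸ hδm))
  have hε0 : algebraMap A B (δ ^ j) ≠ 0 := by
    rw [Ne, map_eq_zero_iff _ hinjB]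
    exact pow_ne_zero j hδ0
  have hgen : IntermediateField.adjoin K {(z : L)} = ⊤ := by
    have := IntermediateField.isSimpleOrder_of_finrank_prime K L (hdeg.symm ▸ hp)
    refine (eq_bot_or_eq_top _).resolve_left fun h ↦ ?_
    rw [IntermediateField.adjoin_simple_eq_bot_iff, IntermediateField.mem_bot] at h
    obtain ⟨x, hx⟩ := h
    have h1 : σ z = z := Subtype.ext (by rw [hσL, ← hx, AlgEquiv.commutes])
    rw [hσz, sub_eq_self] at h1
    exact hε0 h1
  obtain ⟨m, hm⟩ := exists_pow_mul_mem_adjoin (A := A) (K := K) hdeg (ε := δ ^ j) (α := α)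
    (z := (z : L)) (congrArg (algebraMap B L) hz) hgen
  refine ⟨j, α, z, m, hz, fun b ↦ ?_⟩
  have h1 : Algebra.adjoin A {(z : L)} = (Algebra.adjoin A {z}).map (B.val) := by
    rw [AlgHom.map_adjoin, Set.image_singleton]; rfl
  have h2 := hm b b.2
  rw [h1] at h2
  obtain ⟨y, hy, hy'⟩ := h2
  have : y = algebraMap A B (δ ^ j) ^ m * b := Subtype.ext hy'
  exact this ▸ hy

/-- The condition that the jump along a curve of a graph family avoiding the branch locus is at most
`s` is polynomial in the coefficients of the curve. -/
theorem IsGraphFamily.exists_jump_polynomials (hdim : ringKrullDim A = 2)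
    (p : ℕ) [Fact p.Prime] [CharP A p] [IsAlgClosed (ResidueField A)] [IsGalois K L]
    [IsCyclic (L ≃ₐ[K] L)] (hdeg : Module.finrank K L = p) {d r : ℕ} {X Y : A} {S : Set (Ideal A)}
    (h : IsGraphFamily L d r X Y S) {a b : ℕ} (hb : r = 1 ∧ d = 1 → b = 0)
    (hm : X ^ a * Y ^ b ∈ maximalIdeal A) (h0 : X ^ a * Y ^ b ≠ 0)
    (hbranch : ∀ 𝔭 ∈ branchPrimes A L, X ^ a * Y ^ b ∈ 𝔭)
    (hS : ∀ 𝔭 ∈ S, X ^ a * Y ^ b ∉ 𝔭) :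
    ∃ D e : ℕ, ∀ N, D ≤ N → ∀ lam : ResidueField A → A, IsSection N lam →
      ∃ q : ℕ → MvPolynomial (Finset.Icc r N) (ResidueField A),
      ∀ 𝔭 ∈ S, ∀ c ∈ coeffSpace (ResidueField A) d r N,
      curveGerm r N X Y lam c ∈ 𝔭 ⊔ maximalIdeal A ^ (N + 1) →
      ∀ s, jump A L p 𝔭 ≤ s ↔ ∀ i ∈ Finset.Icc 1 e, s < i → MvPolynomial.eval c (q i) = 0 := by
  obtain ⟨j, α, z, m, hz, hadj⟩ := exists_artinSchreier_datum (K := K) (L := L) hdim p hdeg hm h0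
    hbranch
  have : FaithfulSMul A L := by
    rw [faithfulSMul_iff_algebraMap_injective, IsScalarTower.algebraMap_eq A K L]
    exact (algebraMap K L).injective.comp (IsFractionRing.injective A K)
  refine ⟨r * (b * (j * p)) + a * (j * p) + r, r * (b * (j * p)) + a * (j * p),
    fun N hN lam hlam ↦ ?_⟩
  obtain ⟨q, hq⟩ := h.exists_polynomials_quotient p hb hS hz hadj hlam hN
  refine ⟨q, fun 𝔭 h𝔭 c hc hc' s ↦ ?_⟩
  have : 𝔭.IsPrime := (h.mem_regularCurves h𝔭).1.1
  obtain ⟨𝔮, h𝔮, rfl, hjump⟩ := exists_jump_eq (L := L) p 𝔭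
  rw [hjump]
  exact hq 𝔮 h𝔮 h𝔭 c hc hc' s

end Jumps

/-! ### Tangent curves of a normal crossing branch divisor -/

section Tangent

variable {A L : Type*} [CommRing A] [IsLocalRing A] [Field L] [Algebra A L]
  {d r : ℕ} {P : Fin d → Ideal A} {T U : A}

theorem mem_tangentPrimes_iff (hP : IsNormalCrossingBranch A L P) (hTU : IsAdapted P T U)
    {𝔭 : Ideal A} (h𝔭 : 𝔭 ∈ regularCurves A) :
    𝔭 ∈ tangentPrimes A L P r ↔ (T ∈ 𝔭 ⊔ maximalIdeal A ^ r ∧ T ∉ 𝔭 ⊔ maximalIdeal A ^ (r + 1)) ∧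
      (d = 2 → U ∉ 𝔭 ⊔ maximalIdeal A ^ 2) := by
  have hUm : U ∈ maximalIdeal A := by rw [← hTU.1]; exact Ideal.subset_span (by simp)
  have h1 : (∀ i : Fin d, interNum 𝔭 (P i) = if (i : ℕ) = 0 then (r : ℕ∞) else 1) ↔
      (T ∈ 𝔭 ⊔ maximalIdeal A ^ r ∧ T ∉ 𝔭 ⊔ maximalIdeal A ^ (r + 1)) ∧
      (d = 2 → U ∉ 𝔭 ⊔ maximalIdeal A ^ 2) := by
    have hU : interNum 𝔭 (Ideal.span {U}) = 1 ↔ U ∉ 𝔭 ⊔ maximalIdeal A ^ 2 := by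
      have := interNum_eq_iff h𝔭 U 1
      rw [Nat.cast_one] at this
      rw [this, and_iff_right]
      rw [pow_one]
      exact Ideal.mem_sup_right hUm
    rw [← hU, ← interNum_eq_iff h𝔭]
    constructor
    · intro h
      refine ⟨?_, fun hd ↦ ?_⟩
      · have := h ⟨0, hP.one_le⟩
        rwa [hTU.2] at this
      · have := h ⟨1, by omega⟩
        rwa [hTU.2] at this
    · rintro ⟨hT, hU⟩ i
      rw [hTU.2]
      split_ifs with hi
      · exact hT
      · have := hP.le_two
        exact hU (by omega)
  rw [← h1]
  refine ⟨fun h ↦ h.2, fun h ↦ ⟨⟨h𝔭.1, h𝔭.2, fun hb ↦ ?_⟩, h⟩⟩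
  rw [← hP.range_eq] at hb
  obtain ⟨i, rfl⟩ := hb
  have h2 := h i
  rw [interNum_self h𝔭] at h2
  split_ifs at h2
  · exact ENat.top_ne_natCast r h2
  · exact ENat.top_ne_natCast 1 h2

theorem maximalIdeal_not_le_sup_sq {𝔭 : Ideal A} (h𝔭 : 𝔭 ∈ regularCurves A) :
    ¬ maximalIdeal A ≤ 𝔭 ⊔ maximalIdeal A ^ 2 := by
  have : 𝔭.IsPrime := h𝔭.1.1
  have := isDiscreteValuationRing_of_mem_regularCurves h𝔭
  intro h
  obtain ⟨ϖ, hϖ⟩ := IsDiscreteValuationRing.exists_irreducible (A ⧸ 𝔭)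
  obtain ⟨x, rfl⟩ := Ideal.Quotient.mk_surjective ϖ
  have hx : x ∈ maximalIdeal A := fun hu ↦ hϖ.not_isUnit (hu.map _)
  have h1 := (mem_sup_pow_iff_dvd hϖ x 2).1 (h hx)
  have h2 := (pow_dvd_pow_iff hϖ.ne_zero hϖ.not_isUnit (n := 2) (m := 1)).1 (by simpa using h1)
  omega

theorem isGraphFamily_of_one (hP : IsNormalCrossingBranch A L P) (hTU : IsAdapted P T U)
    (hrd : r = 1 ∧ d = 1) : IsGraphFamily L d r T U (tangentPrimes A L P r) := by
  refine ⟨hTU.1, fun _ h ↦ h.1, fun 𝔭 h𝔭 ↦ ?_⟩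
  have hm : T ∈ maximalIdeal A ∧ U ∈ maximalIdeal A := by
    rw [← hTU.1]
    exact ⟨Ideal.subset_span (by simp), Ideal.subset_span (by simp)⟩
  rw [mem_tangentPrimes_iff hP hTU h𝔭, hrd.1, pow_one]
  constructor
  · rintro ⟨⟨-, h⟩, -⟩
    exact ⟨h, Ideal.mem_sup_right hm.2, fun h ↦ absurd ⟨rfl, hrd.2⟩ h⟩
  · rintro ⟨h, -, -⟩
    exact ⟨⟨Ideal.mem_sup_right hm.1, h⟩, by omega⟩

theorem isGraphFamily_of_ne_one (hP : IsNormalCrossingBranch A L P) (hTU : IsAdapted P T U)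
    (hr : 1 ≤ r) (hrd : ¬ (r = 1 ∧ d = 1)) :
    IsGraphFamily L d r U T (tangentPrimes A L P r) := by
  refine ⟨by rw [Set.pair_comm]; exact hTU.1, fun _ h ↦ h.1, fun 𝔭 h𝔭 ↦ ?_⟩
  rw [mem_tangentPrimes_iff hP hTU h𝔭]
  have hd := hP.le_two
  have hd' := hP.one_le
  constructor
  · rintro ⟨⟨h1, h2⟩, h3⟩
    refine ⟨?_, h1, fun _ ↦ h2⟩
    by_cases hd2 : d = 2
    · exact h3 hd2
    · -- a curve tangent to `T = 0` is transversal to `U = 0`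
      intro hU
      refine maximalIdeal_not_le_sup_sq h𝔭 ?_
      rw [← hTU.1, Ideal.span_le, Set.insert_subset_iff, Set.singleton_subset_iff, hTU.1]
      exact ⟨(show 𝔭 ⊔ maximalIdeal A ^ r ≤ 𝔭 ⊔ maximalIdeal A ^ 2 from
        sup_le_sup_left (Ideal.pow_le_pow_right (by omega)) 𝔭) h1, hU⟩
  · rintro ⟨h1, h2, h3⟩
    exact ⟨⟨h2, h3 hrd⟩, fun _ ↦ h1⟩

end Tangent

/-! ### Sufficient jets and semicontinuity of the jump -/

section Main

variable {A K L : Type*} [CommRing A] [IsDomain A] [IsLocalRing A] [IsNoetherianRing A]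
    [IsIntegrallyClosed A] [Field K] [Algebra A K] [IsFractionRing A K]
    [Field L] [Algebra K L] [Algebra A L] [IsScalarTower A K L]

/-- For a graph family avoiding the branch locus, jets of order at least the sufficient jet order
are parametrized by their coefficients, and the ramification jump is lower semicontinuous. -/
theorem IsGraphFamily.bijOn_and_exists_zeroLocus (hdim : ringKrullDim A = 2)
    (p : ℕ) [Fact p.Prime] [CharP A p] [IsAlgClosed (ResidueField A)] [IsGalois K L]
    [IsCyclic (L ≃ₐ[K] L)] (hdeg : Module.finrank K L = p) {d r : ℕ} (hr : 1 ≤ r)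
    {P : Fin d → Ideal A} {X Y : A} (h : IsGraphFamily L d r X Y (tangentPrimes A L P r))
    {a b : ℕ} (hb : r = 1 ∧ d = 1 → b = 0) (hm : X ^ a * Y ^ b ∈ maximalIdeal A)
    (hbranch : ∀ 𝔭 ∈ branchPrimes A L, X ^ a * Y ^ b ∈ 𝔭)
    (hS : ∀ 𝔭 ∈ tangentPrimes A L P r, X ^ a * Y ^ b ∉ 𝔭)
    {n : ℕ} (hn : sufficientJetOrder A L p P r ≤ n) {lam : ResidueField A → A}
    (hlam : IsSection n lam) :
    Set.BijOn (fun c ↦ jet A L n (Ideal.span {curveGerm r n X Y lam c}))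
      (coeffSpace (ResidueField A) d r n) (tangentJets A L P r n) ∧
    ∀ s : ℕ, ∃ I : Ideal (MvPolynomial (Finset.Icc r n) (ResidueField A)),
      jet A L n '' {𝔭 | 𝔭 ∈ tangentPrimes A L P r ∧ jump A L p 𝔭 ≤ s} =
        (fun c ↦ jet A L n (Ideal.span {curveGerm r n X Y lam c})) ''
        (coeffSpace (ResidueField A) d r n ∩ MvPolynomial.zeroLocus (ResidueField A) I) := by
  refine ⟨h.bijOn hdim p hr hlam, fun s ↦ ?_⟩
  have hX : X ≠ 0 := ne_zero_of_span_pair_eq hdim h.span_eq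
  have hY : Y ≠ 0 := ne_zero_of_span_pair_eq hdim (Set.pair_comm X Y ▸ h.span_eq)
  obtain ⟨D, e, hD⟩ := h.exists_jump_polynomials (K := K) hdim p hdeg hb hm
    (mul_ne_zero (pow_ne_zero a hX) (pow_ne_zero b hY)) hbranch hS
  set N := max (max n r) D
  have hnN : n ≤ N := (le_max_left n r).trans (le_max_left _ D)
  have hrN : r ≤ N := (le_max_right n r).trans (le_max_left _ D)
  obtain ⟨lam', hlam'⟩ := exists_isSection (A := A) p N
  obtain ⟨q, hq⟩ := hD N (le_max_right _ _) lam' hlam'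
  -- the jump is determined by the jet of order `N`, so that the sufficient jet order is attained
  have hmem : sufficientJetOrder A L p P r ∈ {s : ℕ | ∀ 𝔭 ∈ tangentPrimes A L P r,
      ∀ 𝔭' ∈ tangentPrimes A L P r, ((s + 1 : ℕ) : ℕ∞) ≤ interNum 𝔭 𝔭' →
      jump A L p 𝔭 = jump A L p 𝔭'} := by
    refine Nat.sInf_mem ⟨N, fun 𝔭 h𝔭 𝔭' h𝔭' hle ↦ ?_⟩
    obtain ⟨c, hc, hc'⟩ := h.exists_coeff hlam'.residue_eq h𝔭 N
    have h1 := sup_pow_eq_of_le_interNum (h.mem_regularCurves h𝔭) (h.mem_regularCurves h𝔭') hle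
    have h2 : ∀ s, jump A L p 𝔭 ≤ s ↔ jump A L p 𝔭' ≤ s := fun s ↦
      (hq 𝔭 h𝔭 c hc hc' s).trans (hq 𝔭' h𝔭' c hc (h1 ▸ hc') s).symm
    exact le_antisymm ((h2 _).2 le_rfl) ((h2 _).1 le_rfl)
  refine h.exists_zeroLocus hdim p hr hlam hnN hrN hlam' (fun 𝔭 ↦ jump A L p 𝔭 ≤ s)
    (fun 𝔭 h𝔭 𝔮 h𝔮 hle ↦ ?_) (q '' {i | i ∈ Finset.Icc 1 e ∧ s < i}) fun 𝔭 h𝔭 c hc hc' ↦ ?_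
  · rw [hmem 𝔭 h𝔭 𝔮 h𝔮 (le_trans (by exact_mod_cast Nat.succ_le_succ hn) hle)]
  · rw [hq 𝔭 h𝔭 c hc hc' s, Set.forall_mem_image]
    simp only [Set.mem_ofPred_eq, and_imp]

end Main

theorem theorem2 {A K L : Type*} [CommRing A] [IsRegularLocalRing A] (hdim : ringKrullDim A = 2)
    (p : ℕ) [Fact p.Prime] [CharP A p] [IsAlgClosed (ResidueField A)]
    [Field K] [Algebra A K] [IsFractionRing A K]
    [Field L] [Algebra K L] [Algebra A L] [IsScalarTower A K L]
    [IsGalois K L] [IsCyclic (L ≃ₐ[K] L)] (hdeg : Module.finrank K L = p)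
    {d : ℕ} (P : Fin d → Ideal A) (hP : IsNormalCrossingBranch A L P)
    (r : ℕ) (hr : 1 ≤ r) (n : ℕ) (hn : sufficientJetOrder A L p P r ≤ n)
    (T U : A) (hTU : IsAdapted P T U)
    (lam : ResidueField A → A) (hlam : IsSection n lam) :
    Set.BijOn (coeffJet A L d r n T U lam) (coeffSpace (ResidueField A) d r n)
      (tangentJets A L P r n) ∧
    ∀ s : ℕ, IsZariskiClosed A L d r n T U lam
      (jet A L n '' {𝔭 | 𝔭 ∈ tangentPrimes A L P r ∧ jump A L p 𝔭 ≤ s}) := by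
  have : IsDomain A := (IsFractionRing.injective A K).isDomain
  have := uniqueFactorizationMonoid_of_ringKrullDim_eq_two hdim hTU.1
  have : IsIntegrallyClosed A := inferInstance
  have hTm : T ∈ maximalIdeal A := by rw [← hTU.1]; exact Ideal.subset_span (by simp)
  have hbranch : ∀ 𝔭 ∈ branchPrimes A L, T ∈ 𝔭 ∨ (d = 2 ∧ U ∈ 𝔭) := by
    intro 𝔭 h𝔭
    rw [← hP.range_eq] at h𝔭
    obtain ⟨i, rfl⟩ := h𝔭
    rw [hTU.2]
    split_ifs with hi
    · exact Or.inl (Ideal.mem_span_singleton_self T)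
    · have := hP.le_two
      exact Or.inr ⟨by omega, Ideal.mem_span_singleton_self U⟩
  have hS : ∀ 𝔭 ∈ tangentPrimes A L P r, T ∉ 𝔭 ∧ (d = 2 → U ∉ 𝔭) := by
    intro 𝔭 h𝔭
    have h1 := (mem_tangentPrimes_iff hP hTU (mem_regularCurves_of_mem_regularUnramified h𝔭.1)).1 h𝔭
    exact ⟨fun h ↦ h1.1.2 (Ideal.mem_sup_left h), fun hd h ↦ h1.2 hd (Ideal.mem_sup_left h)⟩
  by_cases hrd : r = 1 ∧ d = 1
  · have e : coeffJet A L d r n T U lam =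
        fun c ↦ jet A L n (Ideal.span {curveGerm r n T U lam c}) := by
      funext c; rw [coeffJet, germ, if_pos hrd]; rfl
    unfold IsZariskiClosed
    rw [e]
    refine (isGraphFamily_of_one hP hTU hrd).bijOn_and_exists_zeroLocus (K := K) hdim p hdeg hr
      (a := 1) (b := 0) (fun _ ↦ rfl) (by simpa using hTm) (fun 𝔭 h𝔭 ↦ ?_) (fun 𝔭 h𝔭 ↦ ?_) hn hlam
    · rcases hbranch 𝔭 h𝔭 with h | h
      · simpa using h
      · omega
    · simpa using (hS 𝔭 h𝔭).1
  · have e : coeffJet A L d r n T U lam =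
        fun c ↦ jet A L n (Ideal.span {curveGerm r n U T lam c}) := by
      funext c; rw [coeffJet, germ, if_neg hrd]; rfl
    unfold IsZariskiClosed
    rw [e]
    refine (isGraphFamily_of_ne_one hP hTU hr hrd).bijOn_and_exists_zeroLocus (K := K) hdim p hdeg
      hr (a := d - 1) (b := 1) (fun h ↦ absurd h hrd) (Ideal.mul_mem_left _ _ (by simpa using hTm))
      (fun 𝔭 h𝔭 ↦ ?_) (fun 𝔭 h𝔭 h ↦ ?_) hn hlam
    · rcases hbranch 𝔭 h𝔭 with h | ⟨rfl, h⟩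
      · exact Ideal.mul_mem_left _ _ (by simpa using h)
      · exact Ideal.mul_mem_right _ _ (by simpa using h)
    · have := h𝔭.1.1.1
      have hd := hP.le_two
      have hd' := hP.one_le
      rcases this.mem_or_mem h with h | h
      · obtain rfl | rfl : d = 1 ∨ d = 2 := by omega
        · exact this.ne_top ((Ideal.eq_top_iff_one _).2 (by simpa using h))
        · exact (hS 𝔭 h𝔭).2 rfl (by simpa using h)
      · exact (hS 𝔭 h𝔭).1 (by simpa using h)
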